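/- **Setting.** Let $d\ge 2$, let $M$ be a smooth Hausdorff second countable manifold of dimension $d+1$ and $\mathscr F$ the space of smooth tensor fields $\phi$ on $M$ of a fixed (finite-dimensional) tensor type with values in a fixed open $GL(d+1)$-invariant set of admissible values (for gravity: a Lorentzian metric together with any tensor matter fields). On local differential forms on $\mathscr F$ with values in spacetime forms (possibly depending on background structures), $\delta$ is the field-space exterior derivative, $d$ the spacetime one, $I_V$ and $L_V=I_V\delta+\delta I_V$ are contraction and Lie derivative along a field-space vector field $V$, and $i_\xi,\pounds_\xi$ their spacetime counterparts. A vector field $\xi$ on $M$, possibly field-dependent, defines $\hat\xi$ by $I_{\hat\xi}\delta\phi=\pounds_\xi\phi$; $I_{\widehat{\delta\xi}}$ is the derivation that replaces $\delta\phi$ by $\pounds_{\delta\xi}\phi$; the anomaly operator is $\Delta_{\hat\xi}=L_{\hat\xi}-\pounds_\xi-I_{\widehat{\delta\xi}}$; and $\llbracket\xi,\zeta\rrbracket=[\xi,\zeta]-I_{\hat\xi}\delta\zeta+I_{\hat\zeta}\delta\xi$. **Theory.** Let $L',\theta',b',\lambda'$ be local forms with $\delta L'=E\cdot\delta\phi+d\theta'$,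 and with $\Delta_{\hat v}L'=d\Delta_{\hat v}b'$ and $\Delta_{\hat v}\theta'=\Delta_{\hat v}\delta b'+d\Delta_{\hat v}\lambda'$ for all vector fields $v$. Let $U\subset M$ be open and let $\mathscr S_U\subset\mathscr F$ be the set of $\phi$ with $E=0$ on $U$. Let $Q_v$ be a local $(d-1)$-form on $M$, linear in $v$ and covariantly constructed from $v$ and $\phi$ (that is, $\Delta_{\hat u}Q_v=-Q_{[u,v]}$ for field-independent $u,v$), which for $\phi\in\mathscr S_U$ satisfies $$dQ_v=I_{\hat v}(\theta'-\delta b'-d\lambda')-i_v(L'-db')\quad\text{on }U .$$ **Boundary.** Let $\mathcal N\subset\partial U$ be a smoothly embedded hypersurface of $M$, and let $\ell',\beta',\mathcal E,c',\gamma',\varepsilon$ be local forms on $\mathcal N$ such that on $\mathcal N$ (with the pullbacks to $\mathcal N$ understood) $$\theta'=-\delta\ell'+d\beta'+\mathcal E,\qquad \beta'-\lambda'=-\delta c'+d\gamma'+\varepsilon .$$ Let $\Sigma$ be a smooth singular $d$-chain in $\overline U$ (for example a compact oriented slice with boundary) whose boundary $\partial\Sigma$ is a chain in $\mathcal N$.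 For a (possibly field-dependent) smooth vector field $\xi$ tangent to $\mathcal N$ put $$h_\xi=Q_\xi+i_\xi b'+I_{\hat\xi}\lambda'+i_\xi\ell'-I_{\hat\xi}\beta',\qquad \tilde h_\xi=h_\xi-\Delta_{\hat\xi}c',\qquad \tilde H_\xi=\int_{\partial\Sigma}\tilde h_\xi,$$ $$\tilde{\mathcal F}_{\hat\xi}=\int_{\partial\Sigma}\left(i_\xi\mathcal E-\Delta_{\hat\xi}\varepsilon+\tilde h_{\delta\xi}\right),\qquad \Omega=\int_\Sigma\delta\theta'-\int_{\partial\Sigma}\delta\beta',$$ and define the Barnich–Troessaert bracket of the improved charges by $$\{\tilde H_\xi,\tilde H_\zeta\}=I_{\hat\xi}I_{\hat\zeta}\Omega-I_{\hat\xi}\tilde{\mathcal F}_{\hat\zeta}+I_{\hat\zeta}\tilde{\mathcal F}_{\hat\xi}.$$ **Claim.** For all (possibly field-dependent) smooth vector fields $\xi,\zeta$ tangent to $\mathcal N$, at every $\phi\in\mathscr S_U$ the derivative $I_{\hat\xi}\delta\tilde H_\zeta$ exists and $$\{\tilde H_\xi,\tilde H_\zeta\}=-I_{\hat\xi}\delta\tilde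 H_\zeta+I_{\hat\zeta}\tilde{\mathcal F}_{\hat\xi},\qquad \{\tilde H_\xi,\tilde H_\zeta\}=\tilde H_{\llbracket\xi,\zeta\rrbracket}+\tilde K_{\xi,\zeta},$$ $$\tilde K_{\xi,\zeta}=\int_{\partial\Sigma}\left(i_\xi\Delta_{\hat\zeta}(\ell'+b'+dc')-i_\zeta\Delta_{\hat\xi}(\ell'+b'+dc')\right).$$ -/

import Mathlib

open scoped Manifold ContDiff Topology
open Set

namespace CovPhase

noncomputable section

/-! ### Differential forms and vector fields on a manifold

A manifold `X` of dimension `n` is modelled on `Euc n`; its tangent space at `x` is by definition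
`Euc n`, identified through the preferred chart at `x`. -/

abbrev Euc (n : ℕ) : Type := EuclideanSpace ℝ (Fin n)

/-- Vector fields on an `n`-dimensional manifold (no regularity imposed). -/
abbrev VField (n : ℕ) (X : Type*) : Type _ := X → Euc n

/-- Differential `k`-forms on an `n`-dimensional manifold (no regularity imposed). -/
abbrev DForm (n k : ℕ) (X : Type*) : Type _ := X → (Euc n [⋀^Fin k]→L[ℝ] ℝ)

/-- Interior product `i_v α`. -/
def contract {n k : ℕ} {X : Type*} (v : VField n X) (α : DForm n (k + 1) X) : DForm n k X :=
  fun x => (α x).curryLeft (v x)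

section Geometry

variable {n m k : ℕ} {X : Type*} [TopologicalSpace X] [ChartedSpace (Euc n) X]
  [IsManifold 𝓘(ℝ, Euc n) ∞ X] {Y : Type*} [TopologicalSpace Y] [ChartedSpace (Euc m) Y]

/-- The form `α` read in the chart centred at `x₀`. -/
def formInChart (x₀ : X) (α : DForm n k X) : Euc n → (Euc n [⋀^Fin k]→L[ℝ] ℝ) := fun y =>
  (α ((extChartAt 𝓘(ℝ, Euc n) x₀).symm y)).compContinuousLinearMap
    (tangentCoordChange 𝓘(ℝ, Euc n) x₀ ((extChartAt 𝓘(ℝ, Euc n) x₀).symm y)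
      ((extChartAt 𝓘(ℝ, Euc n) x₀).symm y))

/-- The vector field `v` read in the chart centred at `x₀`. -/
def vfieldInChart (x₀ : X) (v : VField n X) : Euc n → Euc n := fun y =>
  tangentCoordChange 𝓘(ℝ, Euc n) ((extChartAt 𝓘(ℝ, Euc n) x₀).symm y) x₀
    ((extChartAt 𝓘(ℝ, Euc n) x₀).symm y) (v ((extChartAt 𝓘(ℝ, Euc n) x₀).symm y))

/-- Exterior derivative. -/
def dForm (α : DForm n k X) : DForm n (k + 1) X := fun x =>
  extDeriv (formInChart x α) (extChartAt 𝓘(ℝ, Euc n) x x)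

/-- Lie derivative of a form of positive degree, `£_v = i_v d + d i_v`. -/
def lieForm (v : VField n X) (α : DForm n (k + 1) X) : DForm n (k + 1) X :=
  contract v (dForm α) + dForm (contract v α)

/-- Pullback of a form along a map. -/
def pullForm (f : Y → X) (α : DForm n k X) : DForm m k Y := fun y =>
  (α (f y)).compContinuousLinearMap
    (mfderiv 𝓘(ℝ, Euc m) 𝓘(ℝ, Euc n) f y : Euc m →L[ℝ] Euc n)

/-- `v` is tangent, at the point `f y`, to the image of the immersion `f`. -/
def TangentAt (f : Y → X) (v : VField n X) (y : Y) : Prop :=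
  v (f y) ∈ range (mfderiv 𝓘(ℝ, Euc m) 𝓘(ℝ, Euc n) f y : Euc m →L[ℝ] Euc n)

/-- The vector field on `Y` induced by a vector field on `X` tangent to the immersion `f : Y → X`:
the unique `u` with `df (u y) = v (f y)`. -/
def restrictVF (f : Y → X) (v : VField n X) : VField m Y := fun y =>
  Function.invFun (mfderiv 𝓘(ℝ, Euc m) 𝓘(ℝ, Euc n) f y : Euc m →L[ℝ] Euc n) (v (f y))

/-- Lie bracket of vector fields. -/
def vfBracket (u v : VField n X) : VField n X := fun x =>
  (VectorField.mlieBracket 𝓘(ℝ, Euc n) u v x : Euc n)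

/-- Smoothness of a vector field. -/
def SmoothVF (v : VField n X) : Prop :=
  ∀ x₀ : X, ContDiffAt ℝ ∞ (vfieldInChart x₀ v) (extChartAt 𝓘(ℝ, Euc n) x₀ x₀)

/-- Joint smoothness, near `(t₀, x₀)`, of a finite-dimensional family of vector fields. -/
def SmoothVFFamilyAt {p : ℕ} (v : (Fin p → ℝ) → VField n X) (t₀ : Fin p → ℝ) (x₀ : X) : Prop :=
  ContDiffAt ℝ ∞ (fun q : (Fin p → ℝ) × Euc n => vfieldInChart x₀ (v q.1) q.2)
    (t₀, extChartAt 𝓘(ℝ, Euc n) x₀ x₀)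

/-- Joint smoothness, near `(t₀, x₀)`, of a finite-dimensional family of forms. -/
def SmoothFormFamilyAt {p : ℕ} (α : (Fin p → ℝ) → DForm n k X) (t₀ : Fin p → ℝ) (x₀ : X) : Prop :=
  ContDiffAt ℝ ∞ (fun q : (Fin p → ℝ) × Euc n => formInChart x₀ (α q.1) q.2)
    (t₀, extChartAt 𝓘(ℝ, Euc n) x₀ x₀)

end Geometry

/-! ### Smooth singular chains and integration -/

/-- A smooth singular `k`-cube. Only its restriction to `[0,1]^k` enters the integrals. -/
structure SmoothCube (n k : ℕ) (X : Type*) [TopologicalSpace X] [ChartedSpace (Euc n) X] where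
  map : (Fin k → ℝ) → X
  smooth : ContMDiff 𝓘(ℝ, Fin k → ℝ) 𝓘(ℝ, Euc n) ∞ map

/-- Integral smooth singular `k`-chains. -/
abbrev Chain (n k : ℕ) (X : Type*) [TopologicalSpace X] [ChartedSpace (Euc n) X] : Type _ :=
  SmoothCube n k X →₀ ℤ

section Chains

variable {n m k : ℕ} {X : Type*} [TopologicalSpace X] [ChartedSpace (Euc n) X]
  {Y : Type*} [TopologicalSpace Y] [ChartedSpace (Euc m) Y]

/-- The face of a cube on which the `i`-th coordinate equals `a`. -/
def SmoothCube.face (σ : SmoothCube n (k + 1) X) (i : Fin (k + 1)) (a : ℝ) :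
    SmoothCube n k X where
  map := fun t => σ.map (i.insertNth (α := fun _ => ℝ) a t)
  smooth := by
    refine σ.smooth.comp (ContDiff.contMDiff ?_)
    rw [contDiff_pi]
    intro j
    refine Fin.succAboveCases i ?_ (fun j => ?_) j
    · simpa using contDiff_const
    · simpa using contDiff_apply ℝ ℝ j

/-- `∂σ = ∑ i, (-1)^i (σ|_{t_i = 1} - σ|_{t_i = 0})`, extended additively. -/
def Chain.boundary (c : Chain n (k + 1) X) : Chain n k X :=
  c.sum fun σ a => ∑ i : Fin (k + 1),
    ((-1) ^ (i : ℕ) * a) • (Finsupp.single (σ.face i 1) 1 - Finsupp.single (σ.face i 0) 1)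

/-- Image of a chain under a smooth map. -/
def Chain.push (f : Y → X) (hf : ContMDiff 𝓘(ℝ, Euc m) 𝓘(ℝ, Euc n) ∞ f) (c : Chain m k Y) :
    Chain n k X :=
  Finsupp.mapDomain (fun σ => ⟨f ∘ σ.map, hf.comp σ.smooth⟩) c

/-- Integral of a `k`-form over a smooth singular `k`-cube. -/
def SmoothCube.integral (σ : SmoothCube n k X) (α : DForm n k X) : ℝ :=
  ∫ t in Icc (0 : Fin k → ℝ) 1, α (σ.map t) (fun i =>
    (mfderiv 𝓘(ℝ, Fin k → ℝ) 𝓘(ℝ, Euc n) σ.map t : (Fin k → ℝ) →L[ℝ] Euc n) (Pi.single i 1))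

/-- Integral of a `k`-form over a `k`-chain. -/
def Chain.integral (c : Chain n k X) (α : DForm n k X) : ℝ :=
  c.sum fun σ a => (a : ℝ) * σ.integral α

end Chains

/-! ### Dynamical fields -/

/-- A type of tensor fields in dimension `n`: a smooth representation `act` of `GL(n)` on a
finite-dimensional space `W` (used only on invertible arguments), together with an open invariant
set of admissible values. For gravity, `W` is the sum of the symmetric `(0,2)`-tensors with the
space of tensors of the matter fields, and `values` is the condition that the symmetric tensor is
Lorentzian. -/
structure TensorType (n : ℕ) (W : Type*) [NormedAddCommGroup W] [NormedSpace ℝ W] where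
  act : (Euc n →L[ℝ] Euc n) → (W →L[ℝ] W)
  act_one : act 1 = 1
  act_mul : ∀ A B, IsUnit A → IsUnit B → act (A * B) = act A * act B
  act_smooth : ContDiffOn ℝ ∞ act {A | IsUnit A}
  values : Set W
  isOpen_values : IsOpen values
  act_values : ∀ A, IsUnit A → ∀ w ∈ values, act A w ∈ values

/-- Derivative at `φ`, in the direction `ψ`, of a functional `A` of the fields with values in
(pointwise) functions on `X`. -/
def fieldDeriv {M X W G : Type*} [NormedAddCommGroup W] [NormedSpace ℝ W]
    [NormedAddCommGroup G] [NormedSpace ℝ G]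
    (A : (M → W) → X → G) (φ ψ : M → W) : X → G :=
  fun x => deriv (fun t : ℝ => A (φ + t • ψ) x) 0

section Fields

variable {n l k : ℕ} {W : Type*} [NormedAddCommGroup W] [NormedSpace ℝ W] (T : TensorType n W)
  {M : Type*} [TopologicalSpace M] [ChartedSpace (Euc n) M] [IsManifold 𝓘(ℝ, Euc n) ∞ M]
  {X : Type*} [TopologicalSpace X] [ChartedSpace (Euc l) X] [IsManifold 𝓘(ℝ, Euc l) ∞ X]

/-- The tensor field `φ` read in the chart centred at `x₀`. -/
def fieldInChart (x₀ : M) (φ : M → W) : Euc n → W := fun y =>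
  T.act (tangentCoordChange 𝓘(ℝ, Euc n) ((extChartAt 𝓘(ℝ, Euc n) x₀).symm y) x₀
    ((extChartAt 𝓘(ℝ, Euc n) x₀).symm y)) (φ ((extChartAt 𝓘(ℝ, Euc n) x₀).symm y))

/-- Smooth tensor fields; these are also the field variations. -/
def SmoothField (φ : M → W) : Prop :=
  ∀ x₀ : M, ContDiffAt ℝ ∞ (fieldInChart T x₀ φ) (extChartAt 𝓘(ℝ, Euc n) x₀ x₀)

/-- Jointly smooth finite-dimensional families of tensor fields. -/
def SmoothFieldFamily {p : ℕ} (φ : (Fin p → ℝ) → M → W) : Prop :=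
  ∀ (t₀ : Fin p → ℝ) (x₀ : M),
    ContDiffAt ℝ ∞ (fun q : (Fin p → ℝ) × Euc n => fieldInChart T x₀ (φ q.1) q.2)
      (t₀, extChartAt 𝓘(ℝ, Euc n) x₀ x₀)

/-- The space of field configurations: smooth tensor fields with admissible values. -/
def FieldSpace : Set (M → W) := {φ | SmoothField T φ ∧ ∀ x, φ x ∈ T.values}

/-- Lie derivative of a tensor field, `(£_v φ) = v^a ∂_a φ - ρ(∂v) φ` in coordinates, `ρ` being
the infinitesimal action of `gl(n)`; at `x` it is computed in the chart centred at `x`. -/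
def lieField (v : VField n M) (φ : M → W) : M → W := fun x =>
  fderiv ℝ (fieldInChart T x φ) (extChartAt 𝓘(ℝ, Euc n) x x) (v x)
    - (fderiv ℝ T.act 1 (fderiv ℝ (vfieldInChart x v) (extChartAt 𝓘(ℝ, Euc n) x x))) (φ x)

/-- The field-space vector field `ξ̂` of a field-dependent vector field `ξ`: `I_ξ̂ δφ = £_ξ φ`. -/
def hat (ξ : (M → W) → VField n M) (φ : M → W) : M → W := lieField T (ξ φ) φ

/-- The modified bracket `⟦ξ,ζ⟧ = [ξ,ζ] - I_ξ̂ δζ + I_ζ̂ δξ`. -/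
def modBracket (ξ ζ : (M → W) → VField n M) : (M → W) → VField n M := fun φ =>
  vfBracket (ξ φ) (ζ φ) - fieldDeriv ζ φ (hat T ξ φ) + fieldDeriv ξ φ (hat T ζ φ)

/-! ### Local forms on field space

Field-space forms of degree 0 and 1 with values in the `k`-forms of `X`, where `f : X → M` is
the identity of the spacetime or the inclusion of a hypersurface. They may depend on background
structures. They are written as functions on all `φ : M → W`, but only their values near
`FieldSpace` matter. -/

/-- Local, smooth 0-forms on field space. -/
structure IsLocal0 (f : X → M) (A : (M → W) → DForm l k X) : Prop where
  isLocal : ∀ φ φ' x, φ =ᶠ[𝓝 (f x)] φ' → A φ x = A φ' x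
  isSmooth : ∀ (p : ℕ) (φ : (Fin p → ℝ) → M → W), SmoothFieldFamily T φ →
    ∀ t₀, φ t₀ ∈ FieldSpace T → ∀ x₀, SmoothFormFamilyAt (fun t => A (φ t)) t₀ x₀

/-- Local, smooth 1-forms on field space. -/
structure IsLocal1 (f : X → M) (A : (M → W) → (M → W) → DForm l k X) : Prop where
  isLocal : ∀ φ φ' ψ ψ' x, φ =ᶠ[𝓝 (f x)] φ' → ψ =ᶠ[𝓝 (f x)] ψ' → A φ ψ x = A φ' ψ' x
  add : ∀ φ ∈ FieldSpace T, ∀ ψ ψ', SmoothField T ψ → SmoothField T ψ' →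
    A φ (ψ + ψ') = A φ ψ + A φ ψ'
  smul : ∀ φ ∈ FieldSpace T, ∀ (a : ℝ) (ψ), SmoothField T ψ → A φ (a • ψ) = a • A φ ψ
  isSmooth : ∀ (p : ℕ) (φ ψ : (Fin p → ℝ) → M → W), SmoothFieldFamily T φ →
    SmoothFieldFamily T ψ → ∀ t₀, φ t₀ ∈ FieldSpace T → ∀ x₀,
      SmoothFormFamilyAt (fun t => A (φ t) (ψ t)) t₀ x₀

/-- Forms on `M` built locally, smoothly and linearly from a vector field and the fields. -/
structure IsLocalVec (A : (M → W) → VField n M → DForm n k M) : Prop where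
  isLocal : ∀ φ φ' v v' x, φ =ᶠ[𝓝 x] φ' → v =ᶠ[𝓝 x] v' → A φ v x = A φ' v' x
  add : ∀ φ ∈ FieldSpace T, ∀ v v', SmoothVF v → SmoothVF v' → A φ (v + v') = A φ v + A φ v'
  smul : ∀ φ ∈ FieldSpace T, ∀ (a : ℝ) (v), SmoothVF v → A φ (a • v) = a • A φ v
  isSmooth : ∀ (p : ℕ) (φ : (Fin p → ℝ) → M → W) (v : (Fin p → ℝ) → VField n M),
    SmoothFieldFamily T φ → (∀ t x, SmoothVFFamilyAt v t x) →
    ∀ t₀, φ t₀ ∈ FieldSpace T → ∀ x₀, SmoothFormFamilyAt (fun t => A (φ t) (v t)) t₀ x₀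

/-- Exterior derivative on field space of a 0-form. -/
def delta0 (A : (M → W) → DForm l k X) : (M → W) → (M → W) → DForm l k X :=
  fun φ ψ => fieldDeriv A φ ψ

/-- Exterior derivative on field space of a 1-form,
`(δA)(ψ₁, ψ₂) = ψ₁ (A ψ₂) - ψ₂ (A ψ₁)` for constant `ψ₁, ψ₂`. -/
def delta1 (A : (M → W) → (M → W) → DForm l k X) :
    (M → W) → (M → W) → (M → W) → DForm l k X :=
  fun φ ψ₁ ψ₂ => fieldDeriv (fun φ' => A φ' ψ₂) φ ψ₁ - fieldDeriv (fun φ' => A φ' ψ₁) φ ψ₂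

/-- Anomaly `Δ_v̂ A = L_v̂ A - £_v A` of a field-space 0-form at `φ`; it depends only on the value
`v` of the generator at `φ`. The second vector field `vX` is the one induced by `v` on `X`. -/
def anomaly0 (A : (M → W) → DForm l (k + 1) X) (φ : M → W) (v : VField n M) (vX : VField l X) :
    DForm l (k + 1) X :=
  fieldDeriv A φ (lieField T v φ) - lieForm vX (A φ)

/-- Lie derivative on field space, `L_ξ̂ = I_ξ̂ δ + δ I_ξ̂`, of a 1-form. -/
def fieldLie1 (A : (M → W) → (M → W) → DForm l k X) (ξ : (M → W) → VField n M) :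
    (M → W) → (M → W) → DForm l k X := fun φ ψ =>
  delta1 A φ (hat T ξ φ) ψ + delta0 (fun φ' => A φ' (hat T ξ φ')) φ ψ

/-- Anomaly `Δ_ξ̂ A = L_ξ̂ A - £_ξ A - I_{\hat{δξ}} A` of a field-space 1-form. The vector field `vX`
is the one induced by `ξ φ` on `X`. -/
def anomaly1 (A : (M → W) → (M → W) → DForm l (k + 1) X) (ξ : (M → W) → VField n M)
    (φ : M → W) (vX : VField l X) (ψ : M → W) : DForm l (k + 1) X :=
  fieldLie1 T A ξ φ ψ - lieForm vX (A φ ψ) - A φ (lieField T (fieldDeriv ξ φ ψ) φ)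

/-- Field-dependent generators `ξ` tangent to the hypersurface `ν : X → M`: smooth in the fields
and tangent to the hypersurface, also under variations of the fields. -/
structure IsGenerator (ν : X → M) (ξ : (M → W) → VField n M) : Prop where
  isSmooth : ∀ (p : ℕ) (φ : (Fin p → ℝ) → M → W), SmoothFieldFamily T φ →
    ∀ t₀, φ t₀ ∈ FieldSpace T → ∀ x₀, SmoothVFFamilyAt (fun t => ξ (φ t)) t₀ x₀
  tangent : ∀ (p : ℕ) (φ : (Fin p → ℝ) → M → W), SmoothFieldFamily T φ →
    ∀ t₀, φ t₀ ∈ FieldSpace T → ∀ y₀ : X,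
      ∀ᶠ q : (Fin p → ℝ) × X in 𝓝 (t₀, y₀), TangentAt (n := n) (m := l) ν (ξ (φ q.1)) q.2

end Fields

/-! ### The theory, the boundary data and the charges

The spacetime `M` has dimension `d + 1 = n + 3`, the boundary `N` dimension `d = n + 2`, and the cut
dimension `d - 1 = n + 1`. -/

section Charges

variable {n : ℕ} {W : Type*} [NormedAddCommGroup W] [NormedSpace ℝ W] (T : TensorType (n + 3) W)
  (M : Type*) [TopologicalSpace M] [ChartedSpace (Euc (n + 3)) M]
  [IsManifold 𝓘(ℝ, Euc (n + 3)) ∞ M]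
  (N : Type*) [TopologicalSpace N] [ChartedSpace (Euc (n + 2)) N]
  [IsManifold 𝓘(ℝ, Euc (n + 2)) ∞ N]

/-- A diffeomorphism-invariant field theory: the Lagrangian `L'`, the equations of motion `E`, the
symplectic potential `θ'`, and the forms `b'`, `λ'` measuring the noncovariance of `L'`, `θ'`. -/
structure LagrangianTheory where
  L : (M → W) → DForm (n + 3) (n + 3) M
  E : (M → W) → (x : M) → W →L[ℝ] (Euc (n + 3) [⋀^Fin (n + 3)]→L[ℝ] ℝ)
  θ : (M → W) → (M → W) → DForm (n + 3) (n + 2) M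
  b : (M → W) → DForm (n + 3) (n + 2) M
  lam : (M → W) → (M → W) → DForm (n + 3) (n + 1) M
  local_L : IsLocal0 T id L
  local_θ : IsLocal1 T id θ
  local_b : IsLocal0 T id b
  local_lam : IsLocal1 T id lam
  /-- `δL' = E·δφ + dθ'` -/
  delta_L : ∀ φ ∈ FieldSpace T, ∀ ψ, SmoothField T ψ →
    delta0 L φ ψ = (fun x => E φ x (ψ x)) + dForm (θ φ ψ)
  /-- `Δ_v̂ L' = d Δ_v̂ b'` -/
  anomaly_L : ∀ φ ∈ FieldSpace T, ∀ v, SmoothVF v →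
    anomaly0 T L φ v v = dForm (anomaly0 T b φ v v)
  /-- `Δ_v̂ θ' = Δ_v̂ δb' + d Δ_v̂ λ'` -/
  anomaly_θ : ∀ φ ∈ FieldSpace T, ∀ v, SmoothVF v → ∀ ψ, SmoothField T ψ →
    anomaly1 T θ (fun _ => v) φ v ψ =
      anomaly1 T (delta0 b) (fun _ => v) φ v ψ + dForm (anomaly1 T lam (fun _ => v) φ v ψ)

variable {T M}

namespace LagrangianTheory

variable (Th : LagrangianTheory T M)

/-- Solutions of the field equations in the subregion `U`. -/
def Solutions (U : Set M) : Set (M → W) := {φ | φ ∈ FieldSpace T ∧ ∀ x ∈ U, Th.E φ x = 0}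

/-- Covariant Lagrangian `L' - db'`. -/
def covL (φ : M → W) : DForm (n + 3) (n + 3) M := Th.L φ - dForm (Th.b φ)

/-- Covariant symplectic potential `θ' - δb' - dλ'`. -/
def covθ (φ ψ : M → W) : DForm (n + 3) (n + 2) M :=
  Th.θ φ ψ - delta0 Th.b φ ψ - dForm (Th.lam φ ψ)

/-- Noether current of the covariant Lagrangian and potential, `I_v̂ θ - i_v L`. -/
def covNoetherCurrent (φ : M → W) (v : VField (n + 3) M) : DForm (n + 3) (n + 2) M :=
  Th.covθ φ (lieField T v φ) - contract v (Th.covL φ)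

/-- Symplectic current `ω' = δθ'`. -/
def sympCurrent (φ ψ₁ ψ₂ : M → W) : DForm (n + 3) (n + 2) M := delta1 Th.θ φ ψ₁ ψ₂

end LagrangianTheory

/-- A Noether potential in the subregion `U`: a form `Q_v` covariantly constructed from the vector
field `v` and the dynamical fields, that is, `Δ_û Q_v = Q_{Δ_û v} = -Q_{[u,v]}` for
field-independent `u`, `v`, with `dQ_v = J_v` on shell. -/
structure NoetherPotential (Th : LagrangianTheory T M) (U : Set M) where
  Q : (M → W) → VField (n + 3) M → DForm (n + 3) (n + 1) M
  local_Q : IsLocalVec T Q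
  covariant_Q : ∀ φ ∈ FieldSpace T, ∀ u v, SmoothVF u → SmoothVF v →
    anomaly0 T (fun φ' => Q φ' v) φ u u = - Q φ (vfBracket u v)
  d_Q : ∀ φ ∈ Th.Solutions U, ∀ v, SmoothVF v → ∀ x ∈ U,
    dForm (Q φ v) x = Th.covNoetherCurrent φ v x

/-- The data on the boundary hypersurface `ν : N → M`: boundary term `ℓ'`, corner term `β'`, flux
`𝓔`, and the corner quantities `c'`, `γ'`, `ε`. -/
structure BoundaryData (Th : LagrangianTheory T M) (ν : N → M) where
  ell : (M → W) → DForm (n + 2) (n + 2) N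
  β : (M → W) → (M → W) → DForm (n + 2) (n + 1) N
  flux : (M → W) → (M → W) → DForm (n + 2) (n + 2) N
  c : (M → W) → DForm (n + 2) (n + 1) N
  γ : (M → W) → (M → W) → DForm (n + 2) n N
  ε : (M → W) → (M → W) → DForm (n + 2) (n + 1) N
  local_ell : IsLocal0 T ν ell
  local_β : IsLocal1 T ν β
  local_flux : IsLocal1 T ν flux
  local_c : IsLocal0 T ν c
  local_γ : IsLocal1 T ν γ
  local_ε : IsLocal1 T ν ε
  /-- `θ' = -δℓ' + dβ' + 𝓔` pulled back to `N` -/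
  decomp_θ : ∀ φ ∈ FieldSpace T, ∀ ψ, SmoothField T ψ →
    pullForm ν (Th.θ φ ψ) = - delta0 ell φ ψ + dForm (β φ ψ) + flux φ ψ
  /-- `β' - λ' = -δc' + dγ' + ε` on `N` -/
  decomp_β : ∀ φ ∈ FieldSpace T, ∀ ψ, SmoothField T ψ →
    β φ ψ - pullForm ν (Th.lam φ ψ) = - delta0 c φ ψ + dForm (γ φ ψ) + ε φ ψ

variable {N} {Th : LagrangianTheory T M} {U : Set M} {ν : N → M}

namespace BoundaryData

variable (B : BoundaryData N Th ν) (P : NoetherPotential Th U)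

/-- `Q'_v = Q_v + i_v b' + I_v̂ λ'`. -/
def noetherCharge (_B : BoundaryData N Th ν) (φ : M → W) (v : VField (n + 3) M) :
    DForm (n + 3) (n + 1) M :=
  P.Q φ v + contract v (Th.b φ) + Th.lam φ (lieField T v φ)

/-- Charge density `h_v = Q'_v + i_v ℓ' - I_v̂ β'` on `N`. -/
def density (φ : M → W) (v : VField (n + 3) M) : DForm (n + 2) (n + 1) N :=
  pullForm ν (B.noetherCharge P φ v) + contract (restrictVF ν v) (B.ell φ)
    - B.β φ (lieField T v φ)

/-- Corner-improved charge density `h̃_v = h_v - Δ_v̂ c'` on `N`. -/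
def impDensity (φ : M → W) (v : VField (n + 3) M) : DForm (n + 2) (n + 1) N :=
  B.density P φ v - anomaly0 T B.c φ v (restrictVF ν v)

variable (cut : Chain (n + 2) (n + 1) N)

/-- Corner-improved charge `H̃_ξ`, a function of the fields. -/
def impCharge (ξ : (M → W) → VField (n + 3) M) (φ : M → W) : ℝ :=
  cut.integral (B.impDensity P φ (ξ φ))

/-- Improved flux, the field-space 1-form
`𝓕̃_ξ̂ = ∫ (i_ξ 𝓔 - Δ_ξ̂ ε + h̃_{δξ})`. -/
def impFlux (ξ : (M → W) → VField (n + 3) M) (φ ψ : M → W) : ℝ :=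
  cut.integral (contract (restrictVF ν (ξ φ)) (B.flux φ ψ)
    - anomaly1 T B.ε ξ φ (restrictVF ν (ξ φ)) ψ
    + B.impDensity P φ (fieldDeriv ξ φ ψ))

/-- Symplectic form `Ω = ∫_Σ ω' - ∫_{∂Σ} δβ'`. -/
def sympForm (slice : Chain (n + 3) (n + 2) M) (φ ψ₁ ψ₂ : M → W) : ℝ :=
  slice.integral (Th.sympCurrent φ ψ₁ ψ₂) - cut.integral (delta1 B.β φ ψ₁ ψ₂)

/-- Barnich-Troessaert bracket
`I_ξ̂ I_ζ̂ Ω - I_ξ̂ 𝓕̃_ζ̂ + I_ζ̂ 𝓕̃_ξ̂` of the improved charges of `ξ` and `ζ`. -/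
def bracketBT (slice : Chain (n + 3) (n + 2) M) (ξ ζ : (M → W) → VField (n + 3) M)
    (φ : M → W) : ℝ :=
  B.sympForm cut slice φ (hat T ζ φ) (hat T ξ φ)
    - B.impFlux P cut ζ φ (hat T ξ φ) + B.impFlux P cut ξ φ (hat T ζ φ)

/-- `ℓ' + b' + dc'` on `N`. -/
def totalBoundaryTerm (φ : M → W) : DForm (n + 2) (n + 2) N :=
  B.ell φ + pullForm ν (Th.b φ) + dForm (B.c φ)

/-- The extension `K̃_{ξ,ζ} = ∫ (i_ξ Δ_ζ̂ (ℓ' + b' + dc') - i_ζ Δ_ξ̂ (ℓ' + b' + dc'))`. -/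
def extensionK (ξ ζ : (M → W) → VField (n + 3) M) (φ : M → W) : ℝ :=
  cut.integral
    (contract (restrictVF ν (ξ φ))
        (anomaly0 T B.totalBoundaryTerm φ (ζ φ) (restrictVF ν (ζ φ)))
      - contract (restrictVF ν (ζ φ))
        (anomaly0 T B.totalBoundaryTerm φ (ξ φ) (restrictVF ν (ξ φ))))

end BoundaryData

end Charges

end

end CovPhase

open CovPhase

/-! The forms `θ = θ' - δb' - dλ'` and `Q_v` are covariant, so a derivative along a field-space
vector field `v̂` can be traded for a Lie derivative on spacetime. Put `L = L' - db'` and `J_v =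
I_v̂ θ - i_v L`. Since `δθ' = δθ + dδλ'`, covariance of `θ`, the commutator `[£_u, £_v] = £_[u,v]`
and Cartan calculus express the symplectic current of two diffeomorphisms as an exact form plus
terms in `dJ_u`, `dJ_v` and `J_[u,v] - dQ_[u,v]` (`sympCurrent_sub_dForm_potential`). On shell `J =
dQ` on `U`, hence by continuity on its closure, and only the exact form survives. Stokes' theorem
then writes the symplectic form of two diffeomorphisms as an integral over the cut (`sympForm_eq`).

On `N` put `ℬ = ℓ' + b' + dc'`. The two decompositions combine to `θ = -δℬ + dε + 𝓔`
(`pullForm_covθ`), `i_v L` pulls back to zero by degree, and the improved density is `Q_v + i_v ℬ -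
I_v̂ ε` up to an exact form (`impDensity_eq`). The cut is a cycle, because `∂∂ = 0` and push-forward
of chains along an injective map is injective, so exact forms integrate to zero over it. What
remains is pointwise. In the bracket the flux `𝓔` cancels, the `ε` terms assemble into `ε(£_[ξ,ζ]
φ)`, and since `dℬ = 0` by degree, the Cartan formula for `i_[ξ,ζ] ℬ` leaves exactly the anomalies
of `ℬ` (`charge_algebra`). The variation of the charge is obtained in the same way from the
covariance of `Q_ζ` and `dQ_ζ = J_ζ` (`charge_variation`).

The analytic difficulty is the derivative along `φ + t Y`. This line may leave the admissible fields
for every `t ≠ 0`, and a field-dependent generator need not be local in the fields, so identities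
known for admissible fields do not apply along it directly. `IsSmoothGen.exists_localization`
repairs this: smoothness along finite-dimensional families alone forces `ζ (φ + t Y)` to agree, near
a compact set and for small `t`, with the value of `ζ` on a compactly supported truncation of the
variation, and the truncated line is admissible. The reason is a Lipschitz estimate on a family that
joins the variation to its cut-offs at parameters chosen too close together
(`IsSmoothGen.exists_eq_cutoff`). The second tool is Hadamard's lemma: a smooth difference quotient
gives a product rule (`LocalLin.hasDerivAt`) for operators that are only known to be smooth along
families.

Vector fields and forms are treated as tensor fields of the types `vecType` and `formType`, so
smoothness of families and change of chart are proved once for all tensors. -/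

namespace CovPhase

/-! ### Smooth families of alternating forms -/

section AlternatingForms

variable {Z E E' : Type*} [NormedAddCommGroup Z] [NormedSpace ℝ Z]
  [NormedAddCommGroup E] [NormedSpace ℝ E] [NormedAddCommGroup E'] [NormedSpace ℝ E']

/-- An alternating form is determined by its values on tuples of basis vectors. The left inverse
lets smoothness and derivatives of form-valued maps be tested on fixed arguments. -/
theorem exists_leftInverse_evalBasis (k : ℕ) [FiniteDimensional ℝ E] :
    ∃ L : ((Fin k → Fin (Module.finrank ℝ E)) → ℝ) →L[ℝ] (E [⋀^Fin k]→L[ℝ] ℝ),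
      ∀ α : E [⋀^Fin k]→L[ℝ] ℝ,
        L (fun s => α (fun i => Module.finBasis ℝ E (s i))) = α := by
  let ev : (E [⋀^Fin k]→L[ℝ] ℝ) →ₗ[ℝ] ((Fin k → Fin (Module.finrank ℝ E)) → ℝ) :=
    { toFun := fun α s => α (fun i => Module.finBasis ℝ E (s i))
      map_add' := fun _ _ => rfl
      map_smul' := fun _ _ => rfl }
  have hev : LinearMap.ker ev = ⊥ := by
    rw [LinearMap.ker_eq_bot]
    intro α β h
    apply ContinuousAlternatingMap.toAlternatingMap_injective
    apply AlternatingMap.coe_multilinearMap_injective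
    refine Module.Basis.ext_multilinear (fun _ => Module.finBasis ℝ E) (fun s => ?_)
    exact congrFun h s
  obtain ⟨L, hL⟩ := LinearMap.exists_leftInverse_of_injective ev hev
  refine ⟨LinearMap.toContinuousLinearMap L, fun α => ?_⟩
  exact LinearMap.congr_fun hL α

theorem contDiffAt_alternating [FiniteDimensional ℝ E] {k : ℕ} {r : WithTop ℕ∞}
    {g : Z → E [⋀^Fin k]→L[ℝ] ℝ} {z : Z}
    (h : ∀ v : Fin k → E, ContDiffAt ℝ r (fun z => g z v) z) : ContDiffAt ℝ r g z := by
  obtain ⟨L, hL⟩ := exists_leftInverse_evalBasis (E := E) k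
  have : g = fun z => L (fun s => g z (fun i => Module.finBasis ℝ E (s i))) := by
    funext z; rw [hL]
  rw [this]
  exact L.contDiff.contDiffAt.comp z (contDiffAt_pi.2 fun s => h _)

theorem alternating_apply_eq_sum [FiniteDimensional ℝ E] {k : ℕ} (α : E [⋀^Fin k]→L[ℝ] ℝ)
    (w : Fin k → E) :
    α w = ∑ s : Fin k → Fin (Module.finrank ℝ E),
      (∏ i, (Module.finBasis ℝ E).repr (w i) (s i)) * α (fun i => Module.finBasis ℝ E (s i)) := by
  conv_lhs => rw [show w = fun i => ∑ j, (Module.finBasis ℝ E).repr (w i) j •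
    Module.finBasis ℝ E j from funext fun i => ((Module.finBasis ℝ E).sum_repr (w i)).symm]
  change α.toMultilinearMap _ = _
  rw [MultilinearMap.map_sum]
  refine Finset.sum_congr rfl fun s _ => ?_
  rw [MultilinearMap.map_smul_univ]
  rfl

theorem _root_.ContDiffAt.alternating_apply [FiniteDimensional ℝ E] {k : ℕ} {r : WithTop ℕ∞}
    {g : Z → E [⋀^Fin k]→L[ℝ] ℝ} {w : Fin k → Z → E} {z : Z} (hg : ContDiffAt ℝ r g z)
    (hw : ∀ i, ContDiffAt ℝ r (w i) z) : ContDiffAt ℝ r (fun z => g z (fun i => w i z)) z := by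
  have e : (fun z => g z (fun i => w i z)) = fun z =>
      ∑ s : Fin k → Fin (Module.finrank ℝ E),
      (∏ i, (Module.finBasis ℝ E).repr (w i z) (s i)) *
        g z (fun i => Module.finBasis ℝ E (s i)) := by
    funext z; exact alternating_apply_eq_sum _ _
  rw [e]
  refine ContDiffAt.sum fun s _ => ContDiffAt.mul (contDiffAt_prod fun i _ => ?_) ?_
  · let L : E →L[ℝ] ℝ := LinearMap.toContinuousLinearMap ((Module.finBasis ℝ E).coord (s i))
    exact L.contDiff.contDiffAt.comp z (hw i)
  · let L : (E [⋀^Fin k]→L[ℝ] ℝ) →L[ℝ] ℝ :=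
      LinearMap.mkContinuous ⟨⟨fun α => α (fun i => Module.finBasis ℝ E (s i)),
        fun _ _ => rfl⟩, fun _ _ => rfl⟩ (∏ i, ‖Module.finBasis ℝ E (s i)‖) (fun α => by
        rw [mul_comm]; exact α.le_opNorm _)
    exact L.contDiff.contDiffAt.comp z hg

theorem _root_.ContDiffAt.curryLeft [FiniteDimensional ℝ E] {k : ℕ} {r : WithTop ℕ∞}
    {g : Z → E [⋀^Fin (k + 1)]→L[ℝ] ℝ} {w : Z → E} {z : Z} (hg : ContDiffAt ℝ r g z)
    (hw : ContDiffAt ℝ r w z) : ContDiffAt ℝ r (fun z => (g z).curryLeft (w z)) z := by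
  refine contDiffAt_alternating fun v => ?_
  have := hg.alternating_apply (w := fun i z => (Matrix.vecCons (w z) v : Fin (k + 1) → E) i)
    (Fin.cases (by simpa using hw) (fun i => by simpa using contDiffAt_const))
  simpa using this

theorem _root_.ContDiffAt.alternating_comp [FiniteDimensional ℝ E] [FiniteDimensional ℝ E'] {k : ℕ} {r : WithTop ℕ∞}
    {g : Z → E [⋀^Fin k]→L[ℝ] ℝ} {A : Z → E' →L[ℝ] E} {z : Z} (hg : ContDiffAt ℝ r g z)
    (hA : ContDiffAt ℝ r A z) :
    ContDiffAt ℝ r (fun z => (g z).compContinuousLinearMap (A z)) z :=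
  contDiffAt_alternating fun v =>
    (hg.alternating_apply (w := fun i z => A z (v i))
      fun _ => hA.clm_apply contDiffAt_const)

/-- Behind every appeal to degree: `dL` on `M`, the pull-back of `L` to `N`, and `dℬ` on `N` all
vanish by it. -/
theorem alternating_eq_zero_of_finrank_lt [FiniteDimensional ℝ E] {k : ℕ}
    (h : Module.finrank ℝ E < k) (α : E [⋀^Fin k]→L[ℝ] ℝ) : α = 0 := by
  ext v
  refine α.toAlternatingMap.map_linearDependent v (fun hv => ?_)
  have := hv.fintype_card_le_finrank
  simp at this
  omega

end AlternatingForms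

/-! ### Derivatives in a parameter -/

section Swap

theorem two_le_smooth : (2 : WithTop ℕ∞) ≤ ∞ := by
  norm_cast

variable {E F : Type*} [NormedAddCommGroup E] [NormedSpace ℝ E]
  [NormedAddCommGroup F] [NormedSpace ℝ F]

/-- Partial derivative in the space variables. -/
theorem fderiv_partial_right {P : Type*} [NormedAddCommGroup P] [NormedSpace ℝ P]
    {g : P × E → F} {z : P × E} (hg : DifferentiableAt ℝ g z) :
    fderiv ℝ (fun y => g (z.1, y)) z.2 = (fderiv ℝ g z).comp (ContinuousLinearMap.inr ℝ P E) := by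
  have h2 : HasFDerivAt (fun y : E => (z.1, y)) (ContinuousLinearMap.inr ℝ P E) z.2 :=
    hasFDerivAt_prodMk_right z.1 z.2
  exact (HasFDerivAt.comp z.2 (g := g) (f := fun y => (z.1, y)) hg.hasFDerivAt h2).fderiv

theorem hasDerivAt_partial_left {g : ℝ × E → F} {z : ℝ × E} (hg : DifferentiableAt ℝ g z) :
    HasDerivAt (fun t => g (t, z.2)) (fderiv ℝ g z (1, 0)) z.1 := by
  have h2 : HasFDerivAt (fun t : ℝ => (t, z.2)) (ContinuousLinearMap.inl ℝ ℝ E) z.1 :=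
    hasFDerivAt_prodMk_left z.1 z.2
  have := (HasFDerivAt.comp z.1 (g := g) (f := fun t => (t, z.2)) hg.hasFDerivAt h2).hasDerivAt
  simpa [Function.comp_def] using this

theorem _root_.ContDiffAt.partial_left {g : ℝ × E → F} {z : ℝ × E} (hg : ContDiffAt ℝ ∞ g z) :
    ContDiffAt ℝ ∞ (fun z => deriv (fun t => g (t, z.2)) z.1) z := by
  have h1 : ContDiffAt ℝ ∞ (fun z => fderiv ℝ g z (1, 0)) z :=
    (hg.fderiv_right (m := ∞) (by simp)).clm_apply contDiffAt_const
  refine h1.congr_of_eventuallyEq ?_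
  filter_upwards [(hg.of_le (m := 1) (by simp)).eventually (by simp)] with w hw
  exact (hasDerivAt_partial_left (hw.differentiableAt (by simp))).deriv

/-- Derivatives in the parameter and in the space variables commute. -/
theorem hasDerivAt_fderiv_swap {g : ℝ × E → F} {z : ℝ × E} (hg : ContDiffAt ℝ ∞ g z) :
    HasDerivAt (fun t => fderiv ℝ (fun y => g (t, y)) z.2)
      (fderiv ℝ (fun y => deriv (fun t => g (t, y)) z.1) z.2) z.1 := by
  have hev : ∀ᶠ w in 𝓝 z, DifferentiableAt ℝ g w :=
    ((hg.of_le (m := 1) (by simp)).eventually (by simp)).mono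
      fun w hw => hw.differentiableAt (by simp)
  have hd : DifferentiableAt ℝ (fderiv ℝ g) z :=
    (hg.fderiv_right (m := ∞) (by simp)).differentiableAt (by simp)
  have hsymm : IsSymmSndFDerivAt ℝ g z :=
    hg.isSymmSndFDerivAt (by simpa using two_le_smooth)
  have e1 : ∀ᶠ t in 𝓝 z.1, fderiv ℝ (fun y => g (t, y)) z.2 =
      (fderiv ℝ g (t, z.2)).comp (ContinuousLinearMap.inr ℝ ℝ E) := by
    have : Filter.Tendsto (fun t : ℝ => (t, z.2)) (𝓝 z.1) (𝓝 z) :=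
      (Continuous.tendsto (by fun_prop) z.1)
    filter_upwards [this.eventually hev] with t ht
    exact fderiv_partial_right ht
  have e2 : ∀ᶠ y in 𝓝 z.2, deriv (fun t => g (t, y)) z.1 = fderiv ℝ g (z.1, y) (1, 0) := by
    have : Filter.Tendsto (fun y : E => (z.1, y)) (𝓝 z.2) (𝓝 z) :=
      (Continuous.tendsto (by fun_prop) z.2)
    filter_upwards [this.eventually hev] with y hy
    exact (hasDerivAt_partial_left hy).deriv
  have h1 := (hasDerivAt_partial_left hd).clm_comp
    (hasDerivAt_const z.1 (ContinuousLinearMap.inr ℝ ℝ E))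
  have h2 : fderiv ℝ (fun y => deriv (fun t => g (t, y)) z.1) z.2 =
      (fderiv ℝ (fderiv ℝ g) z (1, 0)).comp (ContinuousLinearMap.inr ℝ ℝ E) := by
    rw [Filter.EventuallyEq.fderiv_eq e2]
    have hd2 : DifferentiableAt ℝ (fun y => fderiv ℝ g (z.1, y)) z.2 :=
      DifferentiableAt.comp z.2 (g := fderiv ℝ g) (f := fun y => (z.1, y)) hd
        (hasFDerivAt_prodMk_right z.1 z.2).differentiableAt
    ext y
    rw [fderiv_clm_apply hd2 (differentiableAt_const _), fderiv_partial_right hd]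
    -- Both sides are the mixed second derivative of `g` at `z`, with its two arguments exchanged.
    simp [hsymm.eq (0, y) (1, 0)]
  rw [ContinuousLinearMap.comp_zero, add_zero] at h1
  rw [h2]
  exact h1.congr_of_eventuallyEq e1

end Swap

end CovPhase

namespace CovPhase

/-! ### The infinitesimal action of `gl(n)` -/

section Rho

variable {n : ℕ} {W : Type*} [NormedAddCommGroup W] [NormedSpace ℝ W] (T : TensorType n W)

/-- The infinitesimal action of `gl(n)`. -/
noncomputable def rho : (Euc n →L[ℝ] Euc n) →L[ℝ] (W →L[ℝ] W) := fderiv ℝ T.act 1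

theorem contDiffAt_act {A : Euc n →L[ℝ] Euc n} (hA : IsUnit A) : ContDiffAt ℝ ∞ T.act A :=
  T.act_smooth.contDiffAt (Units.isOpen.mem_nhds hA)

theorem hasFDerivAt_act_one : HasFDerivAt T.act (rho T) 1 :=
  ((contDiffAt_act T isUnit_one).differentiableAt (by simp)).hasFDerivAt

theorem eventually_isUnit (A : (Euc n →L[ℝ] Euc n)ˣ) :
    ∀ᶠ B in 𝓝 (A : Euc n →L[ℝ] Euc n), IsUnit B :=
  Units.isOpen.mem_nhds A.isUnit

/-- Near `A` one has `act B = act (B A⁻¹) act A`, which moves the derivative to the identity, where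
it is `rho`. -/
theorem fderiv_act (A : (Euc n →L[ℝ] Euc n)ˣ) (H : Euc n →L[ℝ] Euc n) :
    fderiv ℝ T.act A H = rho T (H * ↑A⁻¹) * T.act A := by
  have hRdef : ∀ B : Euc n →L[ℝ] Euc n, (ContinuousLinearMap.compL ℝ (Euc n) (Euc n) (Euc n)).flip
      (↑A⁻¹ : Euc n →L[ℝ] Euc n) B = B * ↑A⁻¹ := fun _ => rfl
  let R : (Euc n →L[ℝ] Euc n) →L[ℝ] (Euc n →L[ℝ] Euc n) :=
    (ContinuousLinearMap.compL ℝ (Euc n) (Euc n) (Euc n)).flip (↑A⁻¹ : Euc n →L[ℝ] Euc n)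
  have e : T.act =ᶠ[𝓝 (A : Euc n →L[ℝ] Euc n)] fun B => T.act (R B) * T.act A := by
    filter_upwards [eventually_isUnit A] with B hB
    simp only [R, hRdef]
    rw [← T.act_mul _ _ (hB.mul A⁻¹.isUnit) A.isUnit, mul_assoc, Units.inv_mul, mul_one]
  have hR : R A = 1 := by simp only [R, hRdef, Units.mul_inv]
  have h1 : HasFDerivAt (fun B => T.act (R B)) ((rho T).comp R) (A : Euc n →L[ℝ] Euc n) := by
    refine HasFDerivAt.comp _ ?_ R.hasFDerivAt
    rw [hR]
    exact hasFDerivAt_act_one T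
  have h2 : HasFDerivAt (fun B => (T.act (R B)).comp (T.act A)) _ (A : Euc n →L[ℝ] Euc n) :=
    h1.clm_comp (hasFDerivAt_const (T.act A) _)
  have h3 := DFunLike.congr_fun (h2.congr_of_eventuallyEq e).fderiv H
  refine h3.trans ?_
  ext w
  simp [R, hRdef]

/-- Differentiate `act (A C) = act A act C` in `C` at the identity. -/
theorem act_mul_rho (A : (Euc n →L[ℝ] Euc n)ˣ) (B : Euc n →L[ℝ] Euc n) :
    T.act A * rho T B = rho T (A * B * ↑A⁻¹) * T.act A := by
  let L : (Euc n →L[ℝ] Euc n) →L[ℝ] (Euc n →L[ℝ] Euc n) :=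
    ContinuousLinearMap.compL ℝ (Euc n) (Euc n) (Euc n) (A : Euc n →L[ℝ] Euc n)
  have hL : ∀ B, L B = A * B := fun _ => rfl
  have h1 : HasFDerivAt (fun B => (T.act A).comp (T.act B)) _ 1 :=
    (hasFDerivAt_const (T.act A) _).clm_comp (hasFDerivAt_act_one T)
  have h2 : HasFDerivAt (fun B => T.act (L B)) ((fderiv ℝ T.act A).comp L) 1 := by
    refine HasFDerivAt.comp _ ?_ L.hasFDerivAt
    rw [hL, mul_one]
    exact ((contDiffAt_act T A.isUnit).differentiableAt (by simp)).hasFDerivAt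
  have e : (fun B => T.act (L B)) =ᶠ[𝓝 1] fun B => (T.act A).comp (T.act B) := by
    filter_upwards [eventually_isUnit (1 : (Euc n →L[ℝ] Euc n)ˣ)] with C hC
    rw [hL, T.act_mul _ _ A.isUnit hC]
    rfl
  have h3 := DFunLike.congr_fun ((h2.congr_of_eventuallyEq e.symm).unique h1) B
  simp only [ContinuousLinearMap.comp_apply, fderiv_act, hL] at h3
  rw [h3]
  ext w
  simp

/-- Equivariance of `rho` written without `A⁻¹`, so that both sides are easily differentiated in
`A`. -/
theorem act_mul_rho_mul (A : (Euc n →L[ℝ] Euc n)ˣ) (B : Euc n →L[ℝ] Euc n) :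
    T.act A * rho T (B * A) = rho T (A * B) * T.act A := by
  rw [act_mul_rho, mul_assoc, mul_assoc, Units.mul_inv, mul_one]

/-- Differentiate the identity of `act_mul_rho_mul` at the identity matrix in the direction `A`. -/
theorem rho_commutator (A B : Euc n →L[ℝ] Euc n) :
    rho T (A * B - B * A) = rho T A * rho T B - rho T B * rho T A := by
  let L : (Euc n →L[ℝ] Euc n) →L[ℝ] (Euc n →L[ℝ] Euc n) :=
    ContinuousLinearMap.compL ℝ (Euc n) (Euc n) (Euc n) B
  have hL : ∀ C, L C = B * C := fun _ => rfl
  let R : (Euc n →L[ℝ] Euc n) →L[ℝ] (Euc n →L[ℝ] Euc n) :=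
    (ContinuousLinearMap.compL ℝ (Euc n) (Euc n) (Euc n)).flip B
  have hR : ∀ C, R C = C * B := fun _ => rfl
  have h1 : HasFDerivAt (fun C => (T.act C).comp (rho T (L C))) _ 1 :=
    (hasFDerivAt_act_one T).clm_comp ((rho T).comp L).hasFDerivAt
  have h2 : HasFDerivAt (fun C => (rho T (R C)).comp (T.act C)) _ 1 :=
    ((rho T).comp R).hasFDerivAt.clm_comp (hasFDerivAt_act_one T)
  have e : (fun C => (T.act C).comp (rho T (L C))) =ᶠ[𝓝 1]
      fun C => (rho T (R C)).comp (T.act C) := by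
    filter_upwards [eventually_isUnit (1 : (Euc n →L[ℝ] Euc n)ˣ)] with C hC
    obtain ⟨u, rfl⟩ := hC
    exact act_mul_rho_mul T u B
  have h5 := DFunLike.congr_fun ((h1.congr_of_eventuallyEq e.symm).unique h2) A
  have h6 : rho T (B * A) + rho T A * rho T B = rho T B * rho T A + rho T (A * B) := by
    ext w
    have := DFunLike.congr_fun h5 w
    simpa [T.act_one, hL, hR] using this
  rw [map_sub, sub_eq_sub_iff_add_eq_add, add_comm (rho T A * rho T B), h6]
  abel

end Rho

/-! ### Lie derivatives in coordinates -/

section FlatLie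

variable {n : ℕ} {W : Type*} [NormedAddCommGroup W] [NormedSpace ℝ W] (T : TensorType n W)

/-- The Lie derivative of a tensor field in coordinates. -/
noncomputable def flatLie (V : Euc n → Euc n) (f : Euc n → W) (y : Euc n) : W :=
  fderiv ℝ f y (V y) - rho T (fderiv ℝ V y) (f y)

theorem flatLie_apply (V : Euc n → Euc n) (f : Euc n → W) (y : Euc n) :
    flatLie T V f y = fderiv ℝ f y (V y) - rho T (fderiv ℝ V y) (f y) := rfl

theorem flatLie_congr {V V' : Euc n → Euc n} {f f' : Euc n → W} {y : Euc n}
    (hV : V =ᶠ[𝓝 y] V') (hf : f =ᶠ[𝓝 y] f') : flatLie T V f y = flatLie T V' f' y := by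
  rw [flatLie, flatLie, hV.fderiv_eq, hf.fderiv_eq, hV.eq_of_nhds, hf.eq_of_nhds]

/-- The Lie derivative is natural under changes of coordinates. -/
theorem flatLie_naturality {τ : Euc n → Euc n} {V V' : Euc n → Euc n} {f f' : Euc n → W}
    {y : Euc n} (hτ : ContDiffAt ℝ ∞ τ y) (A : (Euc n →L[ℝ] Euc n)ˣ) (hA : fderiv ℝ τ y = A)
    (hV : DifferentiableAt ℝ V y) (hf : DifferentiableAt ℝ f y)
    (hV' : DifferentiableAt ℝ V' (τ y)) (hf' : DifferentiableAt ℝ f' (τ y))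
    (eV : (fun z => V' (τ z)) =ᶠ[𝓝 y] fun z => fderiv ℝ τ z (V z))
    (ef : (fun z => f' (τ z)) =ᶠ[𝓝 y] fun z => T.act (fderiv ℝ τ z) (f z)) :
    flatLie T V' f' (τ y) = T.act A (flatLie T V f y) := by
  have hτ1 : HasFDerivAt τ (A : Euc n →L[ℝ] Euc n) y := by
    rw [← hA]; exact (hτ.differentiableAt (by simp)).hasFDerivAt
  have hτ2 : DifferentiableAt ℝ (fderiv ℝ τ) y :=
    (hτ.fderiv_right (m := ∞) (by simp)).differentiableAt (by simp)
  have hsymm : IsSymmSndFDerivAt ℝ τ y := hτ.isSymmSndFDerivAt (by simpa using two_le_smooth)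
  have dV : ∀ h, fderiv ℝ V' (τ y) (A.val h) =
      fderiv ℝ (fderiv ℝ τ) y h (V y) + A.val (fderiv ℝ V y h) := by
    intro h
    have h1 := (hV'.hasFDerivAt.comp y hτ1).congr_of_eventuallyEq (eV.symm)
    have h2 := hτ2.hasFDerivAt.clm_apply hV.hasFDerivAt
    have := DFunLike.congr_fun (h1.unique h2) h
    simpa [hA, add_comm] using this
  have hact : DifferentiableAt ℝ T.act (fderiv ℝ τ y) := by
    rw [hA]; exact (contDiffAt_act T A.isUnit).differentiableAt (by simp)
  have df : ∀ h, fderiv ℝ f' (τ y) (A.val h) =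
      fderiv ℝ T.act A (fderiv ℝ (fderiv ℝ τ) y h) (f y) + T.act A (fderiv ℝ f y h) := by
    intro h
    have h1 := (hf'.hasFDerivAt.comp y hτ1).congr_of_eventuallyEq (ef.symm)
    have h2 := (hact.hasFDerivAt.comp y hτ2.hasFDerivAt).clm_apply hf.hasFDerivAt
    have := DFunLike.congr_fun (h1.unique h2) h
    simpa [hA, add_comm] using this
  have eV0 : V' (τ y) = A.val (V y) := by simpa [hA] using eV.eq_of_nhds
  have ef0 : f' (τ y) = T.act A (f y) := by simpa [hA] using ef.eq_of_nhds
  -- By symmetry of the Hessian of `τ`, the inhomogeneous part of `DV'` is `D²τ(V) A⁻¹`. The same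
  -- matrix comes out of `fderiv_act` in the derivative of `f'`, and the two contributions cancel in
  -- the Lie derivative.
  have hD : fderiv ℝ V' (τ y) =
      fderiv ℝ (fderiv ℝ τ) y (V y) * ↑A⁻¹ + A.val * fderiv ℝ V y * ↑A⁻¹ := by
    ext1 h
    have : A.val ((↑A⁻¹ : Euc n →L[ℝ] Euc n) h) = h := by
      rw [← mul_apply_eq_comp]; simp
    conv_lhs => rw [← this]
    rw [dV]
    simp [hsymm.eq (V y)]
  rw [flatLie, flatLie, eV0, ef0, df, hD, map_add, fderiv_act, map_sub]
  have h3 := DFunLike.congr_fun (act_mul_rho T A (fderiv ℝ V y)) (f y)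
  simp only [mul_apply_eq_comp] at h3
  rw [h3]
  simp only [mul_apply_eq_comp, add_apply]
  abel

/-- `[£_u, £_v] = £_{[u,v]}` on tensor fields, in coordinates. -/
theorem flatLie_commutator {U V : Euc n → Euc n} {f : Euc n → W} {y : Euc n}
    (hU : ContDiffAt ℝ ∞ U y) (hV : ContDiffAt ℝ ∞ V y) (hf : ContDiffAt ℝ ∞ f y) :
    flatLie T U (flatLie T V f) y - flatLie T V (flatLie T U f) y =
      flatLie T (VectorField.lieBracket ℝ U V) f y := by
  have key : ∀ {V : Euc n → Euc n}, ContDiffAt ℝ ∞ V y → ∀ h,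
      fderiv ℝ (flatLie T V f) y h =
        fderiv ℝ (fderiv ℝ f) y h (V y) + fderiv ℝ f y (fderiv ℝ V y h) -
        (rho T (fderiv ℝ (fderiv ℝ V) y h) (f y) + rho T (fderiv ℝ V y) (fderiv ℝ f y h)) := by
    intro V hV h
    have f1 := (hf.differentiableAt (by simp)).hasFDerivAt
    have V1 := (hV.differentiableAt (by simp)).hasFDerivAt
    have f2 := ((hf.fderiv_right (m := ∞) (by simp)).differentiableAt (by simp)).hasFDerivAt
    have V2 := ((hV.fderiv_right (m := ∞) (by simp)).differentiableAt (by simp)).hasFDerivAt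
    have := (f2.clm_apply V1).sub (((rho T).hasFDerivAt.comp y V2).clm_apply f1)
    have e := DFunLike.congr_fun this.fderiv h
    refine Eq.trans e ?_
    simp
    abel
  have hfs : IsSymmSndFDerivAt ℝ f y := hf.isSymmSndFDerivAt (by simpa using two_le_smooth)
  have hUs : IsSymmSndFDerivAt ℝ U y := hU.isSymmSndFDerivAt (by simpa using two_le_smooth)
  have hVs : IsSymmSndFDerivAt ℝ V y := hV.isSymmSndFDerivAt (by simpa using two_le_smooth)
  have hb : fderiv ℝ (VectorField.lieBracket ℝ U V) y =
      fderiv ℝ (fderiv ℝ V) y (U y) - fderiv ℝ (fderiv ℝ U) y (V y) +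
      (fderiv ℝ V y * fderiv ℝ U y - fderiv ℝ U y * fderiv ℝ V y) := by
    have U1 := (hU.differentiableAt (by simp)).hasFDerivAt
    have V1 := (hV.differentiableAt (by simp)).hasFDerivAt
    have U2 := ((hU.fderiv_right (m := ∞) (by simp)).differentiableAt (by simp)).hasFDerivAt
    have V2 := ((hV.fderiv_right (m := ∞) (by simp)).differentiableAt (by simp)).hasFDerivAt
    have := (V2.clm_apply U1).sub (U2.clm_apply V1)
    refine Eq.trans this.fderiv ?_
    ext1 h
    simp [hUs.eq h, hVs.eq h]
    abel
  rw [flatLie_apply T U, flatLie_apply T V (flatLie T U f), key hV, key hU,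
    flatLie_apply T (VectorField.lieBracket ℝ U V), hb, VectorField.lieBracket]
  simp only [flatLie, map_add, map_sub, rho_commutator, add_apply,
    sub_apply, mul_apply_eq_comp, hfs.eq (U y) (V y)]
  -- Second derivatives of `f` have cancelled by symmetry and its first derivatives have combined
  -- into `Df [U, V]`; only the products of two `rho` remain.
  have hc : ∀ A B : Euc n →L[ℝ] Euc n, rho T (A * B) - rho T (B * A) =
    rho T A * rho T B - rho T B * rho T A := fun A B => by rw [← map_sub, rho_commutator]
  have h1 := DFunLike.congr_fun (hc (fderiv ℝ V y) (fderiv ℝ U y)) (f y)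
  simp only [sub_apply, mul_apply_eq_comp] at h1
  rw [h1]
  abel

variable {P : Type*} [NormedAddCommGroup P] [NormedSpace ℝ P]

theorem _root_.ContDiffAt.fderiv_partial {F : Type*} [NormedAddCommGroup F] [NormedSpace ℝ F]
    {E : Type*} [NormedAddCommGroup E] [NormedSpace ℝ E] {g : P × E → F} {z : P × E}
    (hg : ContDiffAt ℝ ∞ g z) :
    ContDiffAt ℝ ∞ (fun z => fderiv ℝ (fun y => g (z.1, y)) z.2) z := by
  have h1 : ContDiffAt ℝ ∞ (fun z => (fderiv ℝ g z).comp (ContinuousLinearMap.inr ℝ P E)) z :=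
    (hg.fderiv_right (m := ∞) (by simp)).clm_comp contDiffAt_const
  refine h1.congr_of_eventuallyEq ?_
  filter_upwards [(hg.of_le (m := 1) (by simp)).eventually (by simp)] with w hw
  exact fderiv_partial_right (hw.differentiableAt (by simp))

theorem contDiffAt_flatLie {V : P × Euc n → Euc n} {f : P × Euc n → W} {z : P × Euc n}
    (hV : ContDiffAt ℝ ∞ V z) (hf : ContDiffAt ℝ ∞ f z) :
    ContDiffAt ℝ ∞ (fun z => flatLie T (fun y => V (z.1, y)) (fun y => f (z.1, y)) z.2) z :=
  (hf.fderiv_partial.clm_apply hV).sub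
    (((rho T).contDiff.contDiffAt.comp z hV.fderiv_partial).clm_apply hf)

theorem hasDerivAt_flatLie {V : ℝ × Euc n → Euc n} {f : ℝ × Euc n → W} {z : ℝ × Euc n}
    (hV : ContDiffAt ℝ ∞ V z) (hf : ContDiffAt ℝ ∞ f z) :
    HasDerivAt (fun t => flatLie T (fun y => V (t, y)) (fun y => f (t, y)) z.2)
      (flatLie T (fun y => deriv (fun t => V (t, y)) z.1) (fun y => f (z.1, y)) z.2 +
        flatLie T (fun y => V (z.1, y)) (fun y => deriv (fun t => f (t, y)) z.1) z.2) z.1 := by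
  have h1 := (hasDerivAt_fderiv_swap hf).clm_apply
    (hasDerivAt_partial_left (hV.differentiableAt (by simp)))
  have h2 := ((rho T).hasFDerivAt.comp_hasDerivAt z.1 (hasDerivAt_fderiv_swap hV)).clm_apply
    (hasDerivAt_partial_left (hf.differentiableAt (by simp)))
  refine (h1.sub h2).congr_deriv ?_
  rw [← (hasDerivAt_partial_left (hV.differentiableAt (by simp))).deriv,
    ← (hasDerivAt_partial_left (hf.differentiableAt (by simp))).deriv]
  simp only [flatLie]
  simp
  abel

end FlatLie

end CovPhase

namespace CovPhase

/-! ### Cartan calculus in coordinates -/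

section FlatCartan

variable {n : ℕ}

/-- The flat counterpart of `contract`. -/
noncomputable def flatContract {k : ℕ} (V : Euc n → Euc n)
    (α : Euc n → Euc n [⋀^Fin (k + 1)]→L[ℝ] ℝ) : Euc n → Euc n [⋀^Fin k]→L[ℝ] ℝ :=
  fun y => (α y).curryLeft (V y)

theorem extDeriv_apply' {k : ℕ} {α : Euc n → Euc n [⋀^Fin k]→L[ℝ] ℝ} {y : Euc n}
    (w : Fin (k + 1) → Euc n) :
    extDeriv α y w = ∑ i : Fin (k + 1), (-1) ^ (i : ℕ) * fderiv ℝ α y (w i) (i.removeNth w) := by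
  rw [extDeriv, ContinuousAlternatingMap.alternatizeUncurryFin_apply]
  simp

theorem isBoundedBilinearMap_curryLeft (E : Type*) [NormedAddCommGroup E] [NormedSpace ℝ E]
    (k : ℕ) : IsBoundedBilinearMap ℝ
      (fun p : (E [⋀^Fin (k + 1)]→L[ℝ] ℝ) × E => p.1.curryLeft p.2) where
  add_left α β x := by simp
  smul_left c α x := by simp
  add_right α x y := by simp
  smul_right c α x := by simp
  bound := by
    refine ⟨1, one_pos, fun α x => ?_⟩
    rw [one_mul, ← ContinuousAlternatingMap.norm_curryLeft α]
    exact ContinuousLinearMap.le_opNorm _ _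

theorem fderiv_flatContract {k : ℕ} {V : Euc n → Euc n}
    {α : Euc n → Euc n [⋀^Fin (k + 1)]→L[ℝ] ℝ} {y : Euc n} (hV : DifferentiableAt ℝ V y)
    (hα : DifferentiableAt ℝ α y) (h : Euc n) :
    fderiv ℝ (flatContract V α) y h =
      (fderiv ℝ α y h).curryLeft (V y) + (α y).curryLeft (fderiv ℝ V y h) := by
  have h1 := ((isBoundedBilinearMap_curryLeft (Euc n) k).hasFDerivAt (α y, V y)).comp y
    (hα.hasFDerivAt.prodMk hV.hasFDerivAt)
  refine (DFunLike.congr_fun h1.fderiv h).trans ?_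
  simp [IsBoundedBilinearMap.deriv, add_comm]

theorem removeNth_zero_vecCons {X : Type*} {k : ℕ} (x : X) (w : Fin k → X) :
    (0 : Fin (k + 1)).removeNth (Matrix.vecCons x w : Fin (k + 1) → X) = w := by
  funext j
  simp [Fin.removeNth]

theorem removeNth_succ_vecCons {X : Type*} {k : ℕ} (x : X) (w : Fin (k + 1) → X)
    (i : Fin (k + 1)) :
    i.succ.removeNth (Matrix.vecCons x w : Fin (k + 2) → X) =
      Matrix.vecCons x (i.removeNth w) := by
  funext j
  refine Fin.cases ?_ (fun j => ?_) j <;> simp [Fin.removeNth]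

/-- Polarization of the vanishing on a repeated vector `x + y`. -/
theorem map_vecCons_swap {E : Type*} [NormedAddCommGroup E] [NormedSpace ℝ E] {k : ℕ}
    (α : E [⋀^Fin (k + 2)]→L[ℝ] ℝ) (x y : E) (w : Fin k → E) :
    α (Matrix.vecCons x (Matrix.vecCons y w)) = -α (Matrix.vecCons y (Matrix.vecCons x w)) := by
  have := α.curryLeft_same (x + y)
  have h := DFunLike.congr_fun this w
  have hx := DFunLike.congr_fun (α.curryLeft_same x) w
  have hy := DFunLike.congr_fun (α.curryLeft_same y) w
  simp only [map_add, add_apply, ContinuousAlternatingMap.curryLeft_add,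
    ContinuousAlternatingMap.add_apply, ContinuousAlternatingMap.curryLeft_apply_apply,
    show ∀ w, (0 : E [⋀^Fin k]→L[ℝ] ℝ) w = 0 from fun _ => rfl] at h hx hy
  linarith

/-- `i_[u,v] = [£_u, i_v]`, where `£_u = d i_u + i_u d`, in coordinates. -/
theorem flatContract_bracket {k : ℕ} {U V : Euc n → Euc n}
    {α : Euc n → Euc n [⋀^Fin (k + 2)]→L[ℝ] ℝ} {y : Euc n} (hU : ContDiffAt ℝ ∞ U y)
    (hV : ContDiffAt ℝ ∞ V y) (hα : ContDiffAt ℝ ∞ α y) :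
    flatContract (VectorField.lieBracket ℝ U V) α y =
      extDeriv (flatContract U (flatContract V α)) y + flatContract U (extDeriv (flatContract V α)) y
      - flatContract V (extDeriv (flatContract U α)) y
      - flatContract V (flatContract U (extDeriv α)) y := by
  have hU1 := hU.differentiableAt (by simp)
  have hV1 := hV.differentiableAt (by simp)
  have hα1 := hα.differentiableAt (by simp)
  have hVα : DifferentiableAt ℝ (flatContract V α) y :=
    (ContDiffAt.curryLeft hα hV).differentiableAt (by simp)
  ext w
  simp only [ContinuousAlternatingMap.sub_apply, ContinuousAlternatingMap.add_apply]
  rw [flatContract, flatContract, flatContract, flatContract, flatContract]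
  simp only [ContinuousAlternatingMap.curryLeft_apply_apply, extDeriv_apply',
    fderiv_flatContract hV1 hα1, fderiv_flatContract hU1 hα1, fderiv_flatContract hU1 hVα,
    ContinuousAlternatingMap.add_apply, Fin.sum_univ_succ (n := k + 1),
    Fin.sum_univ_succ (n := k + 2), removeNth_zero_vecCons, removeNth_succ_vecCons]
  -- After splitting off the slots of the contracted vectors, the sums over the slots of `w` occur
  -- in pairs of opposite sign, and so do the terms with a derivative of `α` along `U` or `V`. What
  -- survives is `α` on `DV U - DU V`.
  have h1 : α y (Matrix.vecCons (fderiv ℝ V y (U y) - fderiv ℝ U y (V y)) w) =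
      α y (Matrix.vecCons (fderiv ℝ V y (U y)) w) -
        α y (Matrix.vecCons (fderiv ℝ U y (V y)) w) :=
    DFunLike.congr_fun ((α y).curryLeft.map_sub (fderiv ℝ V y (U y)) (fderiv ℝ U y (V y))) w
  have h2 : ∀ x w, (flatContract V α y) (Matrix.vecCons (fderiv ℝ U y x) w) =
      - α y (Matrix.vecCons (fderiv ℝ U y x) (Matrix.vecCons (V y) w)) :=
    fun x w => map_vecCons_swap _ _ _ _
  simp only [VectorField.lieBracket, h1, h2, Matrix.cons_val_zero, Matrix.cons_val_succ,
    Fin.val_zero, Fin.val_succ, pow_zero, one_mul, mul_add, mul_neg, Finset.sum_add_distrib,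
    Finset.sum_neg_distrib, pow_succ, mul_one, neg_mul, neg_neg, map_vecCons_swap _ (V y) (U y)]
  ring

end FlatCartan

/-! ### Smooth difference quotients -/

section Hadamard

open MeasureTheory

/-- Differentiation under an integral over the unit cube. -/
theorem hasFDerivAt_integral_Icc {E F : Type*} [NormedAddCommGroup E] [NormedSpace ℝ E]
    [NormedAddCommGroup F] [NormedSpace ℝ F] {k : ℕ} {g : E × (Fin k → ℝ) → F} {x₀ : E}
    (hg : ∀ s ∈ Icc (0 : Fin k → ℝ) 1, ContDiffAt ℝ 1 g (x₀, s)) :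
    HasFDerivAt (fun x => ∫ s in Icc (0 : Fin k → ℝ) 1, g (x, s))
      (∫ s in Icc (0 : Fin k → ℝ) 1, (fderiv ℝ g (x₀, s)).comp (ContinuousLinearMap.inl ℝ E _))
      x₀ := by
  have hK : IsCompact (Icc (0 : Fin k → ℝ) 1) := isCompact_Icc
  have hfc : ∀ s ∈ Icc (0 : Fin k → ℝ) 1, ContinuousAt (fderiv ℝ g) (x₀, s) := fun s hs =>
    ((hg s hs).fderiv_right (m := 0) (by simp)).continuousAt
  have hc' : ContinuousOn (fun s => fderiv ℝ g (x₀, s)) (Icc (0 : Fin k → ℝ) 1) := fun s hs =>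
    (ContinuousAt.comp (f := fun s => (x₀, s)) (g := fderiv ℝ g) (hfc s hs)
      (by fun_prop)).continuousWithinAt
  obtain ⟨C, hC⟩ := hK.exists_bound_of_continuousOn hc'
  -- Compactness of the cube makes the neighbourhood of `x₀` uniform in `s`, so a constant dominates
  -- the derivative.
  have hev : ∀ᶠ x in 𝓝 x₀, ∀ s ∈ Icc (0 : Fin k → ℝ) 1,
      DifferentiableAt ℝ g (x, s) ∧ ‖fderiv ℝ g (x, s)‖ ≤ C + 1 := by
    refine hK.eventually_forall_of_forall_eventually fun s hs => ?_
    have h1 : ∀ᶠ z in 𝓝 (x₀, s), DifferentiableAt ℝ g z :=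
      ((hg s hs).eventually (by simp)).mono fun z hz => hz.differentiableAt (by simp)
    have h2 : ∀ᶠ z in 𝓝 (x₀, s), ‖fderiv ℝ g z‖ < C + 1 :=
      (hfc s hs).norm.eventually_lt_const (by linarith [hC s hs])
    filter_upwards [h1, h2] with z h1 h2 using ⟨h1, h2.le⟩
  have hcont : ∀ x, (∀ s ∈ Icc (0 : Fin k → ℝ) 1, DifferentiableAt ℝ g (x, s)) →
      ContinuousOn (fun s => g (x, s)) (Icc (0 : Fin k → ℝ) 1) := fun x h s hs =>
    (ContinuousAt.comp (f := fun s => (x, s)) (g := g) (h s hs).continuousAt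
      (by fun_prop)).continuousWithinAt
  refine hasFDerivAt_integral_of_dominated_of_fderiv_le (F := fun x s => g (x, s))
    (F' := fun x s => (fderiv ℝ g (x, s)).comp (ContinuousLinearMap.inl ℝ E _))
    (bound := fun _ => (C + 1) * ‖ContinuousLinearMap.inl ℝ E (Fin k → ℝ)‖) hev ?_ ?_ ?_ ?_ ?_ ?_
  · filter_upwards [hev] with x hx
    exact (hcont x fun s hs => (hx s hs).1).aestronglyMeasurable_of_isCompact hK
      measurableSet_Icc
  · exact (hcont x₀ fun s hs => (hev.self_of_nhds s hs).1).integrableOn_compact hK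
  · exact (hc'.clm_comp continuousOn_const).aestronglyMeasurable_of_isCompact hK
      measurableSet_Icc
  · filter_upwards [ae_restrict_mem measurableSet_Icc] with s hs x hx
    refine (ContinuousLinearMap.opNorm_comp_le _ _).trans ?_
    gcongr
    exact (hx s hs).2
  · exact integrableOn_const hK.measure_lt_top.ne
  · filter_upwards [ae_restrict_mem measurableSet_Icc] with s hs x hx
    exact HasFDerivAt.comp x (g := g) (f := fun x => (x, s)) (hx s hs).1.hasFDerivAt
      (hasFDerivAt_prodMk_left x s)

theorem hasDerivAt_integral_Icc {k : ℕ} {g : ℝ × (Fin k → ℝ) → ℝ} {t : ℝ}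
    (hg : ∀ s ∈ Icc (0 : Fin k → ℝ) 1, ContDiffAt ℝ 1 g (t, s)) :
    HasDerivAt (fun t => ∫ s in Icc (0 : Fin k → ℝ) 1, g (t, s))
      (∫ s in Icc (0 : Fin k → ℝ) 1, deriv (fun t => g (t, s)) t) t := by
  have h := (hasFDerivAt_integral_Icc hg).hasDerivAt
  refine h.congr_deriv ?_
  rw [ContinuousLinearMap.integral_apply]
  · refine setIntegral_congr_fun measurableSet_Icc fun s hs => ?_
    rw [(hasDerivAt_partial_left ((hg s hs).differentiableAt (by simp))).deriv]
    simp
  · refine ContinuousOn.integrableOn_compact isCompact_Icc fun s hs => ?_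
    refine ContinuousAt.continuousWithinAt ?_
    have := ((hg s hs).fderiv_right (m := 0) (by simp)).continuousAt
    exact (ContinuousAt.comp (f := fun s => (t, s)) (g := fderiv ℝ g) this
      (by fun_prop)).clm_comp continuousAt_const

/-- Induction on the order: the derivative is an integral of the same kind with values in `E →L[ℝ]
F`. Hence `F` is quantified after `r`, and `E` and `F` are kept in one universe. -/
theorem contDiff_integral_Icc {E : Type} [NormedAddCommGroup E] [NormedSpace ℝ E] (r : ℕ) :
    ∀ {F : Type} [NormedAddCommGroup F] [NormedSpace ℝ F] {k : ℕ} {g : E × (Fin k → ℝ) → F},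
    ContDiff ℝ ∞ g → ContDiff ℝ r (fun x => ∫ s in Icc (0 : Fin k → ℝ) 1, g (x, s)) := by
  induction r with
  | zero =>
    intro F _ _ k g hg
    refine contDiff_zero.2 (continuous_iff_continuousAt.2 fun x => ?_)
    exact (hasFDerivAt_integral_Icc fun s _ =>
      (hg.of_le (by simp)).contDiffAt).continuousAt
  | succ r ih =>
    intro F _ _ k g hg
    refine contDiff_succ_iff_hasFDerivAt.2 ⟨_, ih (g := fun z => (fderiv ℝ g z).comp
      (ContinuousLinearMap.inl ℝ E (Fin k → ℝ))) ?_, fun x => hasFDerivAt_integral_Icc fun s _ =>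
      (hg.of_le (by simp)).contDiffAt⟩
    exact (hg.fderiv_right (by simp)).clm_comp contDiff_const

/-- Presents an interval integral as a cube integral, so that `contDiff_integral_Icc` covers
Hadamard's formula. -/
theorem integral_Icc_fin_one {F : Type*} [NormedAddCommGroup F] [NormedSpace ℝ F] (f : ℝ → F) :
    ∫ s in Icc (0 : Fin 1 → ℝ) 1, f (s 0) = ∫ s in (0 : ℝ)..1, f s := by
  have h := (volume_preserving_funUnique (Fin 1) ℝ).setIntegral_preimage_emb
    (MeasurableEquiv.funUnique (Fin 1) ℝ).measurableEmbedding f (Icc 0 1)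
  rw [intervalIntegral.integral_of_le zero_le_one, ← integral_Icc_eq_integral_Ioc, ← h]
  congr 2
  ext s
  simp [Pi.le_def]

/-- The difference quotient of a smooth family is smooth. -/
theorem eventually_contDiffAt_dslope {E : Type} [NormedAddCommGroup E] [NormedSpace ℝ E]
    [FiniteDimensional ℝ E] {F : Type} [NormedAddCommGroup F] [NormedSpace ℝ F]
    [CompleteSpace F] {g : ℝ × E → F} {y₀ : E}
    (hg : ∀ᶠ z in 𝓝 ((0 : ℝ), y₀), ContDiffAt ℝ ∞ g z) :
    ∀ᶠ z in 𝓝 ((0 : ℝ), y₀),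
      ContDiffAt ℝ ∞ (fun z : ℝ × E => dslope (fun t => g (t, z.2)) 0 z.1) z := by
  obtain ⟨r, hr, hball⟩ := Metric.eventually_nhds_iff_ball.1 hg
  -- A cut-off makes `g` globally smooth without changing it on the ball of radius `r / 4`.
  let χ : ContDiffBump ((0 : ℝ), y₀) := ⟨r / 4, r / 2, by positivity, by linarith⟩
  have hG : ContDiff ℝ ∞ (fun z => χ z • g z) := by
    rw [contDiff_iff_contDiffAt]
    intro z
    by_cases hz : z ∈ Metric.ball ((0 : ℝ), y₀) r
    · exact χ.contDiffAt.smul (hball z hz)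
    · have : (fun z => χ z • g z) =ᶠ[𝓝 z] fun _ => 0 := by
        have hz' : z ∉ Metric.closedBall ((0 : ℝ), y₀) (r / 2) := fun h =>
          hz (Metric.closedBall_subset_ball (by linarith) h)
        filter_upwards [Metric.isClosed_closedBall.isOpen_compl.mem_nhds hz'] with w hw
        rw [χ.zero_of_le_dist, zero_smul]
        simp only [mem_compl_iff, Metric.mem_closedBall, not_le] at hw
        exact hw.le
      exact contDiffAt_const.congr_of_eventuallyEq this
  set G : ℝ × E → F := fun z => χ z • g z with hGdef
  have hGg : ∀ z ∈ Metric.ball ((0 : ℝ), y₀) (r / 4), G z = g z := fun z hz => by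
    simp only [hGdef]
    rw [χ.one_of_mem_closedBall (Metric.ball_subset_closedBall hz), one_smul]
  have hD : ContDiff ℝ ∞ (fun z : ℝ × E => ∫ s in Icc (0 : Fin 1 → ℝ) 1,
      fderiv ℝ G (s 0 * z.1, z.2) (1, 0)) := by
    rw [contDiff_infty]
    intro m
    refine contDiff_integral_Icc m (g := fun p : (ℝ × E) × (Fin 1 → ℝ) =>
      fderiv ℝ G (p.2 0 * p.1.1, p.1.2) (1, 0)) ?_
    refine ContDiff.clm_apply ?_ contDiff_const
    refine (hG.fderiv_right (m := ∞) (by simp)).comp ?_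
    fun_prop
  -- Hadamard: `(G(t) - G(0)) / t = ∫₀¹ ∂ₜG(s t) ds`. The right side makes sense at `t = 0`, with
  -- the value that `dslope` takes there.
  have hint : ∀ z : ℝ × E, dslope (fun t => G (t, z.2)) 0 z.1 =
      ∫ s in Icc (0 : Fin 1 → ℝ) 1, fderiv ℝ G (s 0 * z.1, z.2) (1, 0) := by
    intro z
    rw [integral_Icc_fin_one fun s : ℝ => fderiv ℝ G (s * z.1, z.2) (1, 0)]
    have hd : ∀ w, DifferentiableAt ℝ G w := fun w => hG.contDiffAt.differentiableAt (by simp)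
    by_cases h0 : z.1 = 0
    · rw [h0, dslope_same, (hasDerivAt_partial_left (z := (0, z.2)) (hd _)).deriv]
      simp
    · have h1 : ∀ s : ℝ, HasDerivAt (fun s => G (s * z.1, z.2))
          (z.1 • fderiv ℝ G (s * z.1, z.2) (1, 0)) s := by
        intro s
        exact HasDerivAt.scomp s (h := fun s => s * z.1) (g₁ := fun t => G (t, z.2))
          (hasDerivAt_partial_left (z := (s * z.1, z.2)) (hd _)) (hasDerivAt_mul_const z.1)
      have hcont : Continuous fun s : ℝ => fderiv ℝ G (s * z.1, z.2) (1, 0) :=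
        ((hG.continuous_fderiv (by simp)).comp (by fun_prop)).clm_apply continuous_const
      have h2 := intervalIntegral.integral_eq_sub_of_hasDerivAt (fun s _ => h1 s)
        ((hcont.const_smul z.1).intervalIntegrable 0 1)
      rw [intervalIntegral.integral_smul] at h2
      rw [dslope_of_ne _ h0, slope, sub_zero, vsub_eq_sub]
      rw [one_mul, zero_mul] at h2
      rw [← h2, smul_smul, inv_mul_cancel₀ h0, one_smul]
  filter_upwards [Metric.ball_mem_nhds ((0 : ℝ), y₀) (by positivity : 0 < r / 4)] with z hz
  refine hD.contDiffAt.congr_of_eventuallyEq ?_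
  filter_upwards [Metric.isOpen_ball.mem_nhds hz] with w hw
  rw [← hint w]
  -- The quotient at `w` also involves the parameter `0`; in the sup metric this second point lies
  -- in the same ball.
  have hw0 : ((0 : ℝ), w.2) ∈ Metric.ball ((0 : ℝ), y₀) (r / 4) := by
    rw [Metric.mem_ball, Prod.dist_eq] at hw ⊢
    simp only [dist_self]
    exact max_lt (by positivity) ((le_max_right _ _).trans_lt hw)
  by_cases h0 : w.1 = 0
  · rw [h0, dslope_same, dslope_same]
    refine Filter.EventuallyEq.deriv_eq ?_
    have : Filter.Tendsto (fun t : ℝ => (t, w.2)) (𝓝 0) (𝓝 (0, w.2)) :=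
      Continuous.tendsto (by fun_prop) 0
    filter_upwards [this (Metric.isOpen_ball.mem_nhds hw0)] with t ht
    exact (hGg _ ht).symm
  · rw [dslope_of_ne _ h0, dslope_of_ne _ h0, slope, slope, hGg _ hw, hGg _ hw0]

end Hadamard

/-! ### Stokes' theorem on the unit cube -/

section BoxStokes

open MeasureTheory

theorem fderiv_alternating_apply {E E' : Type*} [NormedAddCommGroup E] [NormedSpace ℝ E]
    [NormedAddCommGroup E'] [NormedSpace ℝ E'] {k : ℕ} {η : E → E' [⋀^Fin k]→L[ℝ] ℝ} {t : E}
    (hη : DifferentiableAt ℝ η t) (h : E) (w : Fin k → E') :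
    fderiv ℝ η t h w = fderiv ℝ (fun t => η t w) t h := by
  let L : (E' [⋀^Fin k]→L[ℝ] ℝ) →L[ℝ] ℝ :=
    LinearMap.mkContinuous ⟨⟨fun α => α w, fun _ _ => rfl⟩, fun _ _ => rfl⟩ (∏ i, ‖w i‖)
      (fun α => by rw [mul_comm]; exact α.le_opNorm _)
  exact (DFunLike.congr_fun (L.hasFDerivAt.comp t hη.hasFDerivAt).fderiv h).symm

/-- The divergence theorem for the vector field whose `i`-th component is `(-1)^i` times `η` on the
basis vectors other than the `i`-th; its divergence is `dη` on the standard basis. -/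
theorem integral_extDeriv_Icc {k : ℕ}
    {η : (Fin (k + 1) → ℝ) → (Fin (k + 1) → ℝ) [⋀^Fin k]→L[ℝ] ℝ} (hη : ContDiff ℝ ∞ η) :
    ∫ t in Icc (0 : Fin (k + 1) → ℝ) 1, extDeriv η t (fun i => Pi.single i 1) =
      ∑ i : Fin (k + 1), (-1) ^ (i : ℕ) *
        ((∫ t in Icc (0 : Fin k → ℝ) 1,
            η (i.insertNth (α := fun _ => ℝ) 1 t) (fun j => Pi.single (i.succAbove j) 1)) -
          ∫ t in Icc (0 : Fin k → ℝ) 1,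
            η (i.insertNth (α := fun _ => ℝ) 0 t) (fun j => Pi.single (i.succAbove j) 1)) := by
  have hd : ∀ t, DifferentiableAt ℝ η t := fun t => hη.contDiffAt.differentiableAt (by simp)
  let f : Fin (k + 1) → (Fin (k + 1) → ℝ) → ℝ := fun i t =>
    (-1) ^ (i : ℕ) * η t (fun j => Pi.single (i.succAbove j) 1)
  have hf : ∀ i, ContDiff ℝ ∞ (f i) := fun i =>
    contDiff_const.mul (contDiff_iff_contDiffAt.2 fun t =>
      hη.contDiffAt.alternating_apply fun _ => contDiffAt_const)
  have hf' : ∀ i t, fderiv ℝ (f i) t (Pi.single i 1) =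
      (-1) ^ (i : ℕ) * fderiv ℝ η t (Pi.single i 1) (fun j => Pi.single (i.succAbove j) 1) := by
    intro i t
    rw [fderiv_alternating_apply (hd t)]
    have h1 : DifferentiableAt ℝ (fun t => η t (fun j => Pi.single (i.succAbove j) 1)) t :=
      (hη.contDiffAt.alternating_apply (w := fun j _ => Pi.single (i.succAbove j) 1)
        fun _ => contDiffAt_const).differentiableAt (by simp)
    rw [(h1.hasFDerivAt.const_mul ((-1 : ℝ) ^ (i : ℕ))).fderiv]
    simp
  have key := integral_divergence_of_hasFDerivAt_off_countable' (0 : Fin (k + 1) → ℝ) 1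
    (zero_le_one) f (fun i t => fderiv ℝ (f i) t) ∅ countable_empty
    (fun i => (hf i).continuous.continuousOn)
    (fun t _ i => ((hf i).contDiffAt.differentiableAt (by simp)).hasFDerivAt)
    (ContinuousOn.integrableOn_compact isCompact_Icc (Continuous.continuousOn
      (continuous_finsetSum _ fun i _ =>
        ((hf i).continuous_fderiv (by simp)).clm_apply continuous_const)))
  have e : ∀ t, extDeriv η t (fun i => Pi.single i 1) =
      ∑ i, fderiv ℝ (f i) t (Pi.single i 1) := by
    intro t
    rw [extDeriv, ContinuousAlternatingMap.alternatizeUncurryFin_apply]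
    refine Finset.sum_congr rfl fun i _ => ?_
    rw [hf']
    simp only [zsmul_eq_mul, Int.cast_pow, Int.cast_neg, Int.cast_one]
    rfl
  simp only [e]
  refine key.trans (Finset.sum_congr rfl fun i _ => ?_)
  rw [mul_sub, ← integral_const_mul, ← integral_const_mul]
  rfl

end BoxStokes

end CovPhase

namespace CovPhase

/-! ### Charts and coordinate changes -/

section Charts

variable (E : Type*) [NormedAddCommGroup E] [NormedSpace ℝ E]
  {X : Type*} [TopologicalSpace X] [ChartedSpace E X]

/-- The preferred chart at `x`. -/
noncomputable abbrev ch (x : X) : PartialEquiv X E := extChartAt 𝓘(ℝ, E) x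

theorem mem_ch_source (x : X) : x ∈ (ch E x).source := mem_extChartAt_source x

theorem ch_source_mem_nhds {x₀ p : X} (hp : p ∈ (ch E x₀).source) : (ch E x₀).source ∈ 𝓝 p :=
  extChartAt_source_mem_nhds' hp

theorem ch_target_mem_nhds {x₀ p : X} (hp : p ∈ (ch E x₀).source) :
    (ch E x₀).target ∈ 𝓝 (ch E x₀ p) :=
  extChartAt_target_mem_nhds' (I := 𝓘(ℝ, E)) ((ch E x₀).map_source hp)

theorem continuousAt_ch {x₀ p : X} (hp : p ∈ (ch E x₀).source) : ContinuousAt (ch E x₀) p :=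
  continuousAt_extChartAt' hp

theorem tendsto_ch_symm {x₀ p : X} (hp : p ∈ (ch E x₀).source) :
    Filter.Tendsto (ch E x₀).symm (𝓝 (ch E x₀ p)) (𝓝 p) := by
  have := continuousAt_extChartAt_symm' (I := 𝓘(ℝ, E)) hp
  rw [ContinuousAt, (ch E x₀).left_inv hp] at this
  exact this

theorem eventually_ch_symm {x₀ p : X} (hp : p ∈ (ch E x₀).source) {Q : X → Prop}
    (hQ : ∀ᶠ x in 𝓝 p, Q x) : ∀ᶠ y in 𝓝 (ch E x₀ p), Q ((ch E x₀).symm y) :=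
  (tendsto_ch_symm E hp).eventually hQ

/-- The coordinate change of tangent vectors. -/
noncomputable abbrev tc [IsManifold 𝓘(ℝ, E) ∞ X] (x y p : X) : E →L[ℝ] E :=
  tangentCoordChange 𝓘(ℝ, E) x y p

variable [IsManifold 𝓘(ℝ, E) ∞ X]

theorem tc_eq_fderiv (x y p : X) :
    tc E x y p = fderiv ℝ (ch E y ∘ (ch E x).symm) (ch E x p) := by
  rw [tc, tangentCoordChange_def, ModelWithCorners.range_eq_univ, fderivWithin_univ]

theorem contDiffAt_transition {x y p : X} (hx : p ∈ (ch E x).source) (hy : p ∈ (ch E y).source) :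
    ContDiffAt ℝ ∞ (ch E y ∘ (ch E x).symm) (ch E x p) := by
  have h' : ch E x p ∈ ((ch E x).symm ≫ (ch E y)).source := by
    rw [PartialEquiv.trans_source'', PartialEquiv.symm_symm, PartialEquiv.symm_target]
    exact mem_image_of_mem _ ⟨hx, hy⟩
  have := contDiffWithinAt_ext_coord_change (I := 𝓘(ℝ, E)) (n := ∞) y x h'
  rwa [ModelWithCorners.range_eq_univ, contDiffWithinAt_univ] at this

theorem tc_self {x p : X} (hx : p ∈ (ch E x).source) : tc E x x p = 1 := by
  ext v
  exact tangentCoordChange_self hx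

theorem tc_mul_tc {w x y p : X} (hw : p ∈ (ch E w).source) (hx : p ∈ (ch E x).source)
    (hy : p ∈ (ch E y).source) : tc E x y p * tc E w x p = tc E w y p := by
  ext v
  exact tangentCoordChange_comp ⟨⟨hw, hx⟩, hy⟩

/-- A coordinate change of tangent vectors as an invertible map. -/
noncomputable def tcUnit {x y p : X} (hx : p ∈ (ch E x).source) (hy : p ∈ (ch E y).source) :
    (E →L[ℝ] E)ˣ where
  val := tc E x y p
  inv := tc E y x p
  val_inv := by rw [tc_mul_tc E hy hx hy, tc_self E hy]
  inv_val := by rw [tc_mul_tc E hx hy hx, tc_self E hx]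

theorem isUnit_tc {x y p : X} (hx : p ∈ (ch E x).source) (hy : p ∈ (ch E y).source) :
    IsUnit (tc E x y p) := ⟨tcUnit E hx hy, rfl⟩

theorem contDiffAt_tc {a b w p : X} (ha : p ∈ (ch E a).source) (hb : p ∈ (ch E b).source)
    (hw : p ∈ (ch E w).source) :
    ContDiffAt ℝ ∞ (fun y => tc E a b ((ch E w).symm y)) (ch E w p) := by
  have h1 : ContDiffAt ℝ ∞ (fderiv ℝ (ch E b ∘ (ch E a).symm)) ((ch E a ∘ (ch E w).symm)
      (ch E w p)) := by
    rw [Function.comp_apply, (ch E w).left_inv hw]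
    exact (contDiffAt_transition E ha hb).fderiv_right (by simp)
  have h2 := h1.comp (ch E w p) (contDiffAt_transition E hw ha)
  refine h2.congr_of_eventuallyEq (Filter.Eventually.of_forall fun y => ?_)
  simp only [tc_eq_fderiv]
  rfl

/-- The derivative of a map read in charts. -/
theorem fderiv_writtenInCharts {E' : Type*} [NormedAddCommGroup E'] [NormedSpace ℝ E']
    {Y : Type*} [TopologicalSpace Y] [ChartedSpace E' Y] [IsManifold 𝓘(ℝ, E') ∞ Y]
    {f : Y → X} {y₀ y : Y} {x₀ : X} (hy : y ∈ (ch E' y₀).source) (hx : f y ∈ (ch E x₀).source)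
    (hf : MDifferentiableAt 𝓘(ℝ, E') 𝓘(ℝ, E) f y) :
    fderiv ℝ (ch E x₀ ∘ f ∘ (ch E' y₀).symm) (ch E' y₀ y) =
      (tc E (f y) x₀ (f y)).comp
        ((mfderiv 𝓘(ℝ, E') 𝓘(ℝ, E) f y : E' →L[ℝ] E).comp (tc E' y₀ y y)) := by
  have h1 := ((contDiffAt_transition E' hy (mem_ch_source E' y)).differentiableAt
    (by simp)).hasFDerivAt
  have h3 := ((contDiffAt_transition E (mem_ch_source E (f y)) hx).differentiableAt
    (by simp)).hasFDerivAt
  -- In the charts centred at `y` and `f y` the derivative is `mfderiv` by definition; the other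
  -- charts contribute transition maps.
  have h2 : HasFDerivAt (ch E (f y) ∘ f ∘ (ch E' y).symm)
      (mfderiv 𝓘(ℝ, E') 𝓘(ℝ, E) f y : E' →L[ℝ] E) (ch E' y y) := by
    have hd : DifferentiableAt ℝ (ch E (f y) ∘ f ∘ (ch E' y).symm) (ch E' y y) := by
      have := hf.2
      rw [DifferentiableWithinAtProp] at this
      simp only [preimage_univ, univ_inter, ModelWithCorners.range_eq_univ] at this
      exact differentiableWithinAt_univ.1 this
    have e : (mfderiv 𝓘(ℝ, E') 𝓘(ℝ, E) f y : E' →L[ℝ] E) =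
        fderiv ℝ (ch E (f y) ∘ f ∘ (ch E' y).symm) (ch E' y y) :=
      hf.mfderiv.trans (by rw [ModelWithCorners.range_eq_univ, fderivWithin_univ]; rfl)
    rw [e]
    exact hd.hasFDerivAt
  rw [← tc_eq_fderiv] at h1 h3
  have e1 : (ch E' y ∘ (ch E' y₀).symm) (ch E' y₀ y) = ch E' y y := by
    rw [Function.comp_apply, (ch E' y₀).left_inv hy]
  have e2 : (ch E (f y) ∘ f ∘ (ch E' y).symm) (ch E' y y) = ch E (f y) (f y) := by
    simp only [Function.comp_apply]
    rw [(ch E' y).left_inv (mem_ch_source E' y)]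
  rw [← e1] at h2
  have h4 := h2.comp _ h1
  rw [← e2, ← e1] at h3
  have h5 := HasFDerivAt.comp (g := ch E x₀ ∘ (ch E (f y)).symm)
    (f := (ch E (f y) ∘ f ∘ (ch E' y).symm) ∘ (ch E' y ∘ (ch E' y₀).symm)) _ h3 h4
  refine HasFDerivAt.fderiv (h5.congr_of_eventuallyEq ?_)
  have hev1 : ∀ᶠ z in 𝓝 (ch E' y₀ y), (ch E' y₀).symm z ∈ (ch E' y).source :=
    eventually_ch_symm E' hy (ch_source_mem_nhds E' (mem_ch_source E' y))
  have hev2 : ∀ᶠ z in 𝓝 (ch E' y₀ y), f ((ch E' y₀).symm z) ∈ (ch E (f y)).source :=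
    eventually_ch_symm E' hy (hf.continuousAt.eventually
      (ch_source_mem_nhds E (mem_ch_source E (f y))))
  filter_upwards [hev1, hev2] with z hz1 hz2
  simp only [Function.comp_apply]
  rw [(ch E' y).left_inv hz1, (ch E (f y)).left_inv hz2]

end Charts

end CovPhase

namespace CovPhase

/-! ### Tensor fields in charts -/

section FieldsInCharts

variable {n : ℕ} {W : Type*} [NormedAddCommGroup W] [NormedSpace ℝ W] (T : TensorType n W)
  {M : Type*} [TopologicalSpace M] [ChartedSpace (Euc n) M] [IsManifold 𝓘(ℝ, Euc n) ∞ M]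
  {P : Type*} [NormedAddCommGroup P] [NormedSpace ℝ P]

theorem fieldInChart_ch {x₀ p : M} (hp : p ∈ (ch (Euc n) x₀).source) (φ : M → W) :
    fieldInChart T x₀ φ (ch (Euc n) x₀ p) = T.act (tc (Euc n) p x₀ p) (φ p) := by
  rw [fieldInChart, (ch (Euc n) x₀).left_inv hp]

theorem fieldInChart_self (p : M) (φ : M → W) :
    fieldInChart T p φ (ch (Euc n) p p) = φ p := by
  rw [fieldInChart_ch T (mem_ch_source _ p), tc_self _ (mem_ch_source _ p), T.act_one]
  rfl

theorem fieldInChart_change {x₀ x₁ p : M} (h0 : p ∈ (ch (Euc n) x₀).source)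
    (h1 : p ∈ (ch (Euc n) x₁).source) (φ : M → W) :
    fieldInChart T x₀ φ (ch (Euc n) x₀ p) =
      T.act (tc (Euc n) x₁ x₀ p) (fieldInChart T x₁ φ (ch (Euc n) x₁ p)) := by
  have hp := mem_ch_source (Euc n) p
  rw [fieldInChart_ch T h0, fieldInChart_ch T h1, ← mul_apply_eq_comp,
    ← T.act_mul _ _ (isUnit_tc _ h1 h0) (isUnit_tc _ hp h1), tc_mul_tc _ hp h1 h0]

/-- Points of a chart domain, read in the chart. -/
theorem eventually_inChart {x₀ p : M} (h0 : p ∈ (ch (Euc n) x₀).source) {Q : Euc n → Prop}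
    (hQ : ∀ᶠ x in 𝓝 p, x ∈ (ch (Euc n) x₀).source → Q (ch (Euc n) x₀ x)) :
    ∀ᶠ y in 𝓝 (ch (Euc n) x₀ p), Q y := by
  filter_upwards [eventually_ch_symm (Euc n) h0 hQ, ch_target_mem_nhds (Euc n) h0] with y h1 h2
  have := h1 ((ch (Euc n) x₀).map_target h2)
  rwa [(ch (Euc n) x₀).right_inv h2] at this

/-- The two chart expressions differ by the transition map and the action of its derivative, both
smooth. The order `r` is left free because chart independence of `£` and `d` is needed for tensors
that are only `C¹`. -/
theorem contDiffAt_inChart_change {x₀ x₁ p : M} (h0 : p ∈ (ch (Euc n) x₀).source)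
    (h1 : p ∈ (ch (Euc n) x₁).source) {r : WithTop ℕ∞} (hr : r ≤ ∞) {Φ : P → M → W} {q : P}
    (h : ContDiffAt ℝ r (fun z : P × Euc n => fieldInChart T x₁ (Φ z.1) z.2)
      (q, ch (Euc n) x₁ p)) :
    ContDiffAt ℝ r (fun z : P × Euc n => fieldInChart T x₀ (Φ z.1) z.2)
      (q, ch (Euc n) x₀ p) := by
  have hτ : ContDiffAt ℝ r (fun z : P × Euc n =>
      (z.1, (ch (Euc n) x₁ ∘ (ch (Euc n) x₀).symm) z.2)) (q, ch (Euc n) x₀ p) :=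
    contDiffAt_fst.prodMk (ContDiffAt.comp (g := ch (Euc n) x₁ ∘ (ch (Euc n) x₀).symm)
      (f := fun z : P × Euc n => z.2) (q, ch (Euc n) x₀ p)
      ((contDiffAt_transition (Euc n) h0 h1).of_le hr) contDiffAt_snd)
  have hpt : (fun z : P × Euc n => (z.1, (ch (Euc n) x₁ ∘ (ch (Euc n) x₀).symm) z.2))
      (q, ch (Euc n) x₀ p) = (q, ch (Euc n) x₁ p) := by
    simp only [Function.comp_apply]
    rw [(ch (Euc n) x₀).left_inv h0]
  rw [← hpt] at h
  have hg := ContDiffAt.comp (g := fun z : P × Euc n => fieldInChart T x₁ (Φ z.1) z.2)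
    (f := fun z : P × Euc n => (z.1, (ch (Euc n) x₁ ∘ (ch (Euc n) x₀).symm) z.2))
    (q, ch (Euc n) x₀ p) h hτ
  have hact : ContDiffAt ℝ r (fun z : P × Euc n =>
      T.act (tc (Euc n) x₁ x₀ ((ch (Euc n) x₀).symm z.2))) (q, ch (Euc n) x₀ p) := by
    have e : ContDiffAt ℝ ∞ (fun y => T.act (tc (Euc n) x₁ x₀ ((ch (Euc n) x₀).symm y)))
        (ch (Euc n) x₀ p) := by
      refine ContDiffAt.comp (ch (Euc n) x₀ p) (g := T.act) ?_ (contDiffAt_tc (Euc n) h1 h0 h0)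
      rw [(ch (Euc n) x₀).left_inv h0]
      exact contDiffAt_act T (isUnit_tc _ h1 h0)
    exact ContDiffAt.comp
      (g := fun y => T.act (tc (Euc n) x₁ x₀ ((ch (Euc n) x₀).symm y)))
      (f := fun z : P × Euc n => z.2) (q, ch (Euc n) x₀ p) (e.of_le hr) contDiffAt_snd
  refine (hact.clm_apply hg).congr_of_eventuallyEq ?_
  have hev : ∀ᶠ y in 𝓝 (ch (Euc n) x₀ p), ∀ φ : M → W, fieldInChart T x₀ φ y =
      T.act (tc (Euc n) x₁ x₀ ((ch (Euc n) x₀).symm y))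
        (fieldInChart T x₁ φ ((ch (Euc n) x₁ ∘ (ch (Euc n) x₀).symm) y)) := by
    refine eventually_inChart h0 ?_
    filter_upwards [ch_source_mem_nhds (Euc n) h1] with x hx1 hx0 φ
    rw [Function.comp_apply, (ch (Euc n) x₀).left_inv hx0]
    exact fieldInChart_change T hx0 hx1 φ
  have := (continuous_snd.tendsto (q, ch (Euc n) x₀ p)).eventually hev
  filter_upwards [this] with z hz using hz _

/-- Joint smoothness near `(q, p)` of a family of tensor fields. -/
def SmoothFam (Φ : P → M → W) (q : P) (p : M) : Prop :=
  ContDiffAt ℝ ∞ (fun z : P × Euc n => fieldInChart T p (Φ z.1) z.2) (q, ch (Euc n) p p)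

variable {T}

theorem SmoothFam.inChart {Φ : P → M → W} {q : P} {p x₀ : M} (h : SmoothFam T Φ q p)
    (h0 : p ∈ (ch (Euc n) x₀).source) :
    ContDiffAt ℝ ∞ (fun z : P × Euc n => fieldInChart T x₀ (Φ z.1) z.2) (q, ch (Euc n) x₀ p) :=
  contDiffAt_inChart_change T h0 (mem_ch_source _ p) le_rfl h

/-- The field obtained by restricting a family of fields to a parameter value. -/
theorem SmoothFam.apply {Φ : P → M → W} {q : P} {p x₀ : M} (h : SmoothFam T Φ q p)
    (h0 : p ∈ (ch (Euc n) x₀).source) :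
    ContDiffAt ℝ ∞ (fieldInChart T x₀ (Φ q)) (ch (Euc n) x₀ p) :=
  (h.inChart h0).comp (ch (Euc n) x₀ p) (contDiffAt_const.prodMk contDiffAt_id)

theorem SmoothFam.const {φ : M → W} {q : P} {p : M}
    (h : ContDiffAt ℝ ∞ (fieldInChart T p φ) (ch (Euc n) p p)) :
    SmoothFam T (fun _ : P => φ) q p :=
  ContDiffAt.comp (g := fieldInChart T p φ) (f := fun z : P × Euc n => z.2) _ h contDiffAt_snd

theorem fieldInChart_add (x₀ : M) (φ ψ : M → W) :
    fieldInChart T x₀ (φ + ψ) = fieldInChart T x₀ φ + fieldInChart T x₀ ψ := by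
  funext y; simp [fieldInChart]

theorem fieldInChart_smul (x₀ : M) (a : ℝ) (φ : M → W) :
    fieldInChart T x₀ (a • φ) = a • fieldInChart T x₀ φ := by
  funext y; simp [fieldInChart]

theorem SmoothFam.add {Φ Ψ : P → M → W} {q : P} {p : M} (h : SmoothFam T Φ q p)
    (h' : SmoothFam T Ψ q p) : SmoothFam T (fun q => Φ q + Ψ q) q p := by
  refine (ContDiffAt.add h h').congr_of_eventuallyEq (Filter.Eventually.of_forall fun z => ?_)
  simp only [fieldInChart_add]
  rfl

/-- Multiplication of a family of fields by a family of functions. -/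
theorem SmoothFam.smul {Φ : P → M → W} {a : P → M → ℝ} {q : P} {p : M} (h : SmoothFam T Φ q p)
    (ha : ContDiffAt ℝ ∞ (fun z : P × Euc n => a z.1 ((ch (Euc n) p).symm z.2))
      (q, ch (Euc n) p p)) : SmoothFam T (fun q x => a q x • Φ q x) q p := by
  refine (ContDiffAt.smul ha h).congr_of_eventuallyEq (Filter.Eventually.of_forall fun z => ?_)
  simp [fieldInChart]

theorem SmoothFam.comp {P' : Type*} [NormedAddCommGroup P'] [NormedSpace ℝ P'] {Φ : P → M → W}
    {τ : P' → P} {q : P'} {p : M} (h : SmoothFam T Φ (τ q) p) (hτ : ContDiffAt ℝ ∞ τ q) :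
    SmoothFam T (fun q => Φ (τ q)) q p := by
  refine ContDiffAt.comp (g := fun z : P × Euc n => fieldInChart T p (Φ z.1) z.2)
    (f := fun z : P' × Euc n => (τ z.1, z.2)) (q, ch (Euc n) p p) h ?_
  exact (hτ.comp (q, ch (Euc n) p p) contDiffAt_fst).prodMk contDiffAt_snd

theorem SmoothFam.congr {Φ Ψ : P → M → W} {q : P} {p : M} (h : SmoothFam T Φ q p)
    (e : ∀ᶠ z in 𝓝 (q, p), Ψ z.1 z.2 = Φ z.1 z.2) : SmoothFam T Ψ q p := by
  refine ContDiffAt.congr_of_eventuallyEq h ?_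
  have ht : Filter.Tendsto (fun z : P × Euc n => (z.1, (ch (Euc n) p).symm z.2))
      (𝓝 (q, ch (Euc n) p p)) (𝓝 (q, p)) := by
    rw [nhds_prod_eq, nhds_prod_eq]
    exact Filter.tendsto_id.prodMap (tendsto_ch_symm (Euc n) (mem_ch_source _ p))
  filter_upwards [ht.eventually e] with z hz
  simp only [fieldInChart, hz]

theorem SmoothField.fam {φ : M → W} (h : SmoothField T φ) (q : P) (p : M) :
    SmoothFam T (fun _ : P => φ) q p := SmoothFam.const (h p)

theorem SmoothField.of_fam {Φ : P → M → W} {q : P} (h : ∀ p, SmoothFam T Φ q p) :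
    SmoothField T (Φ q) := fun p => (h p).apply (mem_ch_source _ p)

theorem smoothField_zero : SmoothField T (0 : M → W) := fun p => by
  have : fieldInChart T p (0 : M → W) = fun _ => 0 := by funext y; simp [fieldInChart]
  rw [this]; exact contDiffAt_const

theorem SmoothField.add {φ ψ : M → W} (h : SmoothField T φ) (h' : SmoothField T ψ) :
    SmoothField T (φ + ψ) := fun p => by
  rw [fieldInChart_add]; exact (h p).add (h' p)

theorem SmoothField.smul (a : ℝ) {φ : M → W} (h : SmoothField T φ) : SmoothField T (a • φ) :=
  fun p => by rw [fieldInChart_smul]; exact contDiffAt_const.smul (h p)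

theorem SmoothField.sub {φ ψ : M → W} (h : SmoothField T φ) (h' : SmoothField T ψ) :
    SmoothField T (φ - ψ) := by
  have : φ - ψ = φ + (-1 : ℝ) • ψ := by simp [sub_eq_add_neg]
  rw [this]; exact h.add (h'.smul _)

/-- The affine family `φ + t ψ`. -/
theorem smoothFam_line {φ ψ : M → W} (h : SmoothField T φ) (h' : SmoothField T ψ) (t : ℝ)
    (p : M) : SmoothFam T (fun t : ℝ => φ + t • ψ) t p :=
  (h.fam t p).add ((h'.fam t p).smul (a := fun t _ => t) contDiffAt_fst)

/-- Derivative of a smooth family in its parameter. -/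
theorem SmoothFam.hasDerivAt {Φ : ℝ → M → W} {t : ℝ} {p : M} (h : SmoothFam T Φ t p) :
    HasDerivAt (fun t => Φ t p) (deriv (fun t => Φ t p) t) t := by
  have := hasDerivAt_partial_left (z := (t, ch (Euc n) p p)) (ContDiffAt.differentiableAt h (by simp))
  simp only [fieldInChart_self] at this
  exact this.differentiableAt.hasDerivAt

theorem eventually_fieldInChart_deriv {Φ : ℝ → M → W} {t : ℝ} {p x₀ : M}
    (h : SmoothFam T Φ t p) (h0 : p ∈ (ch (Euc n) x₀).source) :
    ∀ᶠ z in 𝓝 (t, ch (Euc n) x₀ p), fieldInChart T x₀ (fun x => deriv (fun t => Φ t x) z.1) z.2 =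
      deriv (fun t => fieldInChart T x₀ (Φ t) z.2) z.1 := by
  have h1 : ∀ᶠ z in 𝓝 (t, ch (Euc n) x₀ p),
      DifferentiableAt ℝ (fun z : ℝ × Euc n => fieldInChart T x₀ (Φ z.1) z.2) z :=
    (((h.inChart h0).of_le (m := 1) (by simp)).eventually (by simp)).mono
      fun z hz => hz.differentiableAt (by simp)
  have h2 := (continuous_snd.tendsto (t, ch (Euc n) x₀ p)).eventually
    (ch_target_mem_nhds (Euc n) h0)
  filter_upwards [h1, h2] with z hz hz2
  have hz3 : z.2 ∈ (ch (Euc n) x₀).target := hz2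
  set x := (ch (Euc n) x₀).symm z.2 with hx
  have hxs : x ∈ (ch (Euc n) x₀).source := (ch (Euc n) x₀).map_target hz3
  have hzx : z.2 = ch (Euc n) x₀ x := ((ch (Euc n) x₀).right_inv hz3).symm
  have hd := (hasDerivAt_partial_left hz).differentiableAt
  have hd' : DifferentiableAt ℝ (fun t => Φ t x) z.1 := by
    have e : (fun t => Φ t x) = fun t => T.act (tc (Euc n) x₀ x x)
        (fieldInChart T x₀ (Φ t) z.2) := by
      funext t
      rw [← fieldInChart_self T x (Φ t), hzx]
      exact fieldInChart_change T (mem_ch_source _ x) hxs (Φ t)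
    rw [e]
    exact (T.act (tc (Euc n) x₀ x x)).differentiableAt.comp _ hd
  have := (T.act (tc (Euc n) x x₀ x)).hasFDerivAt.comp_hasDerivAt z.1 hd'.hasDerivAt
  have e2 : (⇑(T.act (tc (Euc n) x x₀ x)) ∘ fun t => Φ t x) =
      fun t => fieldInChart T x₀ (Φ t) z.2 := by
    funext t
    rw [hzx, fieldInChart_ch T hxs]
    rfl
  rw [e2] at this
  rw [this.deriv, fieldInChart]

theorem SmoothFam.deriv {Φ : ℝ → M → W} {t : ℝ} {p : M} (h : SmoothFam T Φ t p) :
    SmoothFam T (fun t x => deriv (fun t => Φ t x) t) t p :=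
  (ContDiffAt.partial_left h).congr_of_eventuallyEq
    (eventually_fieldInChart_deriv h (mem_ch_source _ p))

end FieldsInCharts

end CovPhase

namespace CovPhase

/-! ### Vector fields and differential forms as tensor fields -/

section TensorTypes

/-- The tensor type of vector fields. -/
noncomputable def vecType (n : ℕ) : TensorType n (Euc n) where
  act A := A
  act_one := rfl
  act_mul _ _ _ _ := rfl
  act_smooth := contDiff_id.contDiffOn
  values := univ
  isOpen_values := isOpen_univ
  act_values _ _ _ _ := mem_univ _

instance finiteDimensional_alternating (n k : ℕ) :
    FiniteDimensional ℝ (Euc n [⋀^Fin k]→L[ℝ] ℝ) := by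
  obtain ⟨L, hL⟩ := exists_leftInverse_evalBasis (E := Euc n) k
  exact FiniteDimensional.of_surjective L.toLinearMap fun α => ⟨_, hL α⟩

/-- Push-forward of forms along a linear map. -/
noncomputable def formAct (n k : ℕ) (A : Euc n →L[ℝ] Euc n) :
    (Euc n [⋀^Fin k]→L[ℝ] ℝ) →L[ℝ] (Euc n [⋀^Fin k]→L[ℝ] ℝ) :=
  LinearMap.toContinuousLinearMap
    { toFun := fun α => α.compContinuousLinearMap (Ring.inverse A)
      map_add' := fun _ _ => rfl
      map_smul' := fun _ _ => rfl }

theorem formAct_apply {n k : ℕ} (A : Euc n →L[ℝ] Euc n) (α : Euc n [⋀^Fin k]→L[ℝ] ℝ) :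
    formAct n k A α = α.compContinuousLinearMap (Ring.inverse A) := rfl

/-- The tensor type of differential forms. -/
noncomputable def formType (n k : ℕ) : TensorType n (Euc n [⋀^Fin k]→L[ℝ] ℝ) where
  act := formAct n k
  act_one := by
    ext α w
    simp [formAct_apply]
  act_mul A B hA hB := by
    obtain ⟨A, rfl⟩ := hA
    obtain ⟨B, rfl⟩ := hB
    ext α w
    rw [mul_apply_eq_comp, formAct_apply, formAct_apply, formAct_apply, ← Units.val_mul,
      Ring.inverse_unit, Ring.inverse_unit, Ring.inverse_unit, mul_inv_rev, Units.val_mul]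
    rfl
  act_smooth := by
    refine contDiffOn_clm_apply.2 fun α A hA => ContDiffAt.contDiffWithinAt ?_
    obtain ⟨A, rfl⟩ := hA
    exact contDiffAt_const.alternating_comp (contDiffAt_ringInverse ℝ A)
  values := univ
  isOpen_values := isOpen_univ
  act_values _ _ _ _ := mem_univ _

end TensorTypes

/-! ### The Lie derivative in charts -/

section LieField

variable {n : ℕ} {W : Type*} [NormedAddCommGroup W] [NormedSpace ℝ W] {T : TensorType n W}
  {M : Type*} [TopologicalSpace M] [ChartedSpace (Euc n) M] [IsManifold 𝓘(ℝ, Euc n) ∞ M]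
  {P : Type*} [NormedAddCommGroup P] [NormedSpace ℝ P]

theorem lieField_eq_flatLie (v : VField n M) (φ : M → W) (p : M) :
    lieField T v φ p = flatLie T (fieldInChart (vecType n) p v) (fieldInChart T p φ)
      (ch (Euc n) p p) := by
  rw [flatLie_apply, fieldInChart_self, fieldInChart_self]
  rfl

theorem fieldInChart_congr {x₀ p : M} (h0 : p ∈ (ch (Euc n) x₀).source) {φ φ' : M → W}
    (h : φ =ᶠ[𝓝 p] φ') :
    fieldInChart T x₀ φ =ᶠ[𝓝 (ch (Euc n) x₀ p)] fieldInChart T x₀ φ' := by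
  filter_upwards [eventually_ch_symm (Euc n) h0 h] with y hy
  rw [fieldInChart, fieldInChart, hy]

theorem lieField_congr {v v' : VField n M} {φ φ' : M → W} {p : M} (hv : v =ᶠ[𝓝 p] v')
    (hφ : φ =ᶠ[𝓝 p] φ') : lieField T v φ p = lieField T v' φ' p := by
  rw [lieField_eq_flatLie, lieField_eq_flatLie]
  exact flatLie_congr T (fieldInChart_congr (mem_ch_source _ p) hv)
    (fieldInChart_congr (mem_ch_source _ p) hφ)

theorem eventually_fieldInChart_change {x₀ x₁ p : M} (h0 : p ∈ (ch (Euc n) x₀).source)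
    (h1 : p ∈ (ch (Euc n) x₁).source) (φ : M → W) :
    (fun y => fieldInChart T x₁ φ ((ch (Euc n) x₁ ∘ (ch (Euc n) x₀).symm) y))
      =ᶠ[𝓝 (ch (Euc n) x₀ p)] fun y =>
      T.act (fderiv ℝ (ch (Euc n) x₁ ∘ (ch (Euc n) x₀).symm) y) (fieldInChart T x₀ φ y) := by
  refine eventually_inChart h0 ?_
  filter_upwards [ch_source_mem_nhds (Euc n) h1] with x hx1 hx0
  rw [Function.comp_apply, (ch (Euc n) x₀).left_inv hx0, ← tc_eq_fderiv]
  exact fieldInChart_change T hx1 hx0 φ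

theorem contDiffAt_one_inChart_change {x₀ x₁ p : M} (h0 : p ∈ (ch (Euc n) x₀).source)
    (h1 : p ∈ (ch (Euc n) x₁).source) {φ : M → W}
    (h : ContDiffAt ℝ 1 (fieldInChart T x₁ φ) (ch (Euc n) x₁ p)) :
    ContDiffAt ℝ 1 (fieldInChart T x₀ φ) (ch (Euc n) x₀ p) := by
  have h2 : ContDiffAt ℝ 1 (fun z : ℝ × Euc n => fieldInChart T x₁ ((fun _ => φ) z.1) z.2)
      ((0 : ℝ), ch (Euc n) x₁ p) :=
    ContDiffAt.comp (g := fieldInChart T x₁ φ) (f := fun z : ℝ × Euc n => z.2) _ h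
      contDiffAt_snd
  exact (contDiffAt_inChart_change (r := 1) (Φ := fun _ : ℝ => φ) T h0 h1 (by norm_cast) h2).comp (ch (Euc n) x₀ p)
    (contDiffAt_const.prodMk contDiffAt_id)

/-- The Lie derivative may be computed in any chart. -/
theorem fieldInChart_lieField {x₀ p : M} (h0 : p ∈ (ch (Euc n) x₀).source) {v : VField n M}
    {φ : M → W} (hv : ContDiffAt ℝ 1 (fieldInChart (vecType n) x₀ v) (ch (Euc n) x₀ p))
    (hφ : ContDiffAt ℝ 1 (fieldInChart T x₀ φ) (ch (Euc n) x₀ p)) :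
    fieldInChart T x₀ (lieField T v φ) (ch (Euc n) x₀ p) =
      flatLie T (fieldInChart (vecType n) x₀ v) (fieldInChart T x₀ φ) (ch (Euc n) x₀ p) := by
  have hp := mem_ch_source (Euc n) p
  have e : (ch (Euc n) x₀ ∘ (ch (Euc n) p).symm) (ch (Euc n) p p) = ch (Euc n) x₀ p := by
    rw [Function.comp_apply, (ch (Euc n) p).left_inv hp]
  have key := flatLie_naturality T (contDiffAt_transition (Euc n) hp h0) (tcUnit (Euc n) hp h0)
    (tc_eq_fderiv (Euc n) p x₀ p).symm ((contDiffAt_one_inChart_change hp h0 hv).differentiableAt (by simp))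
    ((contDiffAt_one_inChart_change hp h0 hφ).differentiableAt (by simp))
    (by rw [e]; exact hv.differentiableAt (by simp))
    (by rw [e]; exact hφ.differentiableAt (by simp))
    (eventually_fieldInChart_change (T := vecType n) hp h0 v)
    (eventually_fieldInChart_change hp h0 φ)
  rw [e] at key
  rw [key, fieldInChart_ch T h0, lieField_eq_flatLie]
  rfl

theorem eventually_fieldInChart_lieField {x₀ p : M} (h0 : p ∈ (ch (Euc n) x₀).source)
    {v : P → VField n M} {Φ : P → M → W} {q : P} (hv : SmoothFam (vecType n) v q p)
    (hΦ : SmoothFam T Φ q p) :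
    ∀ᶠ z in 𝓝 (q, ch (Euc n) x₀ p), fieldInChart T x₀ (lieField T (v z.1) (Φ z.1)) z.2 =
      flatLie T (fieldInChart (vecType n) x₀ (v z.1)) (fieldInChart T x₀ (Φ z.1)) z.2 := by
  have h1 := ((hv.inChart h0).of_le (m := 1) (by simp)).eventually (by simp)
  have h2 := ((hΦ.inChart h0).of_le (m := 1) (by simp)).eventually (by simp)
  have h3 := (continuous_snd.tendsto (q, ch (Euc n) x₀ p)).eventually
    (ch_target_mem_nhds (Euc n) h0)
  filter_upwards [h1, h2, h3] with z h1 h2 h3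
  have h3 : z.2 ∈ (ch (Euc n) x₀).target := h3
  have h4 := (ch (Euc n) x₀).right_inv h3
  have h5 := (ch (Euc n) x₀).map_target h3
  have h6 : ContDiffAt ℝ 1 (fun y : Euc n => (z.1, y)) z.2 := contDiffAt_const.prodMk contDiffAt_id
  have := fieldInChart_lieField (T := T) h5 (v := v z.1) (φ := Φ z.1)
    (by rw [h4]; exact h1.comp z.2 h6) (by rw [h4]; exact h2.comp z.2 h6)
  rwa [h4] at this

theorem SmoothFam.lieField {v : P → VField n M} {Φ : P → M → W} {q : P} {p : M}
    (hv : SmoothFam (vecType n) v q p) (hΦ : SmoothFam T Φ q p) :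
    SmoothFam T (fun q => lieField T (v q) (Φ q)) q p :=
  (contDiffAt_flatLie T hv hΦ).congr_of_eventuallyEq
    (eventually_fieldInChart_lieField (mem_ch_source _ p) hv hΦ)

theorem SmoothField.lieField {v : VField n M} {φ : M → W} (hv : SmoothField (vecType n) v)
    (hφ : SmoothField T φ) : SmoothField T (lieField T v φ) :=
  SmoothField.of_fam (q := (0 : ℝ)) fun p => (hv.fam 0 p).lieField (hφ.fam 0 p)

theorem SmoothFam.fieldInChart_deriv {Φ : ℝ → M → W} {t : ℝ} {p : M}
    (h : SmoothFam T Φ t p) :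
    fieldInChart T p (fun x => _root_.deriv (fun t => Φ t x) t) =ᶠ[𝓝 (ch (Euc n) p p)]
      fun y => _root_.deriv (fun t => fieldInChart T p (Φ t) y) t := by
  have h1 : Filter.Tendsto (fun y : Euc n => (t, y)) (𝓝 (ch (Euc n) p p))
    (𝓝 (t, ch (Euc n) p p)) := (Continuous.prodMk_right t).tendsto _
  exact h1.eventually (eventually_fieldInChart_deriv h (mem_ch_source _ p))

theorem hasDerivAt_lieField {v : ℝ → VField n M} {Φ : ℝ → M → W} {t : ℝ} {p : M}
    (hv : SmoothFam (vecType n) v t p) (hΦ : SmoothFam T Φ t p) :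
    HasDerivAt (fun t => lieField T (v t) (Φ t) p)
      (lieField T (fun x => deriv (fun t => v t x) t) (Φ t) p +
        lieField T (v t) (fun x => deriv (fun t => Φ t x) t) p) t := by
  have h := hasDerivAt_flatLie T (z := (t, ch (Euc n) p p)) hv hΦ
  simp only [lieField_eq_flatLie]
  rw [flatLie_congr T hv.fieldInChart_deriv Filter.EventuallyEq.rfl,
    flatLie_congr T Filter.EventuallyEq.rfl hΦ.fieldInChart_deriv]
  exact h

theorem lieField_add_left {v v' : VField n M} {φ : M → W} (hv : SmoothField (vecType n) v)
    (hv' : SmoothField (vecType n) v') :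
    lieField T (v + v') φ = lieField T v φ + lieField T v' φ := by
  funext p
  simp only [Pi.add_apply, lieField_eq_flatLie, fieldInChart_add, flatLie_apply]
  rw [fderiv_add ((hv p).differentiableAt (by simp)) ((hv' p).differentiableAt (by simp))]
  simp only [map_add, add_apply]
  abel

/-! ### The bracket of vector fields -/

/-- Identifies the pull-back of vector fields along an inverse chart, from which `mlieBracket` is
built, with reading them in that chart. -/
theorem mfderiv_ch_symm {x₀ p : M} (h0 : p ∈ (ch (Euc n) x₀).source) :
    (mfderiv 𝓘(ℝ, Euc n) 𝓘(ℝ, Euc n) (ch (Euc n) x₀).symm (ch (Euc n) x₀ p) :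
      Euc n →L[ℝ] Euc n) = tc (Euc n) x₀ p p := by
  have ht := (ch (Euc n) x₀).map_source h0
  have hd : MDifferentiableAt 𝓘(ℝ, Euc n) 𝓘(ℝ, Euc n) (ch (Euc n) x₀).symm
      (ch (Euc n) x₀ p) :=
    ((contMDiffOn_extChartAt_symm (n := ∞) x₀).contMDiffAt
      (ch_target_mem_nhds (Euc n) h0)).mdifferentiableAt (by simp)
  have h := fderiv_writtenInCharts (E := Euc n) (E' := Euc n) (f := (ch (Euc n) x₀).symm)
    (y₀ := ch (Euc n) x₀ p) (y := ch (Euc n) x₀ p) (x₀ := x₀) (mem_ch_source _ _)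
    (by rw [(ch (Euc n) x₀).left_inv h0]; exact h0) hd
  rw [(ch (Euc n) x₀).left_inv h0, tc_self _ (mem_ch_source _ _)] at h
  have hid : ch (Euc n) (ch (Euc n) x₀ p) = PartialEquiv.refl (Euc n) := extChartAt_model_space_eq_id ℝ _
  rw [hid] at h
  have e : (ch (Euc n) x₀ ∘ (ch (Euc n) x₀).symm ∘ (PartialEquiv.refl (Euc n)).symm)
      =ᶠ[𝓝 (ch (Euc n) x₀ p)] id := by
    filter_upwards [ch_target_mem_nhds (Euc n) h0] with y hy
    exact (ch (Euc n) x₀).right_inv hy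
  have e1 : (PartialEquiv.refl (Euc n)) (ch (Euc n) x₀ p) = ch (Euc n) x₀ p := rfl
  rw [e1, e.fderiv_eq, fderiv_id] at h
  ext1 w
  have h2 := congrArg (fun B : Euc n →L[ℝ] Euc n => tc (Euc n) x₀ p p (B w)) h
  have h3 := DFunLike.congr_fun (tc_mul_tc (Euc n) (mem_ch_source _ p) h0 (mem_ch_source _ p))
    ((mfderiv 𝓘(ℝ, Euc n) 𝓘(ℝ, Euc n) (ch (Euc n) x₀).symm (ch (Euc n) x₀ p) :
      Euc n →L[ℝ] Euc n) w)
  rw [tc_self _ (mem_ch_source _ p)] at h3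
  exact h3.symm.trans h2.symm

theorem inverse_eq_of_mul {A B : Euc n →L[ℝ] Euc n} (h : A * B = 1) (h' : B * A = 1) :
    ContinuousLinearMap.inverse A = B := ContinuousLinearMap.inverse_eq h h'

theorem flatLie_vecType (U V : Euc n → Euc n) :
    flatLie (vecType n) U V = VectorField.lieBracket ℝ U V := by
  funext y
  have : rho (vecType n) = ContinuousLinearMap.id ℝ _ := by
    rw [rho]; exact fderiv_id
  rw [flatLie_apply, this]
  rfl

/-- The bracket of vector fields is the Lie derivative of vector fields. -/
theorem vfBracket_eq_lieField (u v : VField n M) :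
    vfBracket u v = lieField (vecType n) u v := by
  funext p
  have hp := mem_ch_source (Euc n) p
  have hpull : ∀ w : VField n M, VectorField.mpullbackWithin 𝓘(ℝ, Euc n) 𝓘(ℝ, Euc n)
      (ch (Euc n) p).symm w (range 𝓘(ℝ, Euc n)) =ᶠ[𝓝 (ch (Euc n) p p)]
      fieldInChart (vecType n) p w := by
    intro w
    refine eventually_inChart hp (Filter.Eventually.of_forall fun x hx => ?_)
    change ContinuousLinearMap.inverse (mfderivWithin 𝓘(ℝ, Euc n) 𝓘(ℝ, Euc n) (ch (Euc n) p).symm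
      (range 𝓘(ℝ, Euc n)) (ch (Euc n) p x) : Euc n →L[ℝ] Euc n)
      (w ((ch (Euc n) p).symm (ch (Euc n) p x))) = _
    rw [ModelWithCorners.range_eq_univ, mfderivWithin_univ,
      fieldInChart_ch _ hx, (ch (Euc n) p).left_inv hx]
    exact (DFunLike.congr_fun (congrArg ContinuousLinearMap.inverse (mfderiv_ch_symm hx))
      (w x)).trans (DFunLike.congr_fun (inverse_eq_of_mul
        ((tc_mul_tc (Euc n) (mem_ch_source _ x) hx (mem_ch_source _ x)).trans
          (tc_self _ (mem_ch_source _ x)))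
        ((tc_mul_tc (Euc n) hx (mem_ch_source _ x) hx).trans (tc_self _ hx))) (w x))
  -- The chart centred at `p` has derivative the identity at `p`, so carrying the bracket back to
  -- `M` changes nothing.
  have hA : (1 : Euc n →L[ℝ] Euc n) = mfderiv 𝓘(ℝ, Euc n) 𝓘(ℝ, Euc n) (ch (Euc n) p) p :=
    (mfderiv_extChartAt_self (I := 𝓘(ℝ, Euc n)) (x := p)).symm
  refine (DFunLike.congr_fun (congrArg ContinuousLinearMap.inverse hA.symm)
    (VectorField.lieBracketWithin ℝ
      (VectorField.mpullbackWithin 𝓘(ℝ, Euc n) 𝓘(ℝ, Euc n) (ch (Euc n) p).symm u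
        (range 𝓘(ℝ, Euc n)) : Euc n → Euc n)
      (VectorField.mpullbackWithin 𝓘(ℝ, Euc n) 𝓘(ℝ, Euc n) (ch (Euc n) p).symm v
        (range 𝓘(ℝ, Euc n)) : Euc n → Euc n)
      ((ch (Euc n) p).symm ⁻¹' univ ∩ range 𝓘(ℝ, Euc n)) (ch (Euc n) p p))).trans
    ((DFunLike.congr_fun (inverse_eq_of_mul (one_mul 1) (one_mul 1)) _).trans ?_)
  rw [lieField_eq_flatLie, flatLie_vecType]
  rw [← Filter.EventuallyEq.lieBracket_vectorField_eq (hpull u) (hpull v), ModelWithCorners.range_eq_univ,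
    preimage_univ, inter_univ]
  exact congrFun (VectorField.lieBracketWithin_univ (𝕜 := ℝ)) _

end LieField

end CovPhase

namespace CovPhase

/-! ### Differential forms in charts -/

section FlatForms

variable {n k : ℕ} {P : Type*} [NormedAddCommGroup P] [NormedSpace ℝ P]

theorem contDiffAt_extDeriv {g : P × Euc n → Euc n [⋀^Fin k]→L[ℝ] ℝ} {z : P × Euc n}
    (hg : ContDiffAt ℝ ∞ g z) :
    ContDiffAt ℝ ∞ (fun z => extDeriv (fun y => g (z.1, y)) z.2) z := by
  refine contDiffAt_alternating fun w => ?_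
  simp only [extDeriv_apply']
  exact ContDiffAt.sum fun i _ => contDiffAt_const.mul
    ((hg.fderiv_partial.clm_apply contDiffAt_const).alternating_apply fun _ => contDiffAt_const)

theorem _root_.HasDerivAt.alternating_apply {E : Type*} [NormedAddCommGroup E] [NormedSpace ℝ E]
    {g : ℝ → E [⋀^Fin k]→L[ℝ] ℝ} {D : E [⋀^Fin k]→L[ℝ] ℝ} {t : ℝ} (h : HasDerivAt g D t)
    (w : Fin k → E) : HasDerivAt (fun t => g t w) (D w) t := by
  let L : (E [⋀^Fin k]→L[ℝ] ℝ) →L[ℝ] ℝ :=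
    LinearMap.mkContinuous ⟨⟨fun α => α w, fun _ _ => rfl⟩, fun _ _ => rfl⟩ (∏ i, ‖w i‖)
      (fun α => by rw [mul_comm]; exact α.le_opNorm _)
  exact L.hasFDerivAt.comp_hasDerivAt t h

theorem hasDerivAt_alternating {E : Type*} [NormedAddCommGroup E] [NormedSpace ℝ E]
    [FiniteDimensional ℝ E] {g : ℝ → E [⋀^Fin k]→L[ℝ] ℝ} {D : E [⋀^Fin k]→L[ℝ] ℝ} {t : ℝ}
    (h : ∀ w : Fin k → E, HasDerivAt (fun t => g t w) (D w) t) : HasDerivAt g D t := by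
  obtain ⟨L, hL⟩ := exists_leftInverse_evalBasis (E := E) k
  have h1 := L.hasFDerivAt.comp_hasDerivAt t
    (hasDerivAt_pi.2 fun s => h (fun i => Module.finBasis ℝ E (s i)))
  rw [hL] at h1
  exact h1.congr_of_eventuallyEq (Filter.Eventually.of_forall fun t => (hL (g t)).symm)

theorem hasDerivAt_extDeriv {g : ℝ × Euc n → Euc n [⋀^Fin k]→L[ℝ] ℝ} {z : ℝ × Euc n}
    (hg : ContDiffAt ℝ ∞ g z) :
    HasDerivAt (fun t => extDeriv (fun y => g (t, y)) z.2)
      (extDeriv (fun y => deriv (fun t => g (t, y)) z.1) z.2) z.1 := by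
  refine hasDerivAt_alternating fun w => ?_
  simp only [extDeriv_apply']
  refine HasDerivAt.fun_sum fun i _ => HasDerivAt.const_mul _ ?_
  have h1 := (hasDerivAt_fderiv_swap hg).clm_apply (hasDerivAt_const z.1 (w i))
  simp only [map_zero, add_zero] at h1
  exact h1.alternating_apply _

end FlatForms

section Forms

variable {l k : ℕ} {X : Type*} [TopologicalSpace X] [ChartedSpace (Euc l) X]
  [IsManifold 𝓘(ℝ, Euc l) ∞ X] {P : Type*} [NormedAddCommGroup P] [NormedSpace ℝ P]

/-- One expression uses the inverse of a coordinate change, the other the opposite coordinate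
change. The two maps are known to agree only on the chart domain, which is why later comparisons are
eventual ones. -/
theorem fieldInChart_formType {x₀ p : X} (h0 : p ∈ (ch (Euc l) x₀).source) (α : DForm l k X) :
    fieldInChart (formType l k) x₀ α (ch (Euc l) x₀ p) = formInChart x₀ α (ch (Euc l) x₀ p) := by
  have hp := mem_ch_source (Euc l) p
  rw [fieldInChart_ch _ h0, formInChart, (ch (Euc l) x₀).left_inv h0]
  change (α p).compContinuousLinearMap (Ring.inverse (tcUnit (Euc l) hp h0 : Euc l →L[ℝ] Euc l)) = _
  rw [Ring.inverse_unit]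
  rfl

theorem fieldInChart_formType_ch {x₀ p : X} (h0 : p ∈ (ch (Euc l) x₀).source) (α : DForm l k X) :
    fieldInChart (formType l k) x₀ α (ch (Euc l) x₀ p) =
      (α p).compContinuousLinearMap (tc (Euc l) x₀ p p) := by
  rw [fieldInChart_formType h0, formInChart, (ch (Euc l) x₀).left_inv h0]

theorem formInChart_eventuallyEq {x₀ p : X} (h0 : p ∈ (ch (Euc l) x₀).source) :
    ∀ᶠ y in 𝓝 (ch (Euc l) x₀ p), ∀ α : DForm l k X,
      formInChart x₀ α y = fieldInChart (formType l k) x₀ α y :=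
  eventually_inChart h0 (Filter.Eventually.of_forall fun _ hx α =>
    (fieldInChart_formType hx α).symm)

theorem smoothFormFamilyAt_iff {p : ℕ} {α : (Fin p → ℝ) → DForm l k X} {t : Fin p → ℝ} {x : X} :
    SmoothFormFamilyAt α t x ↔ SmoothFam (formType l k) α t x := by
  have h := (continuous_snd.tendsto (t, ch (Euc l) x x)).eventually
    (formInChart_eventuallyEq (k := k) (mem_ch_source (Euc l) x))
  have h' : (fun q : (Fin p → ℝ) × Euc l => formInChart x (α q.1) q.2)
      =ᶠ[𝓝 (t, ch (Euc l) x x)]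
      fun q => fieldInChart (formType l k) x (α q.1) q.2 := by
    filter_upwards [h] with z hz using hz _
  exact ⟨fun h => ContDiffAt.congr_of_eventuallyEq h h'.symm,
    fun h => ContDiffAt.congr_of_eventuallyEq h h'⟩

theorem eventually_fieldInChart_form_change {x₀ x₁ p : X} (h0 : p ∈ (ch (Euc l) x₀).source)
    (h1 : p ∈ (ch (Euc l) x₁).source) (α : DForm l k X) :
    fieldInChart (formType l k) x₀ α =ᶠ[𝓝 (ch (Euc l) x₀ p)] fun y =>
      (fieldInChart (formType l k) x₁ α
        ((ch (Euc l) x₁ ∘ (ch (Euc l) x₀).symm) y)).compContinuousLinearMap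
        (fderiv ℝ (ch (Euc l) x₁ ∘ (ch (Euc l) x₀).symm) y) := by
  refine eventually_inChart h0 ?_
  filter_upwards [ch_source_mem_nhds (Euc l) h1] with x hx1 hx0
  rw [Function.comp_apply, (ch (Euc l) x₀).left_inv hx0, ← tc_eq_fderiv,
    fieldInChart_formType_ch hx0, fieldInChart_formType_ch hx1,
    ← tc_mul_tc (Euc l) hx0 hx1 (mem_ch_source _ x)]
  rfl

/-- The exterior derivative may be computed in any chart. -/
theorem fieldInChart_dForm {x₀ p : X} (h0 : p ∈ (ch (Euc l) x₀).source) {α : DForm l k X}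
    (hα : ContDiffAt ℝ 1 (fieldInChart (formType l k) x₀ α) (ch (Euc l) x₀ p)) :
    fieldInChart (formType l (k + 1)) x₀ (dForm α) (ch (Euc l) x₀ p) =
      extDeriv (fieldInChart (formType l k) x₀ α) (ch (Euc l) x₀ p) := by
  have hp := mem_ch_source (Euc l) p
  have e : (ch (Euc l) p ∘ (ch (Euc l) x₀).symm) (ch (Euc l) x₀ p) = ch (Euc l) p p := by
    rw [Function.comp_apply, (ch (Euc l) x₀).left_inv h0]
  have hα' := (contDiffAt_one_inChart_change hp h0 hα).differentiableAt (by simp)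
  rw [← e] at hα'
  rw [(eventually_fieldInChart_form_change h0 hp α).extDeriv_eq,
    extDeriv_pullback hα' (contDiffAt_transition (Euc l) h0 hp) (by simpa using two_le_smooth),
    e, ← tc_eq_fderiv, fieldInChart_formType_ch h0, dForm]
  congr 1
  refine Filter.EventuallyEq.extDeriv_eq ?_
  filter_upwards [formInChart_eventuallyEq (k := k) hp] with y hy using hy α

theorem dForm_eq_extDeriv (α : DForm l k X) (p : X) :
    dForm α p = extDeriv (fieldInChart (formType l k) p α) (ch (Euc l) p p) := by
  refine Filter.EventuallyEq.extDeriv_eq ?_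
  filter_upwards [formInChart_eventuallyEq (k := k) (mem_ch_source (Euc l) p)] with y hy using hy α

theorem dForm_congr {α β : DForm l k X} {p : X} (h : α =ᶠ[𝓝 p] β) : dForm α p = dForm β p := by
  rw [dForm_eq_extDeriv, dForm_eq_extDeriv]
  exact (fieldInChart_congr (mem_ch_source _ p) h).extDeriv_eq

theorem eventually_fieldInChart_dForm {x₀ p : X} (h0 : p ∈ (ch (Euc l) x₀).source)
    {α : P → DForm l k X} {q : P} (hα : SmoothFam (formType l k) α q p) :
    ∀ᶠ z in 𝓝 (q, ch (Euc l) x₀ p), fieldInChart (formType l (k + 1)) x₀ (dForm (α z.1)) z.2 =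
      extDeriv (fieldInChart (formType l k) x₀ (α z.1)) z.2 := by
  have h1 := ((hα.inChart h0).of_le (m := 1) (by simp)).eventually (by simp)
  have h3 := (continuous_snd.tendsto (q, ch (Euc l) x₀ p)).eventually
    (ch_target_mem_nhds (Euc l) h0)
  filter_upwards [h1, h3] with z h1 h3
  have h3 : z.2 ∈ (ch (Euc l) x₀).target := h3
  have h4 := (ch (Euc l) x₀).right_inv h3
  have h5 := (ch (Euc l) x₀).map_target h3
  have h6 : ContDiffAt ℝ 1 (fun y : Euc l => (z.1, y)) z.2 := contDiffAt_const.prodMk contDiffAt_id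
  have := fieldInChart_dForm h5 (α := α z.1) (by rw [h4]; exact h1.comp z.2 h6)
  rwa [h4] at this

theorem SmoothFam.dForm {α : P → DForm l k X} {q : P} {p : X}
    (hα : SmoothFam (formType l k) α q p) :
    SmoothFam (formType l (k + 1)) (fun q => dForm (α q)) q p :=
  (contDiffAt_extDeriv hα).congr_of_eventuallyEq
    (eventually_fieldInChart_dForm (mem_ch_source _ p) hα)

theorem SmoothField.dForm {α : DForm l k X} (hα : SmoothField (formType l k) α) :
    SmoothField (formType l (k + 1)) (dForm α) :=
  SmoothField.of_fam (q := (0 : ℝ)) fun p => (hα.fam 0 p).dForm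

theorem hasDerivAt_dForm {α : ℝ → DForm l k X} {t : ℝ} {p : X}
    (hα : SmoothFam (formType l k) α t p) :
    HasDerivAt (fun t => CovPhase.dForm (α t) p)
      (CovPhase.dForm (fun x => deriv (fun t => α t x) t) p) t := by
  simp only [dForm_eq_extDeriv]
  rw [hα.fieldInChart_deriv.extDeriv_eq]
  exact hasDerivAt_extDeriv (z := (t, ch (Euc l) p p)) hα

theorem dForm_add {α β : DForm l k X} (hα : SmoothField (formType l k) α)
    (hβ : SmoothField (formType l k) β) : dForm (α + β) = dForm α + dForm β := by
  funext p
  simp only [Pi.add_apply, dForm_eq_extDeriv, fieldInChart_add]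
  exact extDeriv_add ((hα p).differentiableAt (by simp)) ((hβ p).differentiableAt (by simp))

theorem dForm_smul (a : ℝ) (α : DForm l k X) : dForm (a • α) = a • dForm α := by
  funext p
  simp only [Pi.smul_apply, dForm_eq_extDeriv, fieldInChart_smul]
  exact extDeriv_smul a _

theorem dForm_neg (α : DForm l k X) : dForm (-α) = -dForm α := by
  have h : ∀ {j : ℕ} (β : DForm l j X), -β = (-1 : ℝ) • β := fun β => by
    funext x; ext w; simp
  rw [h, h, dForm_smul]

theorem SmoothField.neg {n : ℕ} {W : Type*} [NormedAddCommGroup W] [NormedSpace ℝ W]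
    {T : TensorType n W} {M : Type*} [TopologicalSpace M] [ChartedSpace (Euc n) M]
    [IsManifold 𝓘(ℝ, Euc n) ∞ M] {φ : M → W} (h : SmoothField T φ) : SmoothField T (-φ) := by
  simpa using smoothField_zero.sub h

theorem dForm_sub {α β : DForm l k X} (hα : SmoothField (formType l k) α)
    (hβ : SmoothField (formType l k) β) : dForm (α - β) = dForm α - dForm β := by
  rw [sub_eq_add_neg, sub_eq_add_neg, ← dForm_neg, dForm_add hα hβ.neg]

theorem dForm_dForm {α : DForm l k X} (hα : SmoothField (formType l k) α) :
    dForm (dForm α) = 0 := by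
  funext p
  have h1 : fieldInChart (formType l (k + 1)) p (dForm α) =ᶠ[𝓝 (ch (Euc l) p p)]
      extDeriv (fieldInChart (formType l k) p α) := by
    have h := eventually_fieldInChart_dForm (mem_ch_source (Euc l) p) (hα.fam (0 : ℝ) p)
    exact ((Continuous.prodMk_right (0 : ℝ)).tendsto (ch (Euc l) p p)).eventually h
  rw [dForm_eq_extDeriv, h1.extDeriv_eq]
  exact extDeriv_extDeriv_apply (hα p) (by simpa using two_le_smooth)

/-! ### Contraction -/

theorem fieldInChart_contract {x₀ p : X} (h0 : p ∈ (ch (Euc l) x₀).source) (v : VField l X)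
    (α : DForm l (k + 1) X) :
    fieldInChart (formType l k) x₀ (contract v α) (ch (Euc l) x₀ p) =
      flatContract (fieldInChart (vecType l) x₀ v) (fieldInChart (formType l (k + 1)) x₀ α)
        (ch (Euc l) x₀ p) := by
  have hp := mem_ch_source (Euc l) p
  rw [flatContract, fieldInChart_formType_ch h0, fieldInChart_formType_ch h0, fieldInChart_ch _ h0]
  ext w
  have e : tc (Euc l) x₀ p p (tc (Euc l) p x₀ p (v p)) = v p := by
    rw [← mul_apply_eq_comp, tc_mul_tc (Euc l) hp h0 hp, tc_self _ hp]; rfl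
  change α p (Matrix.vecCons (v p) _) = α p _
  congr 1
  funext i
  refine Fin.cases ?_ (fun i => ?_) i
  · exact e.symm
  · rfl

theorem eventually_fieldInChart_contract {x₀ p : X} (h0 : p ∈ (ch (Euc l) x₀).source) :
    ∀ᶠ y in 𝓝 (ch (Euc l) x₀ p), ∀ (v : VField l X) (α : DForm l (k + 1) X),
      fieldInChart (formType l k) x₀ (contract v α) y =
      flatContract (fieldInChart (vecType l) x₀ v) (fieldInChart (formType l (k + 1)) x₀ α) y :=
  eventually_inChart h0 (Filter.Eventually.of_forall fun _ hx v α => fieldInChart_contract hx v α)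

theorem SmoothFam.contract {v : P → VField l X} {α : P → DForm l (k + 1) X} {q : P} {p : X}
    (hv : SmoothFam (vecType l) v q p) (hα : SmoothFam (formType l (k + 1)) α q p) :
    SmoothFam (formType l k) (fun q => contract (v q) (α q)) q p := by
  refine (ContDiffAt.curryLeft hα hv).congr_of_eventuallyEq ?_
  filter_upwards [(continuous_snd.tendsto (q, ch (Euc l) p p)).eventually
    (eventually_fieldInChart_contract (k := k) (mem_ch_source (Euc l) p))] with z hz using hz _ _

theorem SmoothField.contract {v : VField l X} {α : DForm l (k + 1) X}
    (hv : SmoothField (vecType l) v) (hα : SmoothField (formType l (k + 1)) α) :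
    SmoothField (formType l k) (contract v α) :=
  SmoothField.of_fam (q := (0 : ℝ)) fun p => (hv.fam 0 p).contract (hα.fam 0 p)

theorem contract_add (v : VField l X) (α β : DForm l (k + 1) X) :
    contract v (α + β) = contract v α + contract v β := rfl

theorem contract_sub (v : VField l X) (α β : DForm l (k + 1) X) :
    contract v (α - β) = contract v α - contract v β := rfl

theorem contract_add_left (v w : VField l X) (α : DForm l (k + 1) X) :
    contract (v + w) α = contract v α + contract w α := by
  funext p; simp [contract]

/-- Cartan calculus: contraction with the bracket of two vector fields. -/
theorem contract_vfBracket {u v : VField l X} {α : DForm l (k + 2) X}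
    (hu : SmoothField (vecType l) u) (hv : SmoothField (vecType l) v)
    (hα : SmoothField (formType l (k + 2)) α) :
    contract (vfBracket u v) α =
      dForm (contract u (contract v α)) + contract u (dForm (contract v α))
        - contract v (dForm (contract u α)) - contract v (contract u (dForm α)) := by
  funext p
  have hp := mem_ch_source (Euc l) p
  have ec : ∀ {j : ℕ} (w : VField l X) (β : DForm l (j + 1) X),
      fieldInChart (formType l j) p (contract w β) =ᶠ[𝓝 (ch (Euc l) p p)]
      flatContract (fieldInChart (vecType l) p w) (fieldInChart (formType l (j + 1)) p β) :=
    fun {j} w β => (eventually_fieldInChart_contract (k := j) hp).mono fun y hy => hy w β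
  have e0 : ∀ {j : ℕ} (w : VField l X) (β : DForm l (j + 1) X),
      contract w β p = (β p).curryLeft (w p) := fun _ _ => rfl
  have e1 : fieldInChart (formType l k) p (contract u (contract v α)) =ᶠ[𝓝 (ch (Euc l) p p)]
      flatContract (fieldInChart (vecType l) p u) (flatContract (fieldInChart (vecType l) p v)
        (fieldInChart (formType l (k + 2)) p α)) := by
    filter_upwards [ec u (contract v α), ec v α] with y h1 h2
    rw [h1, flatContract, h2]
    rfl
  have key := flatContract_bracket (hu p) (hv p) (hα p)
  simp only [Pi.sub_apply, Pi.add_apply, e0, dForm_eq_extDeriv, e1.extDeriv_eq,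
    (ec u α).extDeriv_eq, (ec v α).extDeriv_eq, vfBracket_eq_lieField, lieField_eq_flatLie,
    flatLie_vecType]
  simp only [flatContract, fieldInChart_self] at key ⊢
  exact key

end Forms

/-! ### The commutator of Lie derivatives -/

section Commutator

variable {n : ℕ} {W : Type*} [NormedAddCommGroup W] [NormedSpace ℝ W] {T : TensorType n W}
  {M : Type*} [TopologicalSpace M] [ChartedSpace (Euc n) M] [IsManifold 𝓘(ℝ, Euc n) ∞ M]

theorem lieField_commutator {u v : VField n M} {φ : M → W} (hu : SmoothField (vecType n) u)
    (hv : SmoothField (vecType n) v) (hφ : SmoothField T φ) :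
    lieField T u (lieField T v φ) - lieField T v (lieField T u φ) =
      lieField T (vfBracket u v) φ := by
  funext p
  have hp := mem_ch_source (Euc n) p
  have ec : ∀ {w : VField n M}, SmoothField (vecType n) w →
      fieldInChart T p (lieField T w φ) =ᶠ[𝓝 (ch (Euc n) p p)]
        flatLie T (fieldInChart (vecType n) p w) (fieldInChart T p φ) := fun {w} hw =>
    ((Continuous.prodMk_right (0 : ℝ)).tendsto (ch (Euc n) p p)).eventually
      (eventually_fieldInChart_lieField hp (hw.fam (0 : ℝ) p) (hφ.fam 0 p))
  have eb : fieldInChart (vecType n) p (vfBracket u v) =ᶠ[𝓝 (ch (Euc n) p p)]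
      VectorField.lieBracket ℝ (fieldInChart (vecType n) p u) (fieldInChart (vecType n) p v) := by
    rw [vfBracket_eq_lieField, ← flatLie_vecType]
    exact ((Continuous.prodMk_right (0 : ℝ)).tendsto (ch (Euc n) p p)).eventually
      (eventually_fieldInChart_lieField hp (hu.fam (0 : ℝ) p) (hv.fam 0 p))
  rw [Pi.sub_apply, lieField_eq_flatLie, lieField_eq_flatLie, lieField_eq_flatLie,
    flatLie_congr T Filter.EventuallyEq.rfl (ec hv), flatLie_congr T Filter.EventuallyEq.rfl (ec hu),
    flatLie_congr T eb Filter.EventuallyEq.rfl]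
  exact flatLie_commutator T (hu p) (hv p) (hφ p)

theorem SmoothField.vfBracket {u v : VField n M} (hu : SmoothField (vecType n) u)
    (hv : SmoothField (vecType n) v) : SmoothField (vecType n) (vfBracket u v) := by
  rw [vfBracket_eq_lieField]
  exact hu.lieField hv

end Commutator

end CovPhase

namespace CovPhase

/-! ### Pull-back of forms -/

section Pull

variable {m n k : ℕ} {X : Type*} [TopologicalSpace X] [ChartedSpace (Euc n) X]
  [IsManifold 𝓘(ℝ, Euc n) ∞ X] {Y : Type*} [TopologicalSpace Y] [ChartedSpace (Euc m) Y]
  [IsManifold 𝓘(ℝ, Euc m) ∞ Y] {P : Type*} [NormedAddCommGroup P] [NormedSpace ℝ P]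

/-- The differential of a map between manifolds. -/
noncomputable abbrev md (m n : ℕ) {X : Type*} [TopologicalSpace X]
    [ChartedSpace (Euc n) X] {Y : Type*} [TopologicalSpace Y] [ChartedSpace (Euc m) Y] (f : Y → X) (y : Y) : Euc m →L[ℝ] Euc n :=
  mfderiv 𝓘(ℝ, Euc m) 𝓘(ℝ, Euc n) f y

/-- A map between manifolds read in charts. -/
noncomputable abbrev inCharts (m n : ℕ) {X : Type*} [TopologicalSpace X]
    [ChartedSpace (Euc n) X] {Y : Type*} [TopologicalSpace Y] [ChartedSpace (Euc m) Y] (f : Y → X) (y₀ : Y) (x₀ : X) : Euc m → Euc n :=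
  ch (Euc n) x₀ ∘ f ∘ (ch (Euc m) y₀).symm

variable {f : Y → X}

theorem contDiffAt_inCharts (hf : ContMDiff 𝓘(ℝ, Euc m) 𝓘(ℝ, Euc n) ∞ f) (y : Y) :
    ContDiffAt ℝ ∞ (inCharts m n f y (f y)) (ch (Euc m) y y) := by
  have h := (contMDiffAt_iff.1 (hf y)).2
  rwa [ModelWithCorners.range_eq_univ, contDiffWithinAt_univ] at h

theorem inCharts_apply {y₀ y : Y} (hy : y ∈ (ch (Euc m) y₀).source) (x₀ : X) :
    inCharts m n f y₀ x₀ (ch (Euc m) y₀ y) = ch (Euc n) x₀ (f y) := by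
  simp only [inCharts, Function.comp_apply]
  rw [(ch (Euc m) y₀).left_inv hy]

theorem fderiv_inCharts (hf : ContMDiff 𝓘(ℝ, Euc m) 𝓘(ℝ, Euc n) ∞ f) {y₀ y : Y} {x₀ : X}
    (hy : y ∈ (ch (Euc m) y₀).source) (hx : f y ∈ (ch (Euc n) x₀).source) :
    fderiv ℝ (inCharts m n f y₀ x₀) (ch (Euc m) y₀ y) =
      (tc (Euc n) (f y) x₀ (f y)).comp ((md m n f y).comp (tc (Euc m) y₀ y y)) :=
  fderiv_writtenInCharts (Euc n) hy hx ((hf y).mdifferentiableAt (by simp))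

theorem fieldInChart_pullForm (hf : ContMDiff 𝓘(ℝ, Euc m) 𝓘(ℝ, Euc n) ∞ f) {y₀ y : Y} {x₀ : X}
    (hy : y ∈ (ch (Euc m) y₀).source) (hx : f y ∈ (ch (Euc n) x₀).source) (α : DForm n k X) :
    fieldInChart (formType m k) y₀ (pullForm f α) (ch (Euc m) y₀ y) =
      (fieldInChart (formType n k) x₀ α
        (inCharts m n f y₀ x₀ (ch (Euc m) y₀ y))).compContinuousLinearMap
        (fderiv ℝ (inCharts m n f y₀ x₀) (ch (Euc m) y₀ y)) := by
  rw [inCharts_apply hy, fieldInChart_formType_ch hy, fieldInChart_formType_ch hx,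
    fderiv_inCharts hf hy hx]
  ext w
  change α (f y) (fun i => md m n f y (tc (Euc m) y₀ y y (w i))) =
    α (f y) (fun i => (tc (Euc n) x₀ (f y) (f y) * tc (Euc n) (f y) x₀ (f y))
      (md m n f y (tc (Euc m) y₀ y y (w i))))
  rw [tc_mul_tc (Euc n) (mem_ch_source _ (f y)) hx (mem_ch_source _ (f y)),
    tc_self _ (mem_ch_source _ (f y))]
  rfl

theorem eventually_fieldInChart_pullForm (hf : ContMDiff 𝓘(ℝ, Euc m) 𝓘(ℝ, Euc n) ∞ f) (y : Y) :
    ∀ᶠ z in 𝓝 (ch (Euc m) y y), ∀ α : DForm n k X,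
      fieldInChart (formType m k) y (pullForm f α) z =
      (fieldInChart (formType n k) (f y) α (inCharts m n f y (f y) z)).compContinuousLinearMap
        (fderiv ℝ (inCharts m n f y (f y)) z) := by
  refine eventually_inChart (mem_ch_source _ y) ?_
  filter_upwards [hf.continuous.continuousAt.eventually
    (ch_source_mem_nhds (Euc n) (mem_ch_source _ (f y)))] with y' hx hy α
  exact fieldInChart_pullForm hf hy hx α

theorem SmoothFam.pullForm (hf : ContMDiff 𝓘(ℝ, Euc m) 𝓘(ℝ, Euc n) ∞ f) {α : P → DForm n k X}
    {q : P} {y : Y} (hα : SmoothFam (formType n k) α q (f y)) :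
    SmoothFam (formType m k) (fun q => pullForm f (α q)) q y := by
  have hc := contDiffAt_inCharts hf y
  have e : inCharts m n f y (f y) (ch (Euc m) y y) = ch (Euc n) (f y) (f y) :=
    inCharts_apply (mem_ch_source _ y) _
  have h1 : ContDiffAt ℝ ∞ (fun z : P × Euc m => (z.1, inCharts m n f y (f y) z.2))
      (q, ch (Euc m) y y) :=
    contDiffAt_fst.prodMk (ContDiffAt.comp (g := inCharts m n f y (f y))
      (f := fun z : P × Euc m => z.2) (q, ch (Euc m) y y) hc contDiffAt_snd)
  have hα' : ContDiffAt ℝ ∞ (fun z : P × Euc n => fieldInChart (formType n k) (f y) (α z.1) z.2)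
      ((fun z : P × Euc m => (z.1, inCharts m n f y (f y) z.2)) (q, ch (Euc m) y y)) := by
    simp only [e]
    exact hα
  have h2 := ContDiffAt.comp
    (g := fun z : P × Euc n => fieldInChart (formType n k) (f y) (α z.1) z.2)
    (f := fun z : P × Euc m => (z.1, inCharts m n f y (f y) z.2)) (q, ch (Euc m) y y) hα' h1
  have h3 : ContDiffAt ℝ ∞ (fun z : P × Euc m => fderiv ℝ (inCharts m n f y (f y)) z.2)
      (q, ch (Euc m) y y) :=
    ContDiffAt.comp (g := fderiv ℝ (inCharts m n f y (f y))) (f := fun z : P × Euc m => z.2)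
      (q, ch (Euc m) y y) (hc.fderiv_right (m := ∞) (by simp)) contDiffAt_snd
  refine (h2.alternating_comp h3).congr_of_eventuallyEq ?_
  filter_upwards [(continuous_snd.tendsto (q, ch (Euc m) y y)).eventually
    (eventually_fieldInChart_pullForm (k := k) hf y)] with z hz using hz _

theorem SmoothField.pullForm (hf : ContMDiff 𝓘(ℝ, Euc m) 𝓘(ℝ, Euc n) ∞ f) {α : DForm n k X}
    (hα : SmoothField (formType n k) α) : SmoothField (formType m k) (pullForm f α) :=
  SmoothField.of_fam (q := (0 : ℝ)) fun y => (hα.fam 0 (f y)).pullForm hf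

theorem dForm_pullForm (hf : ContMDiff 𝓘(ℝ, Euc m) 𝓘(ℝ, Euc n) ∞ f) {α : DForm n k X}
    (hα : SmoothField (formType n k) α) : dForm (pullForm (m := m) f α) = pullForm (m := m) f (dForm α) := by
  funext y
  have e : inCharts m n f y (f y) (ch (Euc m) y y) = ch (Euc n) (f y) (f y) :=
    inCharts_apply (mem_ch_source _ y) _
  have h1 := (eventually_fieldInChart_pullForm (k := k + 1) hf y).self_of_nhds (dForm α)
  rw [fieldInChart_self] at h1
  have h2 : fieldInChart (formType m k) y (pullForm (m := m) f α) =ᶠ[𝓝 (ch (Euc m) y y)] _ :=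
    (eventually_fieldInChart_pullForm (k := k) hf y).mono fun z hz => hz α
  have hd : DifferentiableAt ℝ (fieldInChart (formType n k) (f y) α)
      (inCharts m n f y (f y) (ch (Euc m) y y)) := by
    rw [e]; exact (hα (f y)).differentiableAt (by simp)
  rw [h1, dForm_eq_extDeriv, h2.extDeriv_eq,
    extDeriv_pullback hd (contDiffAt_inCharts hf y) (by simpa using two_le_smooth), e,
    fieldInChart_dForm (mem_ch_source _ (f y)) ((hα (f y)).of_le (by simp))]

theorem pullForm_add (f : Y → X) (α β : DForm n k X) :
    pullForm (m := m) f (α + β) = pullForm (m := m) f α + pullForm (m := m) f β := rfl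

theorem pullForm_sub (f : Y → X) (α β : DForm n k X) :
    pullForm (m := m) f (α - β) = pullForm (m := m) f α - pullForm (m := m) f β := rfl

theorem hasDerivAt_pullForm {α : ℝ → DForm n k X} {D : DForm n k X} {t : ℝ} {y : Y}
    (h : HasDerivAt (fun t => α t (f y)) (D (f y)) t) :
    HasDerivAt (fun t => pullForm (m := m) f (α t) y) (pullForm (m := m) f D y) t :=
  hasDerivAt_alternating fun _ => h.alternating_apply _

/-! ### Vector fields tangent to an immersed manifold -/

/-- In the charts of the immersion normal form `f` is a linear inclusion; projecting back gives a
differentiable local left inverse, and the chain rule concludes. -/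
theorem md_injective (hf : Manifold.IsImmersion 𝓘(ℝ, Euc m) 𝓘(ℝ, Euc n) ∞ f) (y : Y) :
    Function.Injective (md m n f y) := by
  have h := hf.isImmersionAt y
  set d := h.domChart
  set c := h.codChart
  let g : X → Y := d.symm ∘ Prod.fst ∘ h.equiv.symm ∘ c
  have hgf : g ∘ f =ᶠ[𝓝 y] id := by
    filter_upwards [d.open_source.mem_nhds h.mem_domChart_source] with z hz
    have h1 := h.writtenInCharts (show d z ∈ (d.extend 𝓘(ℝ, Euc m)).target by simpa using d.map_source hz)
    have h2 : c (f (d.symm (d z))) = h.equiv (d z, 0) := h1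
    rw [d.left_inv hz] at h2
    change d.symm (h.equiv.symm (c (f z))).1 = z
    rw [h2, ContinuousLinearEquiv.symm_apply_apply, d.left_inv hz]
  have hc : MDifferentiableAt 𝓘(ℝ, Euc n) 𝓘(ℝ, Euc n) c (f y) :=
    (contMDiffAt_of_mem_maximalAtlas h.codChart_mem_maximalAtlas
      h.mem_codChart_source).mdifferentiableAt (by simp)
  have hp : Differentiable ℝ (fun w : Euc n => (h.equiv.symm w).1) :=
    differentiable_fst.comp h.equiv.symm.differentiable
  have e : (h.equiv.symm (c (f y))).1 = d y := by
    have h1 := h.writtenInCharts (show d y ∈ (d.extend 𝓘(ℝ, Euc m)).target by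
      simpa using d.map_source h.mem_domChart_source)
    have h2 : c (f (d.symm (d y))) = h.equiv (d y, 0) := h1
    rw [d.left_inv h.mem_domChart_source] at h2
    rw [h2, ContinuousLinearEquiv.symm_apply_apply]
  have hd : MDifferentiableAt 𝓘(ℝ, Euc m) 𝓘(ℝ, Euc m) d.symm (h.equiv.symm (c (f y))).1 := by
    rw [e]
    exact (contMDiffAt_symm_of_mem_maximalAtlas h.domChart_mem_maximalAtlas
      (d.map_source h.mem_domChart_source)).mdifferentiableAt (by simp)
  have hg : MDifferentiableAt 𝓘(ℝ, Euc n) 𝓘(ℝ, Euc m) g (f y) :=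
    hd.comp (f y) ((hp (c (f y))).mdifferentiableAt.comp (f y) hc)
  have hfd : MDifferentiableAt 𝓘(ℝ, Euc m) 𝓘(ℝ, Euc n) f y :=
    (hf.contMDiff y).mdifferentiableAt (by simp)
  have h3 := mfderiv_comp y hg hfd
  rw [hgf.mfderiv_eq, mfderiv_id] at h3
  intro a b hab
  have ha := DFunLike.congr_fun h3 a
  have hb := DFunLike.congr_fun h3 b
  exact ha.trans ((congrArg (mfderiv 𝓘(ℝ, Euc n) 𝓘(ℝ, Euc m) g (f y)) hab).trans hb.symm)

theorem md_restrictVF {v : VField n X} {y : Y} (h : TangentAt (n := n) (m := m) f v y) :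
    md m n f y (restrictVF f v y) = v (f y) :=
  Function.invFun_eq h

/-- Injectivity of the differential makes the choice hidden in `restrictVF` irrelevant. -/
theorem restrictVF_eq_of_md (hf : Manifold.IsImmersion 𝓘(ℝ, Euc m) 𝓘(ℝ, Euc n) ∞ f)
    {v : VField n X} {y : Y} {w : Euc m} (h : md m n f y w = v (f y)) :
    restrictVF f v y = w :=
  md_injective hf y ((md_restrictVF ⟨w, h⟩).trans h.symm)

theorem tangentAt_of_md {v : VField n X} {y : Y} {w : Euc m} (h : md m n f y w = v (f y)) :
    TangentAt (n := n) (m := m) f v y := ⟨w, h⟩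

theorem TangentAt.add {v w : VField n X} {y : Y} (hv : TangentAt (n := n) (m := m) f v y)
    (hw : TangentAt (n := n) (m := m) f w y) : TangentAt (n := n) (m := m) f (v + w) y :=
  tangentAt_of_md (w := restrictVF f v y + restrictVF f w y) (by
    rw [map_add, md_restrictVF hv, md_restrictVF hw]; rfl)

theorem TangentAt.smul (a : ℝ) {v : VField n X} {y : Y}
    (hv : TangentAt (n := n) (m := m) f v y) : TangentAt (n := n) (m := m) f (a • v) y :=
  tangentAt_of_md (w := a • restrictVF f v y) (by
    rw [map_smul, md_restrictVF hv]; rfl)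

theorem restrictVF_add (hf : Manifold.IsImmersion 𝓘(ℝ, Euc m) 𝓘(ℝ, Euc n) ∞ f)
    {v w : VField n X} {y : Y} (hv : TangentAt (n := n) (m := m) f v y)
    (hw : TangentAt (n := n) (m := m) f w y) :
    restrictVF (m := m) f (v + w) y = restrictVF f v y + restrictVF f w y :=
  restrictVF_eq_of_md hf (by rw [map_add, md_restrictVF hv, md_restrictVF hw]; rfl)

theorem pullForm_contract {v : VField n X} {y : Y} (hv : TangentAt (n := n) (m := m) f v y)
    (α : DForm n (k + 1) X) :
    pullForm (m := m) f (contract v α) y = contract (restrictVF f v) (pullForm f α) y := by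
  ext w
  change α (f y) (Matrix.vecCons (v (f y)) fun i => md m n f y (w i)) =
    α (f y) (fun i => md m n f y ((Matrix.vecCons (restrictVF f v y) w : Fin (k + 1) → Euc m) i))
  congr 1
  funext i
  refine Fin.cases ?_ (fun i => ?_) i
  · exact (md_restrictVF hv).symm
  · rfl

/-- A tangent vector field and the induced vector field, read in charts. -/
theorem fderiv_inCharts_restrictVF (hf : ContMDiff 𝓘(ℝ, Euc m) 𝓘(ℝ, Euc n) ∞ f) {y₀ y : Y}
    {x₀ : X} (hy : y ∈ (ch (Euc m) y₀).source) (hx : f y ∈ (ch (Euc n) x₀).source)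
    {v : VField n X} {u : VField m Y} (h : md m n f y (u y) = v (f y)) :
    fderiv ℝ (inCharts m n f y₀ x₀) (ch (Euc m) y₀ y)
      (fieldInChart (vecType m) y₀ u (ch (Euc m) y₀ y)) =
      fieldInChart (vecType n) x₀ v (inCharts m n f y₀ x₀ (ch (Euc m) y₀ y)) := by
  have hy' := mem_ch_source (Euc m) y
  rw [inCharts_apply hy, fderiv_inCharts hf hy hx, fieldInChart_ch _ hy, fieldInChart_ch _ hx]
  change tc (Euc n) (f y) x₀ (f y) (md m n f y
    ((tc (Euc m) y₀ y y * tc (Euc m) y y₀ y) (u y))) = tc (Euc n) (f y) x₀ (f y) (v (f y))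
  rw [tc_mul_tc _ hy' hy hy', tc_self _ hy', ← h]
  rfl

theorem fderiv_inCharts_injective (hf : Manifold.IsImmersion 𝓘(ℝ, Euc m) 𝓘(ℝ, Euc n) ∞ f) (y : Y) :
    Function.Injective (fderiv ℝ (inCharts m n f y (f y)) (ch (Euc m) y y)) := by
  rw [fderiv_inCharts hf.contMDiff (mem_ch_source _ y) (mem_ch_source _ (f y)),
    tc_self _ (mem_ch_source _ y), tc_self _ (mem_ch_source _ (f y))]
  exact md_injective hf y

/-- The vector field induced by a smooth family of tangent vector fields is smooth. -/
theorem SmoothFam.restrictVF (hf : Manifold.IsImmersion 𝓘(ℝ, Euc m) 𝓘(ℝ, Euc n) ∞ f)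
    {v : P → VField n X} {q : P} {y : Y} (hv : SmoothFam (vecType n) v q (f y))
    (ht : ∀ᶠ z in 𝓝 (q, y), TangentAt (n := n) (m := m) f (v z.1) z.2) :
    SmoothFam (vecType m) (fun q => restrictVF f (v q)) q y := by
  have hc := contDiffAt_inCharts hf.contMDiff y
  have e : inCharts m n f y (f y) (ch (Euc m) y y) = ch (Euc n) (f y) (f y) :=
    inCharts_apply (mem_ch_source _ y) _
  obtain ⟨L, hL⟩ := LinearMap.exists_leftInverse_of_injective
    (fderiv ℝ (inCharts m n f y (f y)) (ch (Euc m) y y)).toLinearMap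
    (LinearMap.ker_eq_bot.2 (fderiv_inCharts_injective hf y))
  let L' : Euc n →L[ℝ] Euc m := LinearMap.toContinuousLinearMap L
  -- With `L'` a left inverse of the differential at the base point, `B = L' ∘ Df` is the identity
  -- there and invertible nearby, so the induced field is `B⁻¹ L' v`, which is smooth in all
  -- variables.
  let B : P × Euc m → (Euc m →L[ℝ] Euc m) := fun z =>
    L'.comp (fderiv ℝ (inCharts m n f y (f y)) z.2)
  have hB0 : B (q, ch (Euc m) y y) = 1 := by
    ext1 w
    exact DFunLike.congr_fun hL w
  have hBs : ContDiffAt ℝ ∞ B (q, ch (Euc m) y y) :=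
    contDiffAt_const.clm_comp (ContDiffAt.comp (g := fderiv ℝ (inCharts m n f y (f y)))
      (f := fun z : P × Euc m => z.2) (q, ch (Euc m) y y)
      (hc.fderiv_right (m := ∞) (by simp)) contDiffAt_snd)
  have hBi : ContDiffAt ℝ ∞ (fun z => Ring.inverse (B z)) (q, ch (Euc m) y y) := by
    refine ContDiffAt.comp (g := Ring.inverse) (f := B) _ ?_ hBs
    rw [hB0]
    exact contDiffAt_ringInverse ℝ (1 : (Euc m →L[ℝ] Euc m)ˣ)
  have h1 : ContDiffAt ℝ ∞ (fun z : P × Euc m => (z.1, inCharts m n f y (f y) z.2))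
      (q, ch (Euc m) y y) :=
    contDiffAt_fst.prodMk (ContDiffAt.comp (g := inCharts m n f y (f y))
      (f := fun z : P × Euc m => z.2) (q, ch (Euc m) y y) hc contDiffAt_snd)
  have hv' : ContDiffAt ℝ ∞ (fun z : P × Euc n => fieldInChart (vecType n) (f y) (v z.1) z.2)
      ((fun z : P × Euc m => (z.1, inCharts m n f y (f y) z.2)) (q, ch (Euc m) y y)) := by
    simp only [e]
    exact hv
  have h2 := ContDiffAt.comp
    (g := fun z : P × Euc n => fieldInChart (vecType n) (f y) (v z.1) z.2)
    (f := fun z : P × Euc m => (z.1, inCharts m n f y (f y) z.2)) (q, ch (Euc m) y y) hv' h1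
  have h3 : ContDiffAt ℝ ∞ (fun z : P × Euc m => Ring.inverse (B z)
      (L' (fieldInChart (vecType n) (f y) (v z.1) (inCharts m n f y (f y) z.2))))
      (q, ch (Euc m) y y) :=
    hBi.clm_apply (L'.contDiff.contDiffAt.comp _ h2)
  refine h3.congr_of_eventuallyEq ?_
  have hu : ∀ᶠ z in 𝓝 (q, ch (Euc m) y y), IsUnit (B z) := by
    refine hBs.continuousAt.eventually ?_
    rw [hB0]
    exact Units.isOpen.mem_nhds isUnit_one
  have hsx : ∀ᶠ z : P × Euc m in 𝓝 (q, ch (Euc m) y y),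
      f ((ch (Euc m) y).symm z.2) ∈ (ch (Euc n) (f y)).source :=
    (continuous_snd.tendsto (q, ch (Euc m) y y)).eventually
      (eventually_ch_symm (Euc m) (mem_ch_source _ y)
        (hf.contMDiff.continuous.continuousAt.eventually
          (ch_source_mem_nhds (Euc n) (mem_ch_source _ (f y)))))
  have htg : ∀ᶠ z : P × Euc m in 𝓝 (q, ch (Euc m) y y),
      z.2 ∈ (ch (Euc m) y).target :=
    (continuous_snd.tendsto (q, ch (Euc m) y y)).eventually
      (ch_target_mem_nhds (Euc m) (mem_ch_source _ y))
  have hts : Filter.Tendsto (fun z : P × Euc m => (z.1, (ch (Euc m) y).symm z.2))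
      (𝓝 (q, ch (Euc m) y y)) (𝓝 (q, y)) := by
    rw [nhds_prod_eq, nhds_prod_eq]
    exact Filter.tendsto_id.prodMap (tendsto_ch_symm (Euc m) (mem_ch_source _ y))
  filter_upwards [hu, hsx, htg, hts.eventually ht] with z hz1 hz2 hz3 hz4
  have hs := (ch (Euc m) y).map_target hz3
  have key := fderiv_inCharts_restrictVF hf.contMDiff hs hz2 (md_restrictVF hz4)
  rw [(ch (Euc m) y).right_inv hz3] at key
  rw [← key]
  change _ = Ring.inverse (B z) (B z _)
  rw [← mul_apply_eq_comp, Ring.inverse_mul_cancel _ hz1]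
  rfl

theorem SmoothField.restrictVF (hf : Manifold.IsImmersion 𝓘(ℝ, Euc m) 𝓘(ℝ, Euc n) ∞ f)
    {v : VField n X} (hv : SmoothField (vecType n) v)
    (ht : ∀ y, TangentAt (n := n) (m := m) f v y) :
    SmoothField (vecType m) (restrictVF f v) :=
  SmoothField.of_fam (q := (0 : ℝ)) fun y => (hv.fam (0 : ℝ) (f y)).restrictVF hf
    (Filter.Eventually.of_forall fun z => ht z.2)

/-- The bracket of tangent vector fields is tangent. -/
theorem md_vfBracket (hf : ContMDiff 𝓘(ℝ, Euc m) 𝓘(ℝ, Euc n) ∞ f) {u v : VField n X}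
    {u' v' : VField m Y} (hu : SmoothField (vecType n) u) (hv : SmoothField (vecType n) v)
    (hu' : SmoothField (vecType m) u') (hv' : SmoothField (vecType m) v')
    (hut : ∀ y, md m n f y (u' y) = u (f y)) (hvt : ∀ y, md m n f y (v' y) = v (f y)) (y : Y) :
    md m n f y (vfBracket u' v' y) = vfBracket u v (f y) := by
  have hc := contDiffAt_inCharts hf y
  have e : inCharts m n f y (f y) (ch (Euc m) y y) = ch (Euc n) (f y) (f y) :=
    inCharts_apply (mem_ch_source _ y) _
  set g := inCharts m n f y (f y) with hg
  set z := ch (Euc m) y y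
  have hmd : fderiv ℝ g z = md m n f y := by
    rw [hg, fderiv_inCharts hf (mem_ch_source _ y) (mem_ch_source _ (f y)),
      tc_self _ (mem_ch_source _ y), tc_self _ (mem_ch_source _ (f y))]
    rfl
  have hrel : ∀ {w : VField n X} {w' : VField m Y}, (∀ y, md m n f y (w' y) = w (f y)) →
      (fun z => fderiv ℝ g z (fieldInChart (vecType m) y w' z)) =ᶠ[𝓝 z]
        fun z => fieldInChart (vecType n) (f y) w (g z) := by
    intro w w' hw
    refine eventually_inChart (mem_ch_source _ y) ?_
    filter_upwards [hf.continuous.continuousAt.eventually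
      (ch_source_mem_nhds (Euc n) (mem_ch_source _ (f y)))] with y' hx hy
    exact fderiv_inCharts_restrictVF hf hy hx (hw y')
  have hdd : DifferentiableAt ℝ (fderiv ℝ g) z :=
    (hc.fderiv_right (m := ∞) (by simp)).differentiableAt (by simp)
  -- Differentiate the relation `Dg w' = w ∘ g`. In the bracket the Hessian of `g` is evaluated on
  -- `u'` and `v'` in both orders and drops out by symmetry.
  have hD : ∀ {w : VField n X} {w' : VField m Y}, SmoothField (vecType n) w →
      SmoothField (vecType m) w' → (∀ y, md m n f y (w' y) = w (f y)) → ∀ h,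
      fderiv ℝ (fieldInChart (vecType n) (f y) w) (g z) (fderiv ℝ g z h) =
        fderiv ℝ (fderiv ℝ g) z h (fieldInChart (vecType m) y w' z) +
          fderiv ℝ g z (fderiv ℝ (fieldInChart (vecType m) y w') z h) := by
    intro w w' hw hw' hr h
    have h1 := hdd.hasFDerivAt.clm_apply ((hw' y).differentiableAt (by simp)).hasFDerivAt
    have h2 : DifferentiableAt ℝ (fieldInChart (vecType n) (f y) w) (g z) := by
      rw [e]; exact (hw (f y)).differentiableAt (by simp)
    have h3 := h2.hasFDerivAt.comp z (hc.differentiableAt (by simp)).hasFDerivAt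
    have h4 := DFunLike.congr_fun (h1.fderiv.symm.trans ((hrel hr).fderiv_eq.trans h3.fderiv)) h
    simp only [add_apply, ContinuousLinearMap.coe_comp, Function.comp_apply,
      ContinuousLinearMap.flip_apply] at h4
    rw [← h4, add_comm]
  have hsym : IsSymmSndFDerivAt ℝ g z := hc.isSymmSndFDerivAt (by simpa using two_le_smooth)
  have ru := (hrel hut).eq_of_nhds
  have rv := (hrel hvt).eq_of_nhds
  have hDu := hD hu hu' hut (fieldInChart (vecType m) y v' z)
  have hDv := hD hv hv' hvt (fieldInChart (vecType m) y u' z)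
  rw [vfBracket_eq_lieField, vfBracket_eq_lieField, lieField_eq_flatLie, lieField_eq_flatLie,
    flatLie_vecType, flatLie_vecType, VectorField.lieBracket, VectorField.lieBracket, ← e, ← ru,
    ← rv, hDu, hDv, ← hmd, map_sub, hsym.eq (fieldInChart (vecType m) y v' z)]
  abel

theorem vfBracket_tangentAt (hf : Manifold.IsImmersion 𝓘(ℝ, Euc m) 𝓘(ℝ, Euc n) ∞ f)
    {u v : VField n X} (hu : SmoothField (vecType n) u) (hv : SmoothField (vecType n) v)
    (hut : ∀ y, TangentAt (n := n) (m := m) f u y) (hvt : ∀ y, TangentAt (n := n) (m := m) f v y)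
    (y : Y) : TangentAt (n := n) (m := m) f (vfBracket u v) y :=
  tangentAt_of_md (md_vfBracket hf.contMDiff hu hv (hu.restrictVF hf hut) (hv.restrictVF hf hvt)
    (fun y => md_restrictVF (hut y)) (fun y => md_restrictVF (hvt y)) y)

theorem restrictVF_vfBracket (hf : Manifold.IsImmersion 𝓘(ℝ, Euc m) 𝓘(ℝ, Euc n) ∞ f)
    {u v : VField n X} (hu : SmoothField (vecType n) u) (hv : SmoothField (vecType n) v)
    (hut : ∀ y, TangentAt (n := n) (m := m) f u y)
    (hvt : ∀ y, TangentAt (n := n) (m := m) f v y) :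
    restrictVF (m := m) f (vfBracket u v) = vfBracket (restrictVF f u) (restrictVF f v) :=
  funext fun y => restrictVF_eq_of_md hf
    (md_vfBracket hf.contMDiff hu hv (hu.restrictVF hf hut) (hv.restrictVF hf hvt)
      (fun y => md_restrictVF (hut y)) (fun y => md_restrictVF (hvt y)) y)

end Pull

end CovPhase

namespace CovPhase

/-! ### Derivatives and difference quotients of families of tensor fields -/

section Families

variable {n : ℕ} {W : Type*} [NormedAddCommGroup W] [NormedSpace ℝ W] {T : TensorType n W}
  {M : Type*} [TopologicalSpace M] [ChartedSpace (Euc n) M] [IsManifold 𝓘(ℝ, Euc n) ∞ M]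
  {P : Type*} [NormedAddCommGroup P] [NormedSpace ℝ P]

/-- The action of an invertible map as an equivalence. -/
noncomputable def actEquiv (T : TensorType n W) (A : (Euc n →L[ℝ] Euc n)ˣ) : W ≃L[ℝ] W :=
  ContinuousLinearEquiv.equivOfInverse (T.act A) (T.act ↑A⁻¹)
    (fun w => by
      rw [← mul_apply_eq_comp, ← T.act_mul _ _ A⁻¹.isUnit A.isUnit, Units.inv_mul, T.act_one]; rfl)
    (fun w => by
      rw [← mul_apply_eq_comp, ← T.act_mul _ _ A.isUnit A⁻¹.isUnit, Units.mul_inv, T.act_one]; rfl)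

/-- No differentiability is needed, since the action of a coordinate change is a linear equivalence
and `deriv` commutes with those. -/
theorem fieldInChart_deriv_apply {x₀ p : M} (h0 : p ∈ (ch (Euc n) x₀).source) (Φ : ℝ → M → W)
    (t : ℝ) :
    fieldInChart T x₀ (fun x => deriv (fun t => Φ t x) t) (ch (Euc n) x₀ p) =
      deriv (fun t => fieldInChart T x₀ (Φ t) (ch (Euc n) x₀ p)) t := by
  have hp := mem_ch_source (Euc n) p
  simp only [fieldInChart_ch T h0]
  have h := (actEquiv T (tcUnit (Euc n) hp h0)).comp_fderiv (f := fun t => Φ t p) (x := t)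
  have h2 := DFunLike.congr_fun h 1
  exact h2.symm

/-- The value at a point of a smooth family. -/
theorem SmoothFam.contDiffAt {Φ : P → M → W} {q : P} {p : M} (h : SmoothFam T Φ q p) :
    ContDiffAt ℝ ∞ (fun q => Φ q p) q := by
  have h1 := ContDiffAt.comp (g := fun z : P × Euc n => fieldInChart T p (Φ z.1) z.2)
    (f := fun q => (q, ch (Euc n) p p)) q h (contDiffAt_id.prodMk contDiffAt_const)
  refine h1.congr_of_eventuallyEq (Filter.Eventually.of_forall fun q => ?_)
  exact (fieldInChart_self T p (Φ q)).symm

/-- The derivative of a family with an additional parameter. -/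
theorem SmoothFam.deriv_left {Φ : ℝ → P → M → W} {s : ℝ} {q : P} {p : M}
    (h : SmoothFam T (fun z : ℝ × P => Φ z.1 z.2) (s, q) p) :
    SmoothFam T (fun q x => _root_.deriv (fun s => Φ s q x) s) q p := by
  let g : ℝ × (P × Euc n) → W := fun z => fieldInChart T p (Φ z.1 z.2.1) z.2.2
  have hg : ContDiffAt ℝ ∞ g (s, (q, ch (Euc n) p p)) :=
    ContDiffAt.comp (g := fun z : (ℝ × P) × Euc n => fieldInChart T p (Φ z.1.1 z.1.2) z.2)
      (f := fun z : ℝ × (P × Euc n) => ((z.1, z.2.1), z.2.2)) (s, (q, ch (Euc n) p p)) h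
      ((contDiffAt_fst.prodMk (contDiffAt_fst.comp _ contDiffAt_snd)).prodMk
        (contDiffAt_snd.comp _ contDiffAt_snd))
  have h1 := ContDiffAt.comp (f := fun z : P × Euc n => (s, z)) (q, ch (Euc n) p p)
    hg.partial_left (contDiffAt_const.prodMk contDiffAt_id)
  refine h1.congr_of_eventuallyEq ?_
  have h2 : ∀ᶠ z : P × Euc n in 𝓝 (q, ch (Euc n) p p), z.2 ∈ (ch (Euc n) p).target :=
    (continuous_snd.tendsto (q, ch (Euc n) p p)).eventually
      (ch_target_mem_nhds (Euc n) (mem_ch_source _ p))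
  filter_upwards [h2] with z hz
  have := fieldInChart_deriv_apply (T := T) ((ch (Euc n) p).map_target hz) (fun s => Φ s z.1) s
  rwa [(ch (Euc n) p).right_inv hz] at this

/-- Coordinates on `V` bring the values into `Type`, where `eventually_contDiffAt_dslope` lives. -/
theorem contDiffAt_dslope {V : Type*} [NormedAddCommGroup V] [NormedSpace ℝ V]
    [FiniteDimensional ℝ V] {g : ℝ × Euc n → V} {y₀ : Euc n}
    (hg : ∀ᶠ z in 𝓝 ((0 : ℝ), y₀), ContDiffAt ℝ ∞ g z) :
    ContDiffAt ℝ ∞ (fun z : ℝ × Euc n => dslope (fun t => g (t, z.2)) 0 z.1) (0, y₀) := by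
  let e : V ≃L[ℝ] (Fin (Module.finrank ℝ V) → ℝ) :=
    ContinuousLinearEquiv.ofFinrankEq (by simp)
  have h1 : ∀ᶠ z in 𝓝 ((0 : ℝ), y₀), ContDiffAt ℝ ∞ (fun z => e (g z)) z :=
    hg.mono fun z hz => e.contDiff.contDiffAt.comp z hz
  have h2 := e.symm.contDiff.contDiffAt.comp _ (eventually_contDiffAt_dslope h1).self_of_nhds
  refine h2.congr_of_eventuallyEq ?_
  have hd : ∀ᶠ y in 𝓝 y₀, DifferentiableAt ℝ (fun t => g (t, y)) 0 := by
    have := ((Continuous.prodMk_right (0 : ℝ)).tendsto y₀).eventually hg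
    filter_upwards [this] with y hy
    exact (hasDerivAt_partial_left (z := ((0 : ℝ), y))
      (hy.differentiableAt (by simp))).differentiableAt
  filter_upwards [(continuous_snd.tendsto ((0 : ℝ), y₀)).eventually hd] with z hz
  have := e.toContinuousLinearMap.dslope_comp (fun t => g (t, z.2)) 0 z.1 (fun _ => hz)
  simp only [Function.comp_def] at this ⊢
  rw [eq_comm, ContinuousLinearEquiv.symm_apply_eq]
  exact this

/-- The difference quotient of a smooth family is a smooth family. -/
theorem smoothFam_dslope [FiniteDimensional ℝ W] {Φ : ℝ → M → W}
    (h : ∀ t x, SmoothFam T Φ t x) (t : ℝ) (p : M) :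
    SmoothFam T (fun t x => dslope (fun t => Φ t x) 0 t) t p := by
  rcases eq_or_ne t 0 with rfl | ht
  · have hp := mem_ch_source (Euc n) p
    have hs : ∀ᶠ z in 𝓝 ((0 : ℝ), ch (Euc n) p p),
        ContDiffAt ℝ ∞ (fun z : ℝ × Euc n => fieldInChart T p (Φ z.1) z.2) z := by
      have h2 : ∀ᶠ z : ℝ × Euc n in 𝓝 ((0 : ℝ), ch (Euc n) p p), z.2 ∈ (ch (Euc n) p).target :=
        (continuous_snd.tendsto ((0 : ℝ), ch (Euc n) p p)).eventually (ch_target_mem_nhds (Euc n) hp)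
      filter_upwards [h2] with z hz
      have := (h z.1 ((ch (Euc n) p).symm z.2)).inChart ((ch (Euc n) p).map_target hz)
      rwa [(ch (Euc n) p).right_inv hz] at this
    refine (contDiffAt_dslope hs).congr_of_eventuallyEq ?_
    have h2 : ∀ᶠ z : ℝ × Euc n in 𝓝 ((0 : ℝ), ch (Euc n) p p), z.2 ∈ (ch (Euc n) p).target :=
      (continuous_snd.tendsto ((0 : ℝ), ch (Euc n) p p)).eventually (ch_target_mem_nhds (Euc n) hp)
    filter_upwards [h2] with z hz
    have := (T.act (tc (Euc n) ((ch (Euc n) p).symm z.2) p ((ch (Euc n) p).symm z.2))).dslope_comp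
      (fun t => Φ t ((ch (Euc n) p).symm z.2)) 0 z.1
      (fun _ => (h 0 _).contDiffAt.differentiableAt (by simp))
    exact this.symm
  -- Away from the parameter `0` the quotient is explicit; Hadamard's lemma is needed only at `0`.
  · have h1 : SmoothFam T (fun t x => t⁻¹ • (Φ t x + (-1 : ℝ) • Φ 0 x)) t p := by
      refine SmoothFam.smul (a := fun t _ => t⁻¹) ?_ ?_
      · exact (h t p).add (SmoothFam.smul (a := fun _ _ => (-1 : ℝ))
          ((h 0 p).comp (τ := fun _ : ℝ => (0 : ℝ)) contDiffAt_const) contDiffAt_const)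
      · exact ContDiffAt.comp (g := fun t : ℝ => t⁻¹) (f := fun z : ℝ × Euc n => z.1)
          (t, ch (Euc n) p p) (contDiffAt_inv ℝ ht) contDiffAt_fst
    refine h1.congr ?_
    have h2 : ∀ᶠ s : ℝ in 𝓝 t, s ≠ 0 := isOpen_ne.mem_nhds ht
    filter_upwards [(continuous_fst.tendsto (t, p)).eventually h2] with z hz
    rw [dslope_of_ne _ hz, slope_def_module]
    simp [sub_eq_add_neg]

end Families

/-! ### Local operators -/

section LocalOps

variable {n l k : ℕ} {W : Type*} [NormedAddCommGroup W] [NormedSpace ℝ W] {T : TensorType n W}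
  {V : Type*} [NormedAddCommGroup V] [NormedSpace ℝ V] {S : TensorType n V}
  {M : Type*} [TopologicalSpace M] [ChartedSpace (Euc n) M] [IsManifold 𝓘(ℝ, Euc n) ∞ M]
  {X : Type*} [TopologicalSpace X] [ChartedSpace (Euc l) X] [IsManifold 𝓘(ℝ, Euc l) ∞ X]
  {P : Type*} [NormedAddCommGroup P] [NormedSpace ℝ P] [FiniteDimensional ℝ P] {f : X → M}

/-- Local operators on pairs of tensor fields, linear in the second one. -/
structure LocalLin (T : TensorType n W) (S : TensorType n V) (f : X → M)
    (A : (M → W) → (M → V) → DForm l k X) : Prop where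
  isLocal : ∀ φ φ' ψ ψ' x, φ =ᶠ[𝓝 (f x)] φ' → ψ =ᶠ[𝓝 (f x)] ψ' → A φ ψ x = A φ' ψ' x
  add : ∀ φ ∈ FieldSpace T, ∀ ψ ψ', SmoothField S ψ → SmoothField S ψ' →
    A φ (ψ + ψ') = A φ ψ + A φ ψ'
  smul : ∀ φ ∈ FieldSpace T, ∀ (a : ℝ) (ψ), SmoothField S ψ → A φ (a • ψ) = a • A φ ψ
  isSmooth : ∀ (p : ℕ) (φ : (Fin p → ℝ) → M → W) (ψ : (Fin p → ℝ) → M → V),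
    SmoothFieldFamily T φ → SmoothFieldFamily S ψ → ∀ t₀, φ t₀ ∈ FieldSpace T → ∀ x₀,
      SmoothFormFamilyAt (fun t => A (φ t) (ψ t)) t₀ x₀

theorem IsLocal1.localLin {A : (M → W) → (M → W) → DForm l k X} (hA : IsLocal1 T f A) :
    LocalLin T T f A := ⟨hA.isLocal, hA.add, hA.smul, hA.isSmooth⟩

theorem IsLocalVec.localLin {A : (M → W) → VField n M → DForm n k M} (hA : IsLocalVec T A) :
    LocalLin T (vecType n) id A := ⟨hA.isLocal, hA.add, hA.smul, hA.isSmooth⟩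

theorem exists_equiv_fin (P : Type*) [NormedAddCommGroup P] [NormedSpace ℝ P]
    [FiniteDimensional ℝ P] : ∃ p : ℕ, Nonempty (P ≃L[ℝ] (Fin p → ℝ)) :=
  ⟨Module.finrank ℝ P, ⟨ContinuousLinearEquiv.ofFinrankEq (by simp)⟩⟩

/-- The definition only tests parameter spaces `Fin p → ℝ`; linear coordinates extend it to `ℝ`, `ℝ
× ℝ` and the other finite-dimensional spaces used below. -/
theorem LocalLin.smoothFam {A : (M → W) → (M → V) → DForm l k X} (hA : LocalLin T S f A)
    {Φ : P → M → W} {Ψ : P → M → V} (hΦ : ∀ q x, SmoothFam T Φ q x)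
    (hΨ : ∀ q x, SmoothFam S Ψ q x) {q : P} (hq : Φ q ∈ FieldSpace T) (x : X) :
    SmoothFam (formType l k) (fun q => A (Φ q) (Ψ q)) q x := by
  obtain ⟨p, ⟨e⟩⟩ := exists_equiv_fin P
  have h := smoothFormFamilyAt_iff.1 (hA.isSmooth p (fun t => Φ (e.symm t)) (fun t => Ψ (e.symm t))
    (fun t x => (hΦ _ x).comp e.symm.contDiff.contDiffAt)
    (fun t x => (hΨ _ x).comp e.symm.contDiff.contDiffAt) (e q) (by simpa using hq) x)
  simpa using h.comp (τ := e) e.contDiff.contDiffAt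

theorem IsLocal0.smoothFam {A : (M → W) → DForm l k X} (hA : IsLocal0 T f A)
    {Φ : P → M → W} (hΦ : ∀ q x, SmoothFam T Φ q x) {q : P} (hq : Φ q ∈ FieldSpace T) (x : X) :
    SmoothFam (formType l k) (fun q => A (Φ q)) q x := by
  obtain ⟨p, ⟨e⟩⟩ := exists_equiv_fin P
  have h := smoothFormFamilyAt_iff.1 (hA.isSmooth p (fun t => Φ (e.symm t))
    (fun t x => (hΦ _ x).comp e.symm.contDiff.contDiffAt) (e q) (by simpa using hq) x)
  simpa using h.comp (τ := e) e.contDiff.contDiffAt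

theorem LocalLin.smoothField {A : (M → W) → (M → V) → DForm l k X} (hA : LocalLin T S f A)
    {φ : M → W} (hφ : φ ∈ FieldSpace T) {ψ : M → V} (hψ : SmoothField S ψ) :
    SmoothField (formType l k) (A φ ψ) :=
  SmoothField.of_fam (q := (0 : ℝ)) fun x =>
    hA.smoothFam (hφ.1.fam) (hψ.fam) hφ x

theorem IsLocal0.smoothField {A : (M → W) → DForm l k X} (hA : IsLocal0 T f A)
    {φ : M → W} (hφ : φ ∈ FieldSpace T) : SmoothField (formType l k) (A φ) :=
  SmoothField.of_fam (q := (0 : ℝ)) fun x => hA.smoothFam (hφ.1.fam) hφ x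

theorem LocalLin.sub {A : (M → W) → (M → V) → DForm l k X} (hA : LocalLin T S f A)
    {φ : M → W} (hφ : φ ∈ FieldSpace T) {ψ ψ' : M → V} (hψ : SmoothField S ψ)
    (hψ' : SmoothField S ψ') : A φ (ψ - ψ') = A φ ψ - A φ ψ' := by
  have e : ψ - ψ' = ψ + (-1 : ℝ) • ψ' := by simp [sub_eq_add_neg]
  rw [e, hA.add φ hφ _ _ hψ (hψ'.smul _), hA.smul φ hφ _ _ hψ']
  funext x; ext w; simp [sub_eq_add_neg]

/-- Smooth two-parameter families `φ + s ψ`. -/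
theorem smoothFam_add_smul {Φ Ψ : P → M → W} (hΦ : ∀ q x, SmoothFam T Φ q x)
    (hΨ : ∀ q x, SmoothFam T Ψ q x) (z : ℝ × P) (x : M) :
    SmoothFam T (fun z : ℝ × P => Φ z.2 + z.1 • Ψ z.2) z x :=
  ((hΦ z.2 x).comp (τ := Prod.snd) contDiffAt_snd).add
    (((hΨ z.2 x).comp (τ := Prod.snd) contDiffAt_snd).smul (a := fun z _ => z.1)
      (ContDiffAt.comp (g := fun z : ℝ × P => z.1) (f := fun z : (ℝ × P) × Euc n => z.1) _
        contDiffAt_fst contDiffAt_fst))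

/-- Additivity in the direction comes from the two-parameter family `φ + b ψ + a ψ'`: all three
directional derivatives are values of one Fréchet derivative at the origin. Smoothness holds because
`δA` is the derivative of a smooth family in one additional parameter. -/
theorem IsLocal0.delta0 {A : (M → W) → DForm l k X} (hA : IsLocal0 T f A) :
    IsLocal1 T f (delta0 A) where
  isLocal φ φ' ψ ψ' x h h' := by
    have : (fun t : ℝ => A (φ + t • ψ) x) = fun t => A (φ' + t • ψ') x := by
      funext t
      refine hA.isLocal _ _ x ?_
      filter_upwards [h, h'] with y h1 h2
      simp [h1, h2]
    exact congrArg (fun g => deriv g 0) this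
  add φ hφ ψ ψ' hψ hψ' := by
    funext x
    have hs : SmoothFam (formType l k) (fun z : ℝ × ℝ => A (φ + z.2 • ψ + z.1 • ψ')) (0, 0) x :=
      hA.smoothFam (Φ := fun z : ℝ × ℝ => φ + z.2 • ψ + z.1 • ψ')
        (fun z x => smoothFam_add_smul (P := ℝ) (Φ := fun t => φ + t • ψ) (Ψ := fun _ => ψ')
          (smoothFam_line hφ.1 hψ) (fun q x => hψ'.fam q x) z x) (by simpa using hφ) x
    have hd : DifferentiableAt ℝ (fun z : ℝ × ℝ => A (φ + z.2 • ψ + z.1 • ψ') x) (0, 0) :=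
      hs.contDiffAt.differentiableAt (by simp)
    set g := fun z : ℝ × ℝ => A (φ + z.2 • ψ + z.1 • ψ') x with hg
    have hline : ∀ a b : ℝ, deriv (fun t : ℝ => g (t * a, t * b)) 0 = fderiv ℝ g (0, 0) (a, b) := by
      intro a b
      have h1 : HasDerivAt (fun t : ℝ => (t * a, t * b)) (a, b) 0 := by
        simpa using ((hasDerivAt_id (0 : ℝ)).mul_const a).prodMk
          ((hasDerivAt_id (0 : ℝ)).mul_const b)
      have h2 : HasFDerivAt g (fderiv ℝ g (0, 0)) ((fun t : ℝ => (t * a, t * b)) 0) := by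
        simpa using hd.hasFDerivAt
      exact (h2.comp_hasDerivAt (0 : ℝ) h1).deriv
    have e1 : CovPhase.delta0 A φ (ψ + ψ') x = fderiv ℝ g (0, 0) (1, 1) := by
      rw [← hline]; refine congrArg (fun g => deriv g (0 : ℝ)) (funext fun t => ?_)
      simp [hg, add_assoc]
    have e2 : CovPhase.delta0 A φ ψ x = fderiv ℝ g (0, 0) (0, 1) := by
      rw [← hline]; refine congrArg (fun g => deriv g (0 : ℝ)) (funext fun t => ?_)
      simp [hg]
    have e3 : CovPhase.delta0 A φ ψ' x = fderiv ℝ g (0, 0) (1, 0) := by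
      rw [← hline]; refine congrArg (fun g => deriv g (0 : ℝ)) (funext fun t => ?_)
      simp [hg]
    rw [Pi.add_apply, e1, e2, e3, ← map_add]
    simp
  smul φ hφ a ψ hψ := by
    funext x
    have h := deriv_comp_mul_left a (fun t : ℝ => A (φ + t • ψ) x) 0
    rw [mul_zero] at h
    rw [Pi.smul_apply]
    refine Eq.trans ?_ h
    refine congrArg (fun g => deriv g (0 : ℝ)) (funext fun t => ?_)
    rw [smul_smul, mul_comm]
  isSmooth p φ ψ hφ hψ t₀ ht₀ x₀ := by
    refine smoothFormFamilyAt_iff.2 ?_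
    exact SmoothFam.deriv_left (Φ := fun s t => A (φ t + s • ψ t)) (s := 0)
      (hA.smoothFam (Φ := fun z : ℝ × (Fin p → ℝ) => φ z.2 + z.1 • ψ z.2)
        (fun z x => smoothFam_add_smul hφ hψ z x) (by simpa using ht₀) x₀)

/-- Product rule for a local operator along families of fields. -/
theorem LocalLin.hasDerivAt [FiniteDimensional ℝ V] {A : (M → W) → (M → V) → DForm l k X}
    (hA : LocalLin T S f A) {Φ : ℝ → M → W} {Ψ : ℝ → M → V} (hΦ : ∀ t x, SmoothFam T Φ t x)
    (hΨ : ∀ t x, SmoothFam S Ψ t x) (hF : ∀ t, Φ t ∈ FieldSpace T) (x : X) :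
    HasDerivAt (fun t => A (Φ t) (Ψ t) x)
      (deriv (fun t => A (Φ t) (Ψ 0) x) 0 + A (Φ 0) (fun y => deriv (fun t => Ψ t y) 0) x) 0 := by
  -- Hadamard's lemma gives `Ψ t = Ψ 0 + t η t` with `η` a smooth family. By linearity the second
  -- term is `t A(Φ t, η t)`, whose derivative at `0` is its value `A(Φ 0, η 0)`; no topology on the
  -- space of fields is needed.
  let η : ℝ → M → V := fun t y => dslope (fun t => Ψ t y) 0 t
  have hη : ∀ t y, SmoothFam S η t y := smoothFam_dslope hΨ
  have e0 : η 0 = fun y => deriv (fun t => Ψ t y) 0 := by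
    funext y; exact dslope_same _ _
  have e1 : ∀ t, Ψ t = Ψ 0 + t • η t := by
    intro t; funext y
    have := sub_smul_dslope (fun t => Ψ t y) 0 t
    simp only [sub_zero] at this
    simp [η, this]
  have e2 : (fun t => A (Φ t) (Ψ t) x) =
      fun t => A (Φ t) (Ψ 0) x + t • A (Φ t) (η t) x := by
    funext t
    have hηs : SmoothField S (η t) := SmoothField.of_fam (hη t)
    conv_lhs => rw [e1 t, hA.add _ (hF t) _ _ (SmoothField.of_fam (hΨ 0)) (hηs.smul t),
      hA.smul _ (hF t) _ _ hηs]
    rfl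
  rw [e2]
  have h1 : HasDerivAt (fun t => A (Φ t) (Ψ 0) x) (deriv (fun t => A (Φ t) (Ψ 0) x) 0) 0 :=
    ((hA.smoothFam hΦ (Ψ := fun _ => Ψ 0) (fun t y => (SmoothField.of_fam (hΨ 0)).fam t y)
      (hF 0) x).contDiffAt.differentiableAt (by simp)).hasDerivAt
  have h2 : HasDerivAt (fun t => A (Φ t) (η t) x) _ 0 :=
    ((hA.smoothFam hΦ hη (hF 0) x).contDiffAt.differentiableAt (by simp)).hasDerivAt
  have h3 := (hasDerivAt_id (0 : ℝ)).smul h2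
  simp only [id, zero_smul, one_smul, zero_add, e0] at h3
  exact h1.add h3

end LocalOps

end CovPhase

namespace CovPhase

/-! ### Localization of field-dependent vector fields -/

section Localization

variable {n : ℕ} {W : Type*} [NormedAddCommGroup W] [NormedSpace ℝ W] {T : TensorType n W}
  {M : Type*} [TopologicalSpace M] [ChartedSpace (Euc n) M] [IsManifold 𝓘(ℝ, Euc n) ∞ M]
  {P : Type*} [NormedAddCommGroup P] [NormedSpace ℝ P] [FiniteDimensional ℝ P]

/-- Field-dependent vector fields depending smoothly on the fields. -/
def IsSmoothGen (T : TensorType n W) (ζ : (M → W) → VField n M) : Prop :=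
  ∀ (p : ℕ) (φ : (Fin p → ℝ) → M → W), SmoothFieldFamily T φ →
    ∀ t₀, φ t₀ ∈ FieldSpace T → ∀ x₀, SmoothVFFamilyAt (fun t => ζ (φ t)) t₀ x₀

theorem IsSmoothGen.smoothFam {ζ : (M → W) → VField n M} (hζ : IsSmoothGen T ζ)
    {Φ : P → M → W} (hΦ : ∀ q x, SmoothFam T Φ q x) {q : P} (hq : Φ q ∈ FieldSpace T) (x : M) :
    SmoothFam (vecType n) (fun q => ζ (Φ q)) q x := by
  obtain ⟨p, ⟨e⟩⟩ := exists_equiv_fin P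
  have h : SmoothFam (vecType n) (fun t => ζ (Φ (e.symm t))) (e q) x := hζ p (fun t => Φ (e.symm t))
    (fun t x => (hΦ _ x).comp e.symm.contDiff.contDiffAt) (e q) (by simpa using hq) x
  simpa using h.comp (τ := e) e.contDiff.contDiffAt

theorem IsSmoothGen.smoothField {ζ : (M → W) → VField n M} (hζ : IsSmoothGen T ζ)
    {φ : M → W} (hφ : φ ∈ FieldSpace T) : SmoothField (vecType n) (ζ φ) :=
  SmoothField.of_fam (q := (0 : ℝ)) fun x => hζ.smoothFam hφ.1.fam hφ x

theorem isSmoothGen_const {v : VField n M} (hv : SmoothField (vecType n) v) :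
    IsSmoothGen T (fun _ => v) := fun _ _ _ t₀ _ x₀ => hv.fam t₀ x₀

theorem contDiffAt_inChart_of_contMDiff {χ : M → ℝ}
    (hχ : ContMDiff 𝓘(ℝ, Euc n) 𝓘(ℝ, ℝ) ∞ χ) (p : M) :
    ContDiffAt ℝ ∞ (fun y => χ ((ch (Euc n) p).symm y)) (ch (Euc n) p p) := by
  have h := (contMDiffAt_iff.1 (hχ p)).2
  rw [ModelWithCorners.range_eq_univ, contDiffWithinAt_univ] at h
  exact h

/-- Spikes along a sequence of parameters: a family interpolating between the constant function
`1`, near each parameter `0`, and the `k`-th function of a given sequence, at one of two parameters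
of distance `w k`. -/
theorem exists_interpolation {χ : ℕ → M → ℝ}
    (hχ : ∀ k, ContMDiff 𝓘(ℝ, Euc n) 𝓘(ℝ, ℝ) ∞ (χ k))
    (hone : ∀ x, ∃ k₀, ∀ᶠ y in 𝓝 x, ∀ k ≥ k₀, χ k y = 1) {w : ℕ → ℝ} (hw : ∀ k, 0 < w k)
    (hw' : ∀ k, w k ≤ (1 / 2) ^ k / 8) :
    ∃ κ : ℝ → M → ℝ, (∀ (r : ℝ) (x : M), ContDiffAt ℝ ∞
        (fun z : ℝ × Euc n => κ z.1 ((ch (Euc n) x).symm z.2)) (r, ch (Euc n) x x)) ∧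
      (∀ k x, κ ((1 / 2) ^ k) x = χ k x) ∧ (∀ k x, κ ((1 / 2) ^ k + w k) x = 1) ∧
      ∀ x, κ 0 x = 1 := by
  let ψ : ContDiffBump (0 : ℝ) := ⟨1 / 4, 1 / 2, by norm_num, by norm_num⟩
  have ψ0 : ∀ s : ℝ, 1 / 2 ≤ |s| → ψ s = 0 := fun s hs =>
    ψ.zero_of_le_dist (by rw [Real.dist_eq, sub_zero]; exact hs)
  have ψ1 : ψ 0 = 1 := ψ.one_of_mem_closedBall (by simp [ψ])
  -- A bump about `2⁻ᵏ` that vanishes at distance `w k / 2` and beyond, so at `2⁻ᵏ + w k` in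
  -- particular. The bound `w k ≤ 2⁻ᵏ / 8` keeps different bumps apart and away from `0`.
  let B : ℕ → ℝ → ℝ := fun k r => ψ ((r - (1 / 2) ^ k) / w k)
  have hB : ∀ k, ContDiff ℝ ∞ (B k) := fun k =>
    ψ.contDiff.comp ((contDiff_id.sub contDiff_const).div_const _)
  have hB0 : ∀ k r, w k ≤ |r - (1 / 2) ^ k| → B k r = 0 := by
    intro k r h
    refine ψ0 _ ?_
    rw [abs_div, abs_of_pos (hw k), le_div_iff₀ (hw k)]
    linarith [hw k]
  have hpow : ∀ k : ℕ, (0 : ℝ) < (1 / 2) ^ k := fun k => by positivity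
  have hlt : ∀ j k : ℕ, j < k → ((1 : ℝ) / 2) ^ k ≤ (1 / 2) ^ j / 2 := by
    intro j k h
    have : ((1 : ℝ) / 2) ^ k ≤ (1 / 2) ^ (j + 1) :=
      pow_le_pow_of_le_one (by norm_num) (by norm_num) h
    rw [pow_succ] at this
    linarith
  have hBk : ∀ k, B k ((1 / 2) ^ k) = 1 := fun k => by simp [B, ψ1]
  have hBne : ∀ j k, j ≠ k → ∀ s, 0 ≤ s → s ≤ w k → B j ((1 / 2) ^ k + s) = 0 := by
    intro j k hjk s hs hs'
    refine hB0 j _ ?_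
    have h1 := hw' j
    have h2 := hw' k
    have h3 := hpow j
    have h4 := hpow k
    rcases lt_or_gt_of_ne hjk with h | h
    · have := hlt j k h
      rw [abs_of_nonpos (by linarith)]
      linarith
    · have := hlt k j h
      rw [abs_of_nonneg (by linarith)]
      linarith
  have hBw : ∀ j k, B j ((1 / 2) ^ k + w k) = 0 := by
    intro j k
    rcases eq_or_ne j k with rfl | h
    · refine hB0 j _ ?_
      rw [add_sub_cancel_left, abs_of_pos (hw j)]
    · exact hBne j k h _ (hw k).le le_rfl
  -- The bumps may become arbitrarily steep as `k` grows. Smoothness survives because near a given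
  -- point `χ k = 1` for all large `k`, so only finitely many terms are nonzero there, for all `r`
  -- at once.
  refine ⟨fun r x => 1 - ∑' k, B k r * (1 - χ k x), fun r x => ?_, fun k x => ?_, fun k x => ?_,
    fun x => ?_⟩
  · obtain ⟨k₀, hk₀⟩ := hone x
    have h1 : ContDiffAt ℝ ∞ (fun z : ℝ × Euc n => 1 - ∑ k ∈ Finset.range k₀,
        B k z.1 * (1 - χ k ((ch (Euc n) x).symm z.2))) (r, ch (Euc n) x x) := by
      refine contDiffAt_const.sub (ContDiffAt.sum fun k _ => ?_)
      refine ((hB k).contDiffAt.comp _ contDiffAt_fst).mul (contDiffAt_const.sub ?_)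
      exact ContDiffAt.comp (g := fun y => χ k ((ch (Euc n) x).symm y))
        (f := fun z : ℝ × Euc n => z.2) (r, ch (Euc n) x x)
        (contDiffAt_inChart_of_contMDiff (hχ k) x) contDiffAt_snd
    refine h1.congr_of_eventuallyEq ?_
    have h2 := (continuous_snd.tendsto (r, ch (Euc n) x x)).eventually
      (eventually_ch_symm (Euc n) (mem_ch_source _ x) hk₀)
    filter_upwards [h2] with z hz
    rw [tsum_eq_sum]
    intro k hk
    rw [hz k (by simpa using hk)]
    simp
  · beta_reduce
    rw [tsum_eq_single k (fun j hj => by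
      have := hBne j k hj 0 le_rfl (hw k).le
      rw [add_zero] at this
      rw [this, zero_mul]), hBk]
    ring
  · beta_reduce
    simp only [hBw, zero_mul, tsum_zero, sub_zero]
  · have : ∀ k, B k 0 = 0 := fun k => hB0 k 0 (by
      rw [zero_sub, abs_neg, abs_of_pos (hpow k)]
      linarith [hw' k, hpow k])
    simp [this]

/-- A field-dependent vector field cannot distinguish, along a convergent sequence, between a
variation and its cut-offs. -/
theorem IsSmoothGen.exists_eq_cutoff {ζ : (M → W) → VField n M} (hζ : IsSmoothGen T ζ)
    {φ Y : M → W} (hφ : φ ∈ FieldSpace T) (hY : SmoothField T Y) {χ : ℕ → M → ℝ}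
    (hχ : ∀ k, ContMDiff 𝓘(ℝ, Euc n) 𝓘(ℝ, ℝ) ∞ (χ k))
    (hone : ∀ x, ∃ k₀, ∀ᶠ y in 𝓝 x, ∀ k ≥ k₀, χ k y = 1) {t : ℕ → ℝ} {y : ℕ → M} {x₀ : M}
    (ht : Filter.Tendsto t Filter.atTop (𝓝 0)) (hy : Filter.Tendsto y Filter.atTop (𝓝 x₀)) :
    ∃ k, ζ (φ + t k • Y) (y k) = ζ (φ + t k • fun x => χ k x • Y x) (y k) := by
  by_contra hne
  push Not at hne
  have hx₀ := mem_ch_source (Euc n) x₀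
  let G : (M → W) → M → Euc n := fun Φ p =>
    fieldInChart (vecType n) x₀ (ζ Φ) (ch (Euc n) x₀ p)
  let d : ℕ → ℝ := fun k => ‖G (φ + t k • Y) (y k) - G (φ + t k • fun x => χ k x • Y x) (y k)‖
  have hsrc : ∀ᶠ k in Filter.atTop, y k ∈ (ch (Euc n) x₀).source :=
    hy.eventually (ch_source_mem_nhds (Euc n) hx₀)
  have hd : ∀ᶠ k in Filter.atTop, 0 < d k := by
    filter_upwards [hsrc] with k hk
    refine norm_pos_iff.2 (sub_ne_zero.2 fun h => hne k ?_)
    simp only [G, fieldInChart_ch (vecType n) hk] at h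
    exact (actEquiv (vecType n) (tcUnit (Euc n) (mem_ch_source _ (y k)) hk)).injective h
  -- The gap is at most `d k / (k + 1)`: two parameters at distance `w k` will have values of `ζ` at
  -- distance `d k`, too far for any Lipschitz constant. The other branch covers the `k` for which
  -- positivity of `d k` is not available, for instance while `y k` is outside the chart.
  let w : ℕ → ℝ := fun k => if 0 < d k then min ((1 / 2) ^ k / 8) (d k / (k + 1)) else
    (1 / 2) ^ k / 8
  have hw : ∀ k, 0 < w k := by
    intro k
    simp only [w]
    split_ifs with h
    · exact lt_min (by positivity) (by positivity)
    · positivity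
  have hw' : ∀ k, w k ≤ (1 / 2) ^ k / 8 := by
    intro k
    simp only [w]
    split_ifs with h
    · exact min_le_left _ _
    · exact le_rfl
  obtain ⟨κ, hκs, hκ1, hκ2, hκ0⟩ := exists_interpolation hχ hone hw hw'
  -- One smooth two-parameter family through `φ` containing, at `(t k, 2⁻ᵏ)`, the cut-off variation
  -- and, at `(t k, 2⁻ᵏ + w k)`, the full one.
  let Φ : ℝ × ℝ → M → W := fun q x => φ x + (q.1 * κ q.2 x) • Y x
  have hΦ : ∀ q x, SmoothFam T Φ q x := by
    intro q x
    refine SmoothFam.add (hφ.1.fam q x) (SmoothFam.smul (a := fun q x => q.1 * κ q.2 x)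
      (hY.fam q x) ?_)
    refine ContDiffAt.mul (contDiffAt_fst.comp _ contDiffAt_fst) ?_
    exact ContDiffAt.comp (g := fun z : ℝ × Euc n => κ z.1 ((ch (Euc n) x).symm z.2))
      (f := fun z : (ℝ × ℝ) × Euc n => (z.1.2, z.2)) (q, ch (Euc n) x x) (hκs q.2 x)
      ((contDiffAt_snd.comp _ contDiffAt_fst).prodMk contDiffAt_snd)
  have hΦ0 : Φ (0, 0) = φ := by funext x; simp [Φ]
  have hsm : ContDiffAt ℝ ∞ (fun z : (ℝ × ℝ) × Euc n =>
      fieldInChart (vecType n) x₀ (ζ (Φ z.1)) z.2) ((0, 0), ch (Euc n) x₀ x₀) :=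
    hζ.smoothFam hΦ (q := (0, 0)) (by rw [hΦ0]; exact hφ) x₀
  -- A `C¹` map is Lipschitz near the limit point `((0, 0), x₀)`, to which both sequences of
  -- parameters converge.
  obtain ⟨C, s, hs, hC⟩ := (hsm.of_le (m := 1) (by simp)).exists_lipschitzOnWith
  have hpow : Filter.Tendsto (fun k : ℕ => ((1 : ℝ) / 2) ^ k) Filter.atTop (𝓝 0) :=
    tendsto_pow_atTop_nhds_zero_of_lt_one (by norm_num) (by norm_num)
  have hwt : Filter.Tendsto w Filter.atTop (𝓝 0) := by
    refine squeeze_zero (fun k => (hw k).le) (fun k => (hw' k).trans ?_) hpow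
    have : (0 : ℝ) < (1 / 2) ^ k := by positivity
    linarith
  have hyc : Filter.Tendsto (fun k => ch (Euc n) x₀ (y k)) Filter.atTop
      (𝓝 (ch (Euc n) x₀ x₀)) := (continuousAt_ch (Euc n) hx₀).tendsto.comp hy
  have hz1 : Filter.Tendsto (fun k => ((t k, ((1 : ℝ) / 2) ^ k), ch (Euc n) x₀ (y k)))
      Filter.atTop (𝓝 ((0, 0), ch (Euc n) x₀ x₀)) :=
    (ht.prodMk_nhds hpow).prodMk_nhds hyc
  have hz2 : Filter.Tendsto (fun k => ((t k, ((1 : ℝ) / 2) ^ k + w k), ch (Euc n) x₀ (y k)))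
      Filter.atTop (𝓝 ((0, 0), ch (Euc n) x₀ x₀)) := by
    refine (ht.prodMk_nhds ?_).prodMk_nhds hyc
    simpa using hpow.add hwt
  have hk : ∀ᶠ k : ℕ in Filter.atTop, (C : ℝ) < k + 1 := by
    filter_upwards [Filter.eventually_gt_atTop (Nat.ceil (C : ℝ))] with k hk
    have := Nat.le_ceil (C : ℝ)
    have h2 : ((Nat.ceil (C : ℝ) : ℕ) : ℝ) < k := by exact_mod_cast hk
    linarith
  obtain ⟨k, hk1, hk2, hk3, hk4⟩ :=
    (hd.and (hk.and ((hz1.eventually hs).and (hz2.eventually hs)))).exists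
  have e1 : Φ (t k, (1 / 2) ^ k) = φ + t k • fun x => χ k x • Y x := by
    funext x; simp only [Φ, hκ1]; simp [mul_smul]
  have e2 : Φ (t k, (1 / 2) ^ k + w k) = φ + t k • Y := by
    funext x; simp only [Φ, hκ2]; simp
  have h1 := hC.dist_le_mul _ hk4 _ hk3
  rw [dist_eq_norm] at h1
  simp only [e1, e2] at h1
  have h2 : dist ((t k, ((1 : ℝ) / 2) ^ k + w k), ch (Euc n) x₀ (y k))
      ((t k, ((1 : ℝ) / 2) ^ k), ch (Euc n) x₀ (y k)) = w k := by
    rw [Prod.dist_eq, Prod.dist_eq]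
    simp only [dist_self]
    rw [Real.dist_eq, add_sub_cancel_left, abs_of_pos (hw k)]
    simp [(hw k).le]
  rw [h2] at h1
  have h3 : w k ≤ d k / (k + 1) := by
    simp only [w, if_pos hk1]; exact min_le_right _ _
  have h4 : d k ≤ C * (d k / (k + 1)) := h1.trans (by gcongr)
  have h5 : (C : ℝ) * (d k / (k + 1)) < d k := by
    rw [mul_div_assoc', div_lt_iff₀ (by positivity), mul_comm]
    exact mul_lt_mul_of_pos_left hk2 hk1
  linarith

/-- The admissible values form an open set, and the compact set on which the variation lives makes
the bound on `t` uniform. For a variation without compact support there may be no such bound. -/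
theorem eventually_mem_fieldSpace {φ Y : M → W} (hφ : φ ∈ FieldSpace T) (hY : SmoothField T Y)
    {C : Set M} (hC : IsCompact C) (hYC : ∀ x ∉ C, Y x = 0) :
    ∀ᶠ t : ℝ in 𝓝 0, φ + t • Y ∈ FieldSpace T := by
  have h1 : ∀ᶠ t : ℝ in 𝓝 0, ∀ x ∈ C, φ x + t • Y x ∈ T.values := by
    refine hC.eventually_forall_of_forall_eventually fun x _ => ?_
    have hx := mem_ch_source (Euc n) x
    have hc : ContinuousAt (fun z : ℝ × Euc n => fieldInChart T x (φ + z.1 • Y) z.2)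
        (0, ch (Euc n) x x) := (smoothFam_line hφ.1 hY 0 x).continuousAt
    have hv : T.values ∈ 𝓝 (fieldInChart T x (φ + (0 : ℝ) • Y) (ch (Euc n) x x)) := by
      rw [fieldInChart_self]
      exact T.isOpen_values.mem_nhds (by simpa using hφ.2 x)
    have h2 : Filter.Tendsto (fun z : ℝ × M => (z.1, ch (Euc n) x z.2)) (𝓝 (0, x))
        (𝓝 ((0 : ℝ), ch (Euc n) x x)) := by
      rw [nhds_prod_eq, nhds_prod_eq]
      exact Filter.tendsto_id.prodMap (continuousAt_ch (Euc n) hx)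
    filter_upwards [h2.eventually (hc.eventually hv),
      (continuous_snd.tendsto ((0 : ℝ), x)).eventually (ch_source_mem_nhds (Euc n) hx)] with z hz hs
    have hs : z.2 ∈ (ch (Euc n) x).source := hs
    have hz : fieldInChart T x (φ + z.1 • Y) (ch (Euc n) x z.2) ∈ T.values := hz
    have e := fieldInChart_change (T := T) (mem_ch_source (Euc n) z.2) hs (φ + z.1 • Y)
    rw [fieldInChart_self] at e
    change (φ + z.1 • Y) z.2 ∈ T.values
    rw [e]
    exact T.act_values _ (isUnit_tc (Euc n) hs (mem_ch_source _ _)) _ hz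
  filter_upwards [h1] with t ht
  refine ⟨hφ.1.add (hY.smul t), fun x => ?_⟩
  by_cases hx : x ∈ C
  · exact ht x hx
  · simpa [hYC x hx] using hφ.2 x

/-- A smooth bounded reparametrization equal to the identity near `0`. -/
theorem exists_squash {ε : ℝ} (hε : 0 < ε) :
    ∃ s : ℝ → ℝ, ContDiff ℝ ∞ s ∧ (∀ᶠ t in 𝓝 0, s t = t) ∧ ∀ t, |s t| < ε := by
  let b : ContDiffBump (0 : ℝ) := ⟨ε / 4, ε / 2, by positivity, by linarith⟩
  refine ⟨fun t => b t * t, b.contDiff.mul contDiff_id, ?_, fun t => ?_⟩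
  · filter_upwards [b.eventuallyEq_one] with t ht
    rw [ht]; simp
  · by_cases h : |t| < ε / 2
    · rw [abs_mul, abs_of_nonneg b.nonneg]
      calc b t * |t| ≤ 1 * |t| := mul_le_mul_of_nonneg_right b.le_one (abs_nonneg t)
        _ < ε := by linarith
    · have : b t = 0 := b.zero_of_le_dist (by
        rw [Real.dist_eq, sub_zero]; exact not_lt.1 h)
      simpa [this] using hε

/-- Near a compact set, a field-dependent vector field along a line `φ + t Y` is given by a family
of admissible fields. -/
theorem IsSmoothGen.exists_localization [T2Space M] [SecondCountableTopology M]
    {ζ : (M → W) → VField n M} (hζ : IsSmoothGen T ζ) {φ Y : M → W} (hφ : φ ∈ FieldSpace T)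
    (hY : SmoothField T Y) {K : Set M} (hK : IsCompact K) :
    ∃ (Φ : ℝ → M → W) (V : Set M), IsOpen V ∧ K ⊆ V ∧ (∀ t x, SmoothFam T Φ t x) ∧
      (∀ t, Φ t ∈ FieldSpace T) ∧ Φ 0 = φ ∧
      ∀ᶠ t in 𝓝 0, ∀ x ∈ V, Φ t x = φ x + t • Y x ∧ ζ (Φ t) x = ζ (φ + t • Y) x := by
  have : LocallyCompactSpace M := Manifold.locallyCompact_of_finiteDimensional 𝓘(ℝ, Euc n)
  obtain ⟨K', hK', hKK'⟩ := exists_compact_superset hK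
  let E := CompactExhaustion.choice M
  obtain ⟨k₁, hk₁⟩ := E.exists_superset_of_isCompact hK'
  have hex : ∀ k, ∃ χ : M → ℝ, ContMDiff 𝓘(ℝ, Euc n) 𝓘(ℝ, ℝ) ∞ χ ∧
      (∀ x ∈ E (k + k₁), χ x = 1) ∧ ∀ x ∉ E (k + k₁ + 1), χ x = 0 := by
    intro k
    obtain ⟨g, h1, h0, -⟩ := exists_contMDiffMap_one_nhds_of_subset_interior (n := ⊤)
      𝓘(ℝ, Euc n) (E.isCompact (k + k₁)).isClosed (E.subset_interior_succ (k + k₁))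
    exact ⟨g, g.contMDiff, fun x hx => h1.self_of_nhdsSet x hx, h0⟩
  choose χ hχ hχ1 hχ0 using hex
  have hone : ∀ x, ∃ k₀, ∀ᶠ y in 𝓝 x, ∀ k ≥ k₀, χ k y = 1 := by
    intro x
    obtain ⟨j, hj⟩ := E.exists_mem_nhds x
    refine ⟨j, ?_⟩
    filter_upwards [hj] with y hy k hk
    exact hχ1 k y (E.subset (by omega) hy)
  -- If no cut-off worked, then for each `k` there would be a bad parameter below `1 / (k + 1)` and
  -- a bad point of `K'`. A convergent subsequence of these points contradicts `exists_eq_cutoff`.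
  have key : ∃ k, ∃ ε > 0, ∀ t : ℝ, |t| < ε → ∀ x ∈ K',
      ζ (φ + t • Y) x = ζ (φ + t • fun x => χ k x • Y x) x := by
    by_contra hcon
    push Not at hcon
    choose t ht y hy hne using fun k : ℕ => hcon k (1 / ((k : ℝ) + 1)) (by positivity)
    obtain ⟨x₀, -, s, hs, hys⟩ := hK'.tendsto_subseq hy
    have htt : Filter.Tendsto t Filter.atTop (𝓝 0) :=
      squeeze_zero_norm (fun k => (ht k).le) tendsto_one_div_add_atTop_nhds_zero_nat
    obtain ⟨i, hi⟩ := hζ.exists_eq_cutoff hφ hY (χ := fun i => χ (s i)) (fun i => hχ _)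
      (fun x => by
        obtain ⟨k₀, hk₀⟩ := hone x
        refine ⟨k₀, hk₀.mono fun y hy k hk => hy _ (hk.trans (hs.le_apply))⟩)
      (htt.comp hs.tendsto_atTop) hys
    exact hne (s i) hi
  obtain ⟨k, ε, hε, hk⟩ := key
  let Y' : M → W := fun x => χ k x • Y x
  have hY' : SmoothField T Y' := SmoothField.of_fam (q := (0 : ℝ)) fun x =>
    (hY.fam 0 x).smul (a := fun _ => χ k)
      (ContDiffAt.comp (g := fun y => χ k ((ch (Euc n) x).symm y))
        (f := fun z : ℝ × Euc n => z.2) (0, ch (Euc n) x x)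
        (contDiffAt_inChart_of_contMDiff (hχ k) x) contDiffAt_snd)
  have hev := eventually_mem_fieldSpace hφ hY' (E.isCompact (k + k₁ + 1))
    (fun x hx => by simp [Y', hχ0 k x hx])
  obtain ⟨δ, hδ, hev⟩ := Metric.eventually_nhds_iff_ball.1 hev
  -- The bounded reparametrization makes the truncated line admissible for every `t`, as
  -- `LocalLin.hasDerivAt` requires.
  obtain ⟨s, hs1, hs2, hs3⟩ := exists_squash hδ
  have hs0 : s 0 = 0 := hs2.self_of_nhds
  refine ⟨fun t => φ + s t • Y', interior K', isOpen_interior, hKK', fun t x => ?_, fun t => ?_,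
    by simp [hs0], ?_⟩
  · exact (smoothFam_line hφ.1 hY' (s t) x).comp (τ := s) hs1.contDiffAt
  · exact hev (s t) (by rw [mem_ball_zero_iff]; exact hs3 t)
  · filter_upwards [hs2, Metric.ball_mem_nhds (0 : ℝ) hε] with t ht htε x hx
    have hx' := interior_subset hx
    rw [mem_ball_zero_iff] at htε
    refine ⟨?_, ?_⟩
    · have : χ k x = 1 := hχ1 k x (E.subset (by omega) (hk₁ hx'))
      simp [ht, Y', this]
    · rw [ht]
      exact (hk t htε x hx').symm

end Localization

end CovPhase

namespace CovPhase

/-! ### Calculus on the space of fields -/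

section FieldCalculus

variable {n l k : ℕ} {W : Type*} [NormedAddCommGroup W] [NormedSpace ℝ W] {T : TensorType n W}
  {V : Type*} [NormedAddCommGroup V] [NormedSpace ℝ V] {S : TensorType n V}
  {M : Type*} [TopologicalSpace M] [ChartedSpace (Euc n) M] [IsManifold 𝓘(ℝ, Euc n) ∞ M]
  {X : Type*} [TopologicalSpace X] [ChartedSpace (Euc l) X] [IsManifold 𝓘(ℝ, Euc l) ∞ X]
  {f : X → M}

theorem add_zero_smul_mem {φ ψ : M → W} (hφ : φ ∈ FieldSpace T) :
    φ + (0 : ℝ) • ψ ∈ FieldSpace T := by simpa using hφ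

theorem IsSmoothGen.smoothFam_line {ζ : (M → W) → VField n M} (hζ : IsSmoothGen T ζ)
    {φ Y : M → W} (hφ : φ ∈ FieldSpace T) (hY : SmoothField T Y) (x : M) :
    SmoothFam (vecType n) (fun t : ℝ => ζ (φ + t • Y)) 0 x :=
  hζ.smoothFam (CovPhase.smoothFam_line hφ.1 hY) (add_zero_smul_mem hφ) x

theorem SmoothFam.smoothField_deriv {Φ : ℝ → M → W} {t : ℝ} (h : ∀ x, SmoothFam T Φ t x) :
    SmoothField T (fun x => _root_.deriv (fun t => Φ t x) t) :=
  SmoothField.of_fam (Φ := fun t x => _root_.deriv (fun t => Φ t x) t) fun p => (h p).deriv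

theorem IsSmoothGen.smoothField_fieldDeriv {ζ : (M → W) → VField n M} (hζ : IsSmoothGen T ζ)
    {φ Y : M → W} (hφ : φ ∈ FieldSpace T) (hY : SmoothField T Y) :
    SmoothField (vecType n) (fieldDeriv ζ φ Y) :=
  SmoothFam.smoothField_deriv (hζ.smoothFam_line hφ hY)

theorem IsLocal0.smoothFam_line {A : (M → W) → DForm l k X} (hA : IsLocal0 T f A)
    {φ Y : M → W} (hφ : φ ∈ FieldSpace T) (hY : SmoothField T Y) (x : X) :
    SmoothFam (formType l k) (fun t : ℝ => A (φ + t • Y)) 0 x :=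
  hA.smoothFam (CovPhase.smoothFam_line hφ.1 hY) (add_zero_smul_mem hφ) x

theorem IsLocal0.smoothField_fieldDeriv {A : (M → W) → DForm l k X} (hA : IsLocal0 T f A)
    {φ Y : M → W} (hφ : φ ∈ FieldSpace T) (hY : SmoothField T Y) :
    SmoothField (formType l k) (fieldDeriv A φ Y) :=
  SmoothFam.smoothField_deriv (hA.smoothFam_line hφ hY)

theorem IsLocal0.hasDerivAt_line {A : (M → W) → DForm l k X} (hA : IsLocal0 T f A)
    {φ Y : M → W} (hφ : φ ∈ FieldSpace T) (hY : SmoothField T Y) (x : X) :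
    HasDerivAt (fun t : ℝ => A (φ + t • Y) x) (fieldDeriv A φ Y x) 0 :=
  (hA.smoothFam_line hφ hY x).hasDerivAt

theorem LocalLin.apply {A : (M → W) → (M → V) → DForm l k X} (hA : LocalLin T S f A) {ψ : M → V}
    (hψ : SmoothField S ψ) : IsLocal0 T f (fun φ => A φ ψ) where
  isLocal _ _ _ h := hA.isLocal _ _ ψ ψ _ h Filter.EventuallyEq.rfl
  isSmooth p φ hφ t₀ ht₀ x₀ := hA.isSmooth p φ (fun _ => ψ) hφ (fun t x => hψ.fam t x) t₀ ht₀ x₀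

theorem IsLocal0.add {A B : (M → W) → DForm l k X} (hA : IsLocal0 T f A) (hB : IsLocal0 T f B) :
    IsLocal0 T f (fun φ => A φ + B φ) where
  isLocal φ φ' x h := by
    simp only [Pi.add_apply, hA.isLocal φ φ' x h, hB.isLocal φ φ' x h]
  isSmooth p φ hφ t₀ ht₀ x₀ := smoothFormFamilyAt_iff.2
    ((smoothFormFamilyAt_iff.1 (hA.isSmooth p φ hφ t₀ ht₀ x₀)).add
      (smoothFormFamilyAt_iff.1 (hB.isSmooth p φ hφ t₀ ht₀ x₀)))

theorem SmoothFam.neg {P : Type*} [NormedAddCommGroup P] [NormedSpace ℝ P] {Φ : P → M → W} {q : P}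
    {p : M} (h : SmoothFam T Φ q p) : SmoothFam T (fun q => -Φ q) q p := by
  refine (h.smul (a := fun _ _ => (-1 : ℝ)) contDiffAt_const).congr
    (Filter.Eventually.of_forall fun z => ?_)
  simp

theorem IsLocal0.neg {A : (M → W) → DForm l k X} (hA : IsLocal0 T f A) :
    IsLocal0 T f (fun φ => -A φ) where
  isLocal φ φ' x h := by simp only [Pi.neg_apply, hA.isLocal φ φ' x h]
  isSmooth p φ hφ t₀ ht₀ x₀ := smoothFormFamilyAt_iff.2
    (smoothFormFamilyAt_iff.1 (hA.isSmooth p φ hφ t₀ ht₀ x₀)).neg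

theorem IsLocal0.sub {A B : (M → W) → DForm l k X} (hA : IsLocal0 T f A) (hB : IsLocal0 T f B) :
    IsLocal0 T f (fun φ => A φ - B φ) := by
  simpa only [sub_eq_add_neg] using hA.add hB.neg

theorem IsLocal0.eventuallyEq {A : (M → W) → DForm l k X} (hA : IsLocal0 T f A)
    (hf : Continuous f) {φ φ' : M → W} {x : X} (h : φ =ᶠ[𝓝 (f x)] φ') : A φ =ᶠ[𝓝 x] A φ' := by
  filter_upwards [hf.continuousAt.eventually (eventually_eventually_nhds.2 h)] with y hy
  exact hA.isLocal _ _ y hy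

theorem IsLocal0.dForm {A : (M → W) → DForm l k X} (hA : IsLocal0 T f A) (hf : Continuous f) :
    IsLocal0 T f (fun φ => dForm (A φ)) where
  isLocal φ φ' x h := dForm_congr (hA.eventuallyEq hf h)
  isSmooth p φ hφ t₀ ht₀ x₀ := smoothFormFamilyAt_iff.2
    (smoothFormFamilyAt_iff.1 (hA.isSmooth p φ hφ t₀ ht₀ x₀)).dForm

theorem IsLocal0.pullForm {A : (M → W) → DForm n k M} (hA : IsLocal0 T id A)
    (hf : ContMDiff 𝓘(ℝ, Euc l) 𝓘(ℝ, Euc n) ∞ f) :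
    IsLocal0 T f (fun φ => pullForm (m := l) f (A φ)) where
  isLocal φ φ' x h := by
    simp only [CovPhase.pullForm]
    rw [hA.isLocal φ φ' (f x) h]
  isSmooth p φ hφ t₀ ht₀ x₀ := smoothFormFamilyAt_iff.2
    ((smoothFormFamilyAt_iff.1 (hA.isSmooth p φ hφ t₀ ht₀ (f x₀))).pullForm hf)

theorem fieldDeriv_add {A B : (M → W) → DForm l k X} (hA : IsLocal0 T f A) (hB : IsLocal0 T f B)
    {φ Y : M → W} (hφ : φ ∈ FieldSpace T) (hY : SmoothField T Y) :
    fieldDeriv (fun φ => A φ + B φ) φ Y = fieldDeriv A φ Y + fieldDeriv B φ Y := by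
  funext x
  exact ((hA.hasDerivAt_line hφ hY x).add (hB.hasDerivAt_line hφ hY x)).deriv

theorem fieldDeriv_sub {A B : (M → W) → DForm l k X} (hA : IsLocal0 T f A) (hB : IsLocal0 T f B)
    {φ Y : M → W} (hφ : φ ∈ FieldSpace T) (hY : SmoothField T Y) :
    fieldDeriv (fun φ => A φ - B φ) φ Y = fieldDeriv A φ Y - fieldDeriv B φ Y := by
  funext x
  exact ((hA.hasDerivAt_line hφ hY x).sub (hB.hasDerivAt_line hφ hY x)).deriv

theorem fieldDeriv_neg {A : (M → W) → DForm l k X} (hA : IsLocal0 T f A)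
    {φ Y : M → W} (hφ : φ ∈ FieldSpace T) (hY : SmoothField T Y) :
    fieldDeriv (fun φ => -A φ) φ Y = -fieldDeriv A φ Y := by
  funext x
  exact (hA.hasDerivAt_line hφ hY x).neg.deriv

theorem fieldDeriv_dForm {A : (M → W) → DForm l k X} (hA : IsLocal0 T f A)
    {φ Y : M → W} (hφ : φ ∈ FieldSpace T) (hY : SmoothField T Y) :
    fieldDeriv (fun φ => dForm (A φ)) φ Y = dForm (fieldDeriv A φ Y) := by
  funext x
  exact (hasDerivAt_dForm (hA.smoothFam_line hφ hY x)).deriv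

theorem fieldDeriv_pullForm {A : (M → W) → DForm n k M} (hA : IsLocal0 T id A)
    {φ Y : M → W} (hφ : φ ∈ FieldSpace T) (hY : SmoothField T Y) :
    fieldDeriv (fun φ => pullForm (m := l) f (A φ)) φ Y = pullForm f (fieldDeriv A φ Y) := by
  funext x
  exact (hasDerivAt_pullForm (hA.hasDerivAt_line hφ hY (f x))).deriv

theorem IsLocal1.sub {A B : (M → W) → (M → W) → DForm l k X} (hA : IsLocal1 T f A)
    (hB : IsLocal1 T f B) : IsLocal1 T f (fun φ ψ => A φ ψ - B φ ψ) where
  isLocal φ φ' ψ ψ' x h h' := by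
    simp only [Pi.sub_apply, hA.isLocal φ φ' ψ ψ' x h h', hB.isLocal φ φ' ψ ψ' x h h']
  add φ hφ ψ ψ' hψ hψ' := by
    rw [hA.add φ hφ ψ ψ' hψ hψ', hB.add φ hφ ψ ψ' hψ hψ']; abel
  smul φ hφ a ψ hψ := by
    rw [hA.smul φ hφ a ψ hψ, hB.smul φ hφ a ψ hψ, smul_sub]
  isSmooth p φ ψ hφ hψ t₀ ht₀ x₀ := smoothFormFamilyAt_iff.2 (by
    simpa only [sub_eq_add_neg] using
    (smoothFormFamilyAt_iff.1 (hA.isSmooth p φ ψ hφ hψ t₀ ht₀ x₀)).add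
      (smoothFormFamilyAt_iff.1 (hB.isSmooth p φ ψ hφ hψ t₀ ht₀ x₀)).neg)

theorem IsLocal1.dForm {A : (M → W) → (M → W) → DForm l k X} (hA : IsLocal1 T f A)
    (hf : Continuous f) : IsLocal1 T f (fun φ ψ => dForm (A φ ψ)) where
  isLocal φ φ' ψ ψ' x h h' := dForm_congr (by
    filter_upwards [hf.continuousAt.eventually (eventually_eventually_nhds.2 h),
      hf.continuousAt.eventually (eventually_eventually_nhds.2 h')] with y hy hy'
    exact hA.isLocal _ _ _ _ y hy hy')
  add φ hφ ψ ψ' hψ hψ' := by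
    rw [hA.add φ hφ ψ ψ' hψ hψ', dForm_add (hA.localLin.smoothField hφ hψ)
      (hA.localLin.smoothField hφ hψ')]
  smul φ hφ a ψ hψ := by rw [hA.smul φ hφ a ψ hψ, dForm_smul]
  isSmooth p φ ψ hφ hψ t₀ ht₀ x₀ := smoothFormFamilyAt_iff.2
    (smoothFormFamilyAt_iff.1 (hA.isSmooth p φ ψ hφ hψ t₀ ht₀ x₀)).dForm

theorem hasDerivAt_hat {ζ : (M → W) → VField n M} (hζ : IsSmoothGen T ζ) {φ Y : M → W}
    (hφ : φ ∈ FieldSpace T) (hY : SmoothField T Y) (x : M) :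
    HasDerivAt (fun t : ℝ => hat T ζ (φ + t • Y) x)
      (lieField T (fieldDeriv ζ φ Y) φ x + lieField T (ζ φ) Y x) 0 := by
  have h := hasDerivAt_lieField (hζ.smoothFam_line hφ hY x) (smoothFam_line hφ.1 hY 0 x)
  have e : (fun x => deriv (fun t : ℝ => (φ + t • Y) x) 0) = Y := by
    funext x
    have : HasDerivAt (fun t : ℝ => (φ + t • Y) x) ((1 : ℝ) • Y x) 0 :=
      ((hasDerivAt_id (0 : ℝ)).smul_const (Y x)).const_add (φ x)
    rw [this.deriv, one_smul]
  rw [e] at h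
  simp only [zero_smul, add_zero] at h
  exact h

theorem fieldDeriv_hat {ζ : (M → W) → VField n M} (hζ : IsSmoothGen T ζ) {φ Y : M → W}
    (hφ : φ ∈ FieldSpace T) (hY : SmoothField T Y) :
    fieldDeriv (hat T ζ) φ Y = lieField T (fieldDeriv ζ φ Y) φ + lieField T (ζ φ) Y := by
  funext x
  exact (hasDerivAt_hat hζ hφ hY x).deriv

theorem IsSmoothGen.smoothField_hat {ζ : (M → W) → VField n M} (hζ : IsSmoothGen T ζ)
    {φ : M → W} (hφ : φ ∈ FieldSpace T) : SmoothField T (hat T ζ φ) :=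
  (hζ.smoothField hφ).lieField hφ.1

/-- Partial derivatives along field space commute. -/
theorem fieldDeriv_comm {A : (M → W) → DForm l k X} (hA : IsLocal0 T f A)
    {φ ψ₁ ψ₂ : M → W} (hφ : φ ∈ FieldSpace T) (h₁ : SmoothField T ψ₁) (h₂ : SmoothField T ψ₂) :
    fieldDeriv (fun φ' => fieldDeriv A φ' ψ₂) φ ψ₁ =
      fieldDeriv (fun φ' => fieldDeriv A φ' ψ₁) φ ψ₂ := by
  funext x
  let g := fun z : ℝ × ℝ => A (φ + z.2 • ψ₁ + z.1 • ψ₂) x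
  have hs : SmoothFam (formType l k) (fun z : ℝ × ℝ => A (φ + z.2 • ψ₁ + z.1 • ψ₂)) (0, 0) x :=
    hA.smoothFam (Φ := fun z : ℝ × ℝ => φ + z.2 • ψ₁ + z.1 • ψ₂)
      (fun z x => smoothFam_add_smul (P := ℝ) (Φ := fun t => φ + t • ψ₁) (Ψ := fun _ => ψ₂)
        (smoothFam_line hφ.1 h₁) (fun q x => h₂.fam q x) z x) (by simpa using hφ) x
  have hg : ContDiffAt ℝ ∞ g (0, 0) := hs.contDiffAt
  have h := hasDerivAt_fderiv_swap hg
  have hsw : HasDerivAt (fun s : ℝ => fderiv ℝ (fun y => g (s, y)) 0 1)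
      (fderiv ℝ (fun y => deriv (fun t => g (t, y)) 0) 0 1) 0 := by
    have := ((ContinuousLinearMap.apply ℝ _ (1 : ℝ)).hasFDerivAt.comp_hasDerivAt (0 : ℝ) h)
    exact this
  have e1 : fieldDeriv (fun φ' => fieldDeriv A φ' ψ₂) φ ψ₁ x =
      deriv (fun y => deriv (fun t => g (t, y)) 0) 0 := rfl
  have e2 : fieldDeriv (fun φ' => fieldDeriv A φ' ψ₁) φ ψ₂ x =
      deriv (fun s => deriv (fun y => g (s, y)) 0) 0 := by
    refine congrArg (fun g => deriv g (0 : ℝ)) (funext fun s =>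
      congrArg (fun g => deriv g (0 : ℝ)) (funext fun t => ?_))
    simp only [g]
    rw [add_right_comm]
  rw [e1, e2]
  exact hsw.deriv.symm

/-- The identity `δδ = 0` on functionals, from the symmetry of second derivatives of a two-parameter
family. -/
theorem delta1_delta0 {A : (M → W) → DForm l k X} (hA : IsLocal0 T f A)
    {φ ψ₁ ψ₂ : M → W} (hφ : φ ∈ FieldSpace T) (h₁ : SmoothField T ψ₁) (h₂ : SmoothField T ψ₂) :
    delta1 (delta0 A) φ ψ₁ ψ₂ = 0 := by
  unfold delta1 delta0
  rw [fieldDeriv_comm hA hφ h₁ h₂, sub_self]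

end FieldCalculus

/-! ### Total derivatives along lines of fields -/

section Total

variable {n l k : ℕ} {W : Type*} [NormedAddCommGroup W] [NormedSpace ℝ W] {T : TensorType n W}
  {V : Type*} [NormedAddCommGroup V] [NormedSpace ℝ V] [FiniteDimensional ℝ V] {S : TensorType n V}
  {M : Type*} [TopologicalSpace M] [ChartedSpace (Euc n) M] [IsManifold 𝓘(ℝ, Euc n) ∞ M]
  [T2Space M] [SecondCountableTopology M]
  {X : Type*} [TopologicalSpace X] [ChartedSpace (Euc l) X] [IsManifold 𝓘(ℝ, Euc l) ∞ X]
  {f : X → M}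

/-- The derivative of a local functional only depends on its values at admissible fields. -/
theorem fieldDeriv_congr {A B : (M → W) → DForm l k X} (hA : IsLocal0 T f A)
    (hB : IsLocal0 T f B) (h : ∀ φ ∈ FieldSpace T, A φ = B φ) {φ Y : M → W}
    (hφ : φ ∈ FieldSpace T) (hY : SmoothField T Y) : fieldDeriv A φ Y = fieldDeriv B φ Y := by
  funext x
  -- The generator is the zero field: only the admissible family that agrees with the line near `f
  -- x` is wanted.
  obtain ⟨Φ, V, hV, hxV, -, hF, -, hev⟩ := (isSmoothGen_const (T := T) (n := n)
    (smoothField_zero (M := M))).exists_localization hφ hY (isCompact_singleton (x := f x))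
  refine Filter.EventuallyEq.deriv_eq ?_
  filter_upwards [hev] with t ht
  have e : Φ t =ᶠ[𝓝 (f x)] φ + t • Y := by
    filter_upwards [hV.mem_nhds (hxV rfl)] with y hy
    exact (ht y hy).1
  rw [← hA.isLocal _ _ x e, ← hB.isLocal _ _ x e, h _ (hF t)]

/-- Total derivative of a local operator applied to a field depending on the fields through a
field-dependent vector field. -/
theorem LocalLin.hasDerivAt_line {A : (M → W) → (M → V) → DForm l k X} (hA : LocalLin T S f A)
    {ζ : (M → W) → VField n M} (hζ : IsSmoothGen T ζ) {Ψ : (M → W) → M → V}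
    (hΨ : ∀ Φ : ℝ → M → W, (∀ t x, SmoothFam T Φ t x) → (∀ t, Φ t ∈ FieldSpace T) →
      ∀ t x, SmoothFam S (fun t => Ψ (Φ t)) t x)
    (hloc : ∀ φ φ' x, φ =ᶠ[𝓝 x] φ' → ζ φ =ᶠ[𝓝 x] ζ φ' → Ψ φ x = Ψ φ' x)
    {φ Y : M → W} (hφ : φ ∈ FieldSpace T) (hY : SmoothField T Y) (x : X) :
    HasDerivAt (fun t : ℝ => A (φ + t • Y) (Ψ (φ + t • Y)) x)
      (fieldDeriv (fun φ' => A φ' (Ψ φ)) φ Y x + A φ (fieldDeriv Ψ φ Y) x) 0 := by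
  -- Linearity of `A` is available at admissible fields only, so the line is exchanged for an
  -- admissible family with the same germ at `f x`, on which `ζ` takes the same values.
  obtain ⟨Φ, U, hU, hxU, hs, hF, h0, hev⟩ :=
    hζ.exists_localization hφ hY (isCompact_singleton (x := f x))
  have hxU : U ∈ 𝓝 (f x) := hU.mem_nhds (hxU rfl)
  have eΨ : ∀ᶠ t : ℝ in 𝓝 0, ∀ y ∈ U, Ψ (Φ t) y = Ψ (φ + t • Y) y := by
    filter_upwards [hev] with t ht y hy
    refine hloc _ _ _ ?_ ?_
    · filter_upwards [hU.mem_nhds hy] with z hz using (ht z hz).1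
    · filter_upwards [hU.mem_nhds hy] with z hz using (ht z hz).2
  have eΦ : ∀ᶠ t : ℝ in 𝓝 0, Φ t =ᶠ[𝓝 (f x)] φ + t • Y := by
    filter_upwards [hev] with t ht
    filter_upwards [hxU] with z hz using (ht z hz).1
  have h := hA.hasDerivAt hs (hΨ Φ hs hF) hF x
  rw [h0] at h
  have e1 : deriv (fun t => A (Φ t) (Ψ φ) x) 0 = fieldDeriv (fun φ' => A φ' (Ψ φ)) φ Y x := by
    refine Filter.EventuallyEq.deriv_eq ?_
    filter_upwards [eΦ] with t ht
    exact hA.isLocal _ _ _ _ x ht Filter.EventuallyEq.rfl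
  have e2 : A φ (fun y => deriv (fun t => Ψ (Φ t) y) 0) x = A φ (fieldDeriv Ψ φ Y) x := by
    refine hA.isLocal _ _ _ _ x Filter.EventuallyEq.rfl ?_
    filter_upwards [hxU] with y hy
    refine Filter.EventuallyEq.deriv_eq ?_
    filter_upwards [eΨ] with t ht using ht y hy
  rw [e1, e2] at h
  refine h.congr_of_eventuallyEq ?_
  filter_upwards [eΦ, eΨ] with t h1 h2
  refine (hA.isLocal _ _ _ _ x h1 ?_).symm
  filter_upwards [hxU] with y hy using h2 y hy

theorem IsLocal1.hasDerivAt_hat [FiniteDimensional ℝ W] {A : (M → W) → (M → W) → DForm l k X}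
    (hA : IsLocal1 T f A) {ζ : (M → W) → VField n M} (hζ : IsSmoothGen T ζ)
    {φ Y : M → W} (hφ : φ ∈ FieldSpace T) (hY : SmoothField T Y) (x : X) :
    HasDerivAt (fun t : ℝ => A (φ + t • Y) (hat T ζ (φ + t • Y)) x)
      (fieldDeriv (fun φ' => A φ' (hat T ζ φ)) φ Y x +
        (A φ (lieField T (fieldDeriv ζ φ Y) φ) x + A φ (lieField T (ζ φ) Y) x)) 0 := by
  have h := hA.localLin.hasDerivAt_line hζ (Ψ := hat T ζ)
    (fun _ hs hF t x => (hζ.smoothFam hs (hF t) x).lieField (hs t x))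
    (fun _ _ _ h h' => lieField_congr h' h) hφ hY x
  rwa [fieldDeriv_hat hζ hφ hY, hA.add φ hφ _ _
    ((hζ.smoothField_fieldDeriv hφ hY).lieField hφ.1) ((hζ.smoothField hφ).lieField hY)] at h

theorem IsLocalVec.hasDerivAt {A : (M → W) → VField n M → DForm n k M}
    (hA : IsLocalVec T A) {ζ : (M → W) → VField n M} (hζ : IsSmoothGen T ζ)
    {φ Y : M → W} (hφ : φ ∈ FieldSpace T) (hY : SmoothField T Y) (x : M) :
    HasDerivAt (fun t : ℝ => A (φ + t • Y) (ζ (φ + t • Y)) x)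
      (fieldDeriv (fun φ' => A φ' (ζ φ)) φ Y x + A φ (fieldDeriv ζ φ Y) x) 0 :=
  hA.localLin.hasDerivAt_line hζ (fun _ hs hF t x => hζ.smoothFam hs (hF t) x)
    (fun _ _ _ _ h' => h'.self_of_nhds) hφ hY x

/-- The anomaly of a local 1-form. -/
theorem anomaly1_eq [FiniteDimensional ℝ W] {A : (M → W) → (M → W) → DForm l (k + 1) X}
    (hA : IsLocal1 T f A) {ζ : (M → W) → VField n M} (hζ : IsSmoothGen T ζ)
    {φ ψ : M → W} (hφ : φ ∈ FieldSpace T) (hψ : SmoothField T ψ) (vX : VField l X) :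
    anomaly1 T A ζ φ vX ψ = fieldDeriv (fun φ' => A φ' ψ) φ (hat T ζ φ)
      + A φ (lieField T (ζ φ) ψ) - lieForm vX (A φ ψ) := by
  funext x
  -- The variation of `I_ζ̂ A` contains `A` on `£_{δζ} φ`, which the last term of the anomaly
  -- removes. Thus the anomaly sees only the value of `ζ` at `φ`.
  have h : fieldDeriv (fun φ' => A φ' (hat T ζ φ')) φ ψ x = _ :=
    (hA.hasDerivAt_hat hζ hφ hψ x).deriv
  simp only [anomaly1, fieldLie1, delta1, delta0, Pi.add_apply, Pi.sub_apply, h]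
  abel

end Total

end CovPhase

namespace CovPhase

/-! ### Integration over chains -/

section Cubes

variable {n k : ℕ} {X : Type*} [TopologicalSpace X] [ChartedSpace (Euc n) X]

/-- Differential of a cube. -/
noncomputable abbrev SmoothCube.diff (σ : SmoothCube n k X) (s : Fin k → ℝ) :
    (Fin k → ℝ) →L[ℝ] Euc n :=
  mfderiv 𝓘(ℝ, Fin k → ℝ) 𝓘(ℝ, Euc n) σ.map s

/-- Pull-back of a form along a cube. -/
noncomputable def SmoothCube.pull {j : ℕ} (σ : SmoothCube n k X) (α : DForm n j X) :
    (Fin k → ℝ) → (Fin k → ℝ) [⋀^Fin j]→L[ℝ] ℝ := fun s =>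
  (α (σ.map s)).compContinuousLinearMap (σ.diff s)

theorem SmoothCube.integral_eq (σ : SmoothCube n k X) (α : DForm n k X) :
    σ.integral α = ∫ s in Icc (0 : Fin k → ℝ) 1, σ.pull α s (fun i => Pi.single i 1) := rfl

theorem SmoothCube.integral_congr (σ : SmoothCube n k X) {α β : DForm n k X}
    (h : ∀ s ∈ Icc (0 : Fin k → ℝ) 1, α (σ.map s) = β (σ.map s)) :
    σ.integral α = σ.integral β := by
  refine MeasureTheory.setIntegral_congr_fun measurableSet_Icc fun s hs => ?_
  simp only [h s hs]

variable [IsManifold 𝓘(ℝ, Euc n) ∞ X] {j : ℕ}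

/-- A cube read in a chart. -/
noncomputable abbrev SmoothCube.inChart (σ : SmoothCube n k X) (s₀ : Fin k → ℝ) :
    (Fin k → ℝ) → Euc n := ch (Euc n) (σ.map s₀) ∘ σ.map

theorem SmoothCube.contDiffAt_inChart (σ : SmoothCube n k X) (s₀ : Fin k → ℝ) :
    ContDiffAt ℝ ∞ (σ.inChart s₀) s₀ := by
  have h := (contMDiffAt_iff.1 (σ.smooth s₀)).2
  rw [ModelWithCorners.range_eq_univ, contDiffWithinAt_univ] at h
  exact h

theorem SmoothCube.fderiv_inChart (σ : SmoothCube n k X) {s₀ s : Fin k → ℝ}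
    (hs : σ.map s ∈ (ch (Euc n) (σ.map s₀)).source) :
    fderiv ℝ (σ.inChart s₀) s =
      (tc (Euc n) (σ.map s) (σ.map s₀) (σ.map s)).comp (σ.diff s) := by
  have h := fderiv_writtenInCharts (E' := Fin k → ℝ) (Euc n) (f := σ.map)
    (mem_ch_source (Fin k → ℝ) s) hs ((σ.smooth s).mdifferentiableAt (by simp))
  rw [tc_self (Fin k → ℝ) (mem_ch_source _ s)] at h
  exact h

theorem SmoothCube.pull_eq (σ : SmoothCube n k X) {s₀ s : Fin k → ℝ}
    (hs : σ.map s ∈ (ch (Euc n) (σ.map s₀)).source) (α : DForm n j X) :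
    σ.pull α s = (fieldInChart (formType n j) (σ.map s₀) α
      (σ.inChart s₀ s)).compContinuousLinearMap (fderiv ℝ (σ.inChart s₀) s) := by
  rw [σ.fderiv_inChart hs]
  simp only [SmoothCube.inChart, Function.comp_apply]
  rw [fieldInChart_formType_ch hs]
  ext w
  change α (σ.map s) (fun i => σ.diff s (w i)) =
    α (σ.map s) (fun i => (tc (Euc n) (σ.map s₀) (σ.map s) (σ.map s) *
      tc (Euc n) (σ.map s) (σ.map s₀) (σ.map s)) (σ.diff s (w i)))
  rw [tc_mul_tc (Euc n) (mem_ch_source _ _) hs (mem_ch_source _ _), tc_self _ (mem_ch_source _ _)]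
  rfl

theorem SmoothCube.eventually_pull_eq (σ : SmoothCube n k X) (s₀ : Fin k → ℝ) :
    ∀ᶠ s in 𝓝 s₀, ∀ α : DForm n j X,
      σ.pull α s = (fieldInChart (formType n j) (σ.map s₀) α
        (σ.inChart s₀ s)).compContinuousLinearMap (fderiv ℝ (σ.inChart s₀) s) := by
  filter_upwards [σ.smooth.continuous.continuousAt.eventually
    (ch_source_mem_nhds (Euc n) (mem_ch_source _ (σ.map s₀)))] with s hs α
  exact σ.pull_eq hs α

theorem SmoothFam.cubePull {P : Type*} [NormedAddCommGroup P] [NormedSpace ℝ P]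
    (σ : SmoothCube n k X) {α : P → DForm n j X} {q : P} {s : Fin k → ℝ}
    (hα : SmoothFam (formType n j) α q (σ.map s)) :
    ContDiffAt ℝ ∞ (fun z : P × (Fin k → ℝ) => σ.pull (α z.1) z.2) (q, s) := by
  have hc := σ.contDiffAt_inChart s
  have h1 : ContDiffAt ℝ ∞ (fun z : P × (Fin k → ℝ) => (z.1, σ.inChart s z.2)) (q, s) :=
    contDiffAt_fst.prodMk (ContDiffAt.comp (g := σ.inChart s)
      (f := fun z : P × (Fin k → ℝ) => z.2) (q, s) hc contDiffAt_snd)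
  have h2 := ContDiffAt.comp
    (g := fun z : P × Euc n => fieldInChart (formType n j) (σ.map s) (α z.1) z.2)
    (f := fun z : P × (Fin k → ℝ) => (z.1, σ.inChart s z.2)) (q, s) hα h1
  have h3 : ContDiffAt ℝ ∞ (fun z : P × (Fin k → ℝ) => fderiv ℝ (σ.inChart s) z.2) (q, s) :=
    ContDiffAt.comp (g := fderiv ℝ (σ.inChart s)) (f := fun z : P × (Fin k → ℝ) => z.2)
      (q, s) (hc.fderiv_right (m := ∞) (by simp)) contDiffAt_snd
  refine (h2.alternating_comp h3).congr_of_eventuallyEq ?_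
  filter_upwards [(continuous_snd.tendsto (q, s)).eventually
    (σ.eventually_pull_eq (j := j) s)] with z hz using hz _

theorem SmoothField.contDiff_cubePull (σ : SmoothCube n k X) {α : DForm n j X}
    (hα : SmoothField (formType n j) α) : ContDiff ℝ ∞ (σ.pull α) :=
  contDiff_iff_contDiffAt.2 fun s => ContDiffAt.comp
    (g := fun z : ℝ × (Fin k → ℝ) => σ.pull α z.2) (f := fun s => ((0 : ℝ), s)) s
    (SmoothFam.cubePull σ (hα.fam 0 _)) (contDiffAt_const.prodMk contDiffAt_id)

theorem SmoothCube.extDeriv_pull (σ : SmoothCube n k X) {α : DForm n j X}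
    (hα : SmoothField (formType n j) α) (s : Fin k → ℝ) :
    extDeriv (σ.pull α) s = σ.pull (dForm α) s := by
  have h1 := (σ.eventually_pull_eq (j := j + 1) s).self_of_nhds (dForm α)
  have h2 : σ.pull α =ᶠ[𝓝 s] _ := (σ.eventually_pull_eq (j := j) s).mono fun z hz => hz α
  have hd : DifferentiableAt ℝ (fieldInChart (formType n j) (σ.map s) α) (σ.inChart s s) :=
    (hα (σ.map s)).differentiableAt (by simp)
  rw [h1, h2.extDeriv_eq,
    extDeriv_pullback hd (σ.contDiffAt_inChart s) (by simpa using two_le_smooth)]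
  simp only [SmoothCube.inChart, Function.comp_apply]
  rw [fieldInChart_dForm (mem_ch_source _ _) ((hα (σ.map s)).of_le (by simp))]

/-- The inclusion of a face is affine, and its linear part `L` sends the `j`-th basis vector to the
one of index `i.succAbove j`. -/
theorem SmoothCube.face_pull (σ : SmoothCube n (k + 1) X) (i : Fin (k + 1)) (a : ℝ)
    (α : DForm n k X) (t : Fin k → ℝ) :
    (σ.face i a).pull α t (fun j => Pi.single j 1) =
      σ.pull α (i.insertNth (α := fun _ => ℝ) a t) (fun j => Pi.single (i.succAbove j) 1) := by
  let ι : (Fin k → ℝ) → (Fin (k + 1) → ℝ) := fun t => i.insertNth (α := fun _ => ℝ) a t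
  let L : (Fin k → ℝ) →L[ℝ] (Fin (k + 1) → ℝ) :=
    ContinuousLinearMap.pi fun j => if h : ∃ j', i.succAbove j' = j then
      ContinuousLinearMap.proj h.choose else 0
  have hL : ∀ j t, L t (i.succAbove j) = t j := by
    intro j t
    have h : ∃ j', i.succAbove j' = i.succAbove j := ⟨j, rfl⟩
    simp only [L, ContinuousLinearMap.pi_apply, dif_pos h, ContinuousLinearMap.proj_apply]
    exact congrArg t (Fin.succAbove_right_injective h.choose_spec)
  have hL0 : ∀ t, L t i = 0 := by
    intro t
    have h : ¬ ∃ j', i.succAbove j' = i := fun ⟨j, hj⟩ => Fin.succAbove_ne i j hj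
    simp only [L, ContinuousLinearMap.pi_apply, dif_neg h, _root_.zero_apply]
  have hι : ι = fun t => L t + i.insertNth (α := fun _ => ℝ) a 0 := by
    funext t j
    refine Fin.succAboveCases i ?_ (fun j => ?_) j
    · simp [ι, hL0]
    · simp [ι, hL]
  have hd : HasFDerivAt ι L t := by
    rw [hι]; exact L.hasFDerivAt.add_const _
  have hLs : ∀ j, L (Pi.single j 1) = Pi.single (i.succAbove j) 1 := by
    intro j
    funext j'
    refine Fin.succAboveCases i ?_ (fun j' => ?_) j'
    · rw [hL0, Pi.single_eq_of_ne (Fin.succAbove_ne i j).symm]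
    · rw [hL]
      by_cases h : j' = j
      · subst h; simp
      · rw [Pi.single_eq_of_ne h, Pi.single_eq_of_ne
          (fun h' => h (Fin.succAbove_right_injective h'))]
  have hm : (σ.face i a).diff t = (σ.diff (ι t)).comp L := by
    have h1 : MDifferentiableAt 𝓘(ℝ, Fin (k + 1) → ℝ) 𝓘(ℝ, Euc n) σ.map (ι t) :=
      (σ.smooth _).mdifferentiableAt (by simp)
    have h2 : MDifferentiableAt 𝓘(ℝ, Fin k → ℝ) 𝓘(ℝ, Fin (k + 1) → ℝ) ι t :=
      hd.differentiableAt.mdifferentiableAt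
    have h3 := mfderiv_comp t h1 h2
    rw [mfderiv_eq_fderiv, hd.fderiv] at h3
    exact h3
  change α (σ.map (ι t)) (fun j => (σ.face i a).diff t (Pi.single j 1)) =
    α (σ.map (ι t)) (fun j => σ.diff (ι t) (Pi.single (i.succAbove j) 1))
  rw [hm]
  simp only [ContinuousLinearMap.comp_apply, hLs]

/-- Stokes' theorem for a cube. -/
theorem SmoothCube.integral_dForm (σ : SmoothCube n (k + 1) X) {α : DForm n k X}
    (hα : SmoothField (formType n k) α) :
    σ.integral (dForm α) = ∑ i : Fin (k + 1), (-1) ^ (i : ℕ) *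
      ((σ.face i 1).integral α - (σ.face i 0).integral α) := by
  simp only [SmoothCube.integral_eq, SmoothCube.face_pull, ← σ.extDeriv_pull hα]
  exact integral_extDeriv_Icc (hα.contDiff_cubePull σ)

theorem SmoothCube.integrableOn (σ : SmoothCube n k X) {α : DForm n k X}
    (hα : SmoothField (formType n k) α) : MeasureTheory.IntegrableOn
      (fun s => σ.pull α s (fun i => Pi.single i 1)) (Icc (0 : Fin k → ℝ) 1) := by
  have h : ContDiff ℝ ∞ (fun s => σ.pull α s (fun i => Pi.single i 1)) :=
    contDiff_iff_contDiffAt.2 fun s =>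
      ((hα.contDiff_cubePull σ).contDiffAt).alternating_apply fun _ => contDiffAt_const
  exact h.continuous.continuousOn.integrableOn_compact isCompact_Icc

theorem SmoothCube.integral_add (σ : SmoothCube n k X) {α β : DForm n k X}
    (hα : SmoothField (formType n k) α) (hβ : SmoothField (formType n k) β) :
    σ.integral (α + β) = σ.integral α + σ.integral β :=
  MeasureTheory.integral_add (σ.integrableOn hα) (σ.integrableOn hβ)

theorem SmoothCube.integral_sub (σ : SmoothCube n k X) {α β : DForm n k X}
    (hα : SmoothField (formType n k) α) (hβ : SmoothField (formType n k) β) :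
    σ.integral (α - β) = σ.integral α - σ.integral β :=
  MeasureTheory.integral_sub (σ.integrableOn hα) (σ.integrableOn hβ)

theorem SmoothCube.hasDerivAt_integral (σ : SmoothCube n k X) {α : ℝ → DForm n k X} {t : ℝ}
    (hα : ∀ s ∈ Icc (0 : Fin k → ℝ) 1, SmoothFam (formType n k) α t (σ.map s)) :
    HasDerivAt (fun t => σ.integral (α t))
      (σ.integral (fun x => deriv (fun t => α t x) t)) t := by
  have h := hasDerivAt_integral_Icc (k := k)
    (g := fun z => σ.pull (α z.1) z.2 (fun i => Pi.single i 1)) (t := t) fun s hs =>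
      ((SmoothFam.cubePull σ (hα s hs)).alternating_apply fun _ => contDiffAt_const).of_le
        (by simp)
  refine h.congr_deriv ?_
  refine MeasureTheory.setIntegral_congr_fun measurableSet_Icc fun s hs => ?_
  exact ((hα s hs).hasDerivAt.alternating_apply (fun i => σ.diff s (Pi.single i 1))).deriv

end Cubes

section Chains

variable {n k : ℕ} {X : Type*} [TopologicalSpace X] [ChartedSpace (Euc n) X]

theorem Chain.integral_add_chain (c c' : Chain n k X) (α : DForm n k X) :
    (c + c').integral α = c.integral α + c'.integral α :=
  Finsupp.sum_add_index' (by simp) (by intros; push_cast; ring)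

theorem Chain.integral_smul_chain (a : ℤ) (c : Chain n k X) (α : DForm n k X) :
    (a • c).integral α = a * c.integral α := by
  unfold Chain.integral
  rw [Finsupp.sum_smul_index (by simp), Finsupp.mul_sum]
  refine Finsupp.sum_congr fun σ _ => ?_
  push_cast; ring

theorem Chain.integral_zero_chain (α : DForm n k X) : (0 : Chain n k X).integral α = 0 :=
  Finsupp.sum_zero_index

theorem Chain.integral_sub_chain (c c' : Chain n k X) (α : DForm n k X) :
    (c - c').integral α = c.integral α - c'.integral α := by
  have h := Chain.integral_add_chain (c - c') c' α
  rw [sub_add_cancel] at h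
  rw [h]; ring

theorem Chain.integral_single (σ : SmoothCube n k X) (a : ℤ) (α : DForm n k X) :
    Chain.integral (Finsupp.single σ a) α = a * σ.integral α :=
  Finsupp.sum_single_index (by simp)

theorem Chain.integral_sum_chain {ι : Type*} (s : Finset ι) (c : ι → Chain n k X)
    (α : DForm n k X) : (∑ i ∈ s, c i).integral α = ∑ i ∈ s, (c i).integral α := by
  classical
  induction s using Finset.induction_on with
  | empty => simp [Chain.integral_zero_chain]
  | insert a s ha ih =>
    rw [Finset.sum_insert ha, Finset.sum_insert ha, Chain.integral_add_chain, ih]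

theorem Chain.integral_congr (c : Chain n k X) {α β : DForm n k X}
    (h : ∀ σ ∈ c.support, ∀ s ∈ Icc (0 : Fin k → ℝ) 1, α (σ.map s) = β (σ.map s)) :
    c.integral α = c.integral β :=
  Finsupp.sum_congr fun σ hσ => by rw [σ.integral_congr (h σ hσ)]

variable [IsManifold 𝓘(ℝ, Euc n) ∞ X]

theorem Chain.integral_add (c : Chain n k X) {α β : DForm n k X}
    (hα : SmoothField (formType n k) α) (hβ : SmoothField (formType n k) β) :
    c.integral (α + β) = c.integral α + c.integral β := by
  unfold Chain.integral
  rw [← Finsupp.sum_add]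
  exact Finsupp.sum_congr fun σ _ => by rw [σ.integral_add hα hβ, mul_add]

theorem Chain.integral_sub (c : Chain n k X) {α β : DForm n k X}
    (hα : SmoothField (formType n k) α) (hβ : SmoothField (formType n k) β) :
    c.integral (α - β) = c.integral α - c.integral β := by
  unfold Chain.integral
  rw [← Finsupp.sum_sub]
  exact Finsupp.sum_congr fun σ _ => by rw [σ.integral_sub hα hβ, mul_sub]

theorem Chain.hasDerivAt_integral (c : Chain n k X) {α : ℝ → DForm n k X} {t : ℝ}
    (hα : ∀ σ ∈ c.support, ∀ s ∈ Icc (0 : Fin k → ℝ) 1,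
      SmoothFam (formType n k) α t (σ.map s)) :
    HasDerivAt (fun t => c.integral (α t))
      (c.integral (fun x => deriv (fun t => α t x) t)) t := by
  unfold Chain.integral Finsupp.sum
  exact HasDerivAt.fun_sum fun σ hσ => (σ.hasDerivAt_integral (hα σ hσ)).const_mul _

/-- Stokes' theorem for smooth singular chains. -/
theorem Chain.integral_dForm (c : Chain n (k + 1) X) {α : DForm n k X}
    (hα : SmoothField (formType n k) α) : c.integral (dForm α) = c.boundary.integral α := by
  unfold Chain.boundary Finsupp.sum
  rw [Chain.integral_sum_chain]
  unfold Chain.integral Finsupp.sum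
  refine Finset.sum_congr rfl fun σ _ => ?_
  change _ = Chain.integral (_ : Chain n k X) α
  beta_reduce
  rw [Chain.integral_sum_chain, σ.integral_dForm hα, Finset.mul_sum]
  refine Finset.sum_congr rfl fun i _ => ?_
  rw [Chain.integral_smul_chain, Chain.integral_sub_chain, Chain.integral_single,
    Chain.integral_single]
  push_cast; ring

end Chains

/-! ### The boundary operator on chains and push-forward -/

section Boundary

variable {n m k : ℕ} {X : Type*} [TopologicalSpace X] [ChartedSpace (Euc n) X]
  {Y : Type*} [TopologicalSpace Y] [ChartedSpace (Euc m) Y]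

theorem Chain.integral_push {f : Y → X} (hf : ContMDiff 𝓘(ℝ, Euc m) 𝓘(ℝ, Euc n) ∞ f)
    (c : Chain m k Y) (α : DForm n k X) :
    (c.push f hf).integral α = c.integral (pullForm f α) := by
  unfold Chain.push Chain.integral
  rw [Finsupp.sum_mapDomain_index (by simp) (by intros; push_cast; ring)]
  refine Finsupp.sum_congr fun σ _ => ?_
  congr 1
  refine MeasureTheory.setIntegral_congr_fun measurableSet_Icc fun s _ => ?_
  have h1 : MDifferentiableAt 𝓘(ℝ, Euc m) 𝓘(ℝ, Euc n) f (σ.map s) :=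
    (hf _).mdifferentiableAt (by simp)
  have h2 : MDifferentiableAt 𝓘(ℝ, Fin k → ℝ) 𝓘(ℝ, Euc m) σ.map s :=
    (σ.smooth _).mdifferentiableAt (by simp)
  have h3 := mfderiv_comp s h1 h2
  have h4 : (mfderiv 𝓘(ℝ, Fin k → ℝ) 𝓘(ℝ, Euc n) (f ∘ σ.map) s : (Fin k → ℝ) →L[ℝ] Euc n) =
    (md m n f (σ.map s)).comp (σ.diff s) := h3
  beta_reduce
  rw [h4]
  rfl

theorem SmoothCube.ext_map {σ τ : SmoothCube n k X} (h : σ.map = τ.map) : σ = τ := by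
  cases σ; cases τ; cases h; rfl

/-- The same two coordinates are filled in the other order; `succAbove` and `predAbove` relabel the
positions. -/
theorem insertNth_insertNth_swap {k : ℕ} (i : Fin (k + 2)) (j : Fin (k + 1)) (a b : ℝ)
    (t : Fin k → ℝ) :
    (i.insertNth (α := fun _ => ℝ) a (j.insertNth (α := fun _ => ℝ) b t) : Fin (k + 2) → ℝ) =
      (i.succAbove j).insertNth (α := fun _ => ℝ) b
        ((j.predAbove i).insertNth (α := fun _ => ℝ) a t) := by
  refine Fin.insertNth_eq_iff.2 ⟨?_, Fin.insertNth_eq_iff.2 ⟨by simp [Fin.removeNth], ?_⟩⟩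
  · have h := Fin.insertNth_apply_succAbove (α := fun _ => ℝ) (i.succAbove j) b
      ((j.predAbove i).insertNth (α := fun _ => ℝ) a t) (j.predAbove i)
    rw [Fin.succAbove_succAbove_predAbove] at h
    rw [h]; simp
  · rw [Fin.removeNth_removeNth_eq_swap]
    simp

theorem SmoothCube.face_face (σ : SmoothCube n (k + 2) X) (i : Fin (k + 2)) (j : Fin (k + 1))
    (a b : ℝ) : (σ.face i a).face j b = (σ.face (i.succAbove j) b).face (j.predAbove i) a :=
  SmoothCube.ext_map (funext fun t => congrArg σ.map (insertNth_insertNth_swap i j a b t))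

/-- The boundary as a homomorphism. -/
noncomputable def Chain.boundaryHom (n k : ℕ) (X : Type*) [TopologicalSpace X]
    [ChartedSpace (Euc n) X] : Chain n (k + 1) X →+ Chain n k X where
  toFun := Chain.boundary
  map_zero' := Finsupp.sum_zero_index
  map_add' _ _ := Finsupp.sum_add_index' (by simp) (by
    intros; simp only [mul_add, add_smul, Finset.sum_add_distrib])

theorem Chain.boundary_single (σ : SmoothCube n (k + 1) X) :
    Chain.boundary (Finsupp.single σ 1) = ∑ i : Fin (k + 1), ((-1) ^ (i : ℕ) : ℤ) •
      (Finsupp.single (σ.face i 1) 1 - Finsupp.single (σ.face i 0) 1 : Chain n k X) := by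
  unfold Chain.boundary
  rw [Finsupp.sum_single_index (by simp)]
  simp only [mul_one]

/-- Each codimension-two face is reached twice, and the exchange of the order of the two faces is an
involution of the index pairs that reverses the sign and has no fixed point. -/
theorem Chain.boundary_boundary (c : Chain n (k + 2) X) : c.boundary.boundary = 0 := by
  suffices h : (Chain.boundaryHom n k X).comp (Chain.boundaryHom n (k + 1) X) = 0 from
    DFunLike.congr_fun h c
  refine Finsupp.addHom_ext' fun σ => AddMonoidHom.ext_int ?_
  change Chain.boundaryHom n k X (Chain.boundary (Finsupp.single σ 1)) = 0
  let F : Fin (k + 2) × Fin (k + 1) → ℝ → ℝ → Chain n k X := fun p a b =>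
    Finsupp.single ((σ.face p.1 a).face p.2 b) 1
  have hF : Chain.boundaryHom n k X (Chain.boundary (Finsupp.single σ 1)) =
      ∑ p : Fin (k + 2) × Fin (k + 1), ((-1) ^ (p.1 + p.2 : ℕ) : ℤ) •
        (F p 1 1 - F p 1 0 - (F p 0 1 - F p 0 0)) := by
    rw [Chain.boundary_single, map_sum, Fintype.sum_prod_type]
    refine Finset.sum_congr rfl fun i _ => ?_
    rw [map_zsmul, map_sub]
    change _ • (Chain.boundary _ - Chain.boundary _) = _
    rw [Chain.boundary_single, Chain.boundary_single, ← Finset.sum_sub_distrib, Finset.smul_sum]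
    refine Finset.sum_congr rfl fun j _ => ?_
    rw [← smul_sub, smul_smul, ← pow_add]
  rw [hF]
  refine Finset.sum_involution (fun p _ => (p.1.succAbove p.2, p.2.predAbove p.1)) ?_ ?_ ?_ ?_
  · rintro ⟨i, j⟩ -
    have e : ∀ a b, F (i.succAbove j, j.predAbove i) a b = F (i, j) b a := fun a b => by
      simp only [F]
      rw [← σ.face_face]
    simp only [e, Fin.neg_one_pow_succAbove_add_predAbove]
    module
  · rintro ⟨i, j⟩ - - h
    exact Fin.succAbove_ne i j (congrArg Prod.fst h)
  · intro _ _; exact Finset.mem_univ _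
  · rintro ⟨i, j⟩ -
    simp only [Fin.succAbove_succAbove_predAbove, Fin.predAbove_predAbove_succAbove]

theorem Chain.push_boundary {f : Y → X} (hf : ContMDiff 𝓘(ℝ, Euc m) 𝓘(ℝ, Euc n) ∞ f)
    (c : Chain m (k + 1) Y) : (c.push f hf).boundary = c.boundary.push f hf := by
  let p : ∀ k, Chain m k Y →+ Chain n k X := fun k =>
    Finsupp.mapDomain.addMonoidHom (fun σ => ⟨f ∘ σ.map, hf.comp σ.smooth⟩)
  suffices h : (Chain.boundaryHom n k X).comp (p (k + 1)) = (p k).comp (Chain.boundaryHom m k Y) from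
    DFunLike.congr_fun h c
  refine Finsupp.addHom_ext' fun σ => AddMonoidHom.ext_int ?_
  have hp : ∀ (k) (σ : SmoothCube m k Y), p k (Finsupp.single σ 1) =
      Finsupp.single ⟨f ∘ σ.map, hf.comp σ.smooth⟩ 1 := fun k σ => Finsupp.mapDomain_single
  change Chain.boundary (p (k + 1) (Finsupp.single σ 1)) =
    p k (Chain.boundary (Finsupp.single σ 1))
  rw [hp, Chain.boundary_single, Chain.boundary_single, map_sum]
  refine Finset.sum_congr rfl fun i _ => ?_
  rw [map_zsmul, map_sub, hp, hp]
  rfl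

/-- Composition with an injective map is injective on cubes, so no cancellation can occur in the
image. This is what lets `∂∂ = 0` on `M` be read back on `N`. -/
theorem Chain.push_injective {f : Y → X} (hf : ContMDiff 𝓘(ℝ, Euc m) 𝓘(ℝ, Euc n) ∞ f)
    (hi : Function.Injective f) : Function.Injective (Chain.push (k := k) f hf) := by
  refine Finsupp.mapDomain_injective fun σ τ h => SmoothCube.ext_map (funext fun t => hi ?_)
  exact congrFun (congrArg SmoothCube.map h) t

/-- A chain whose injective image is a boundary is a cycle. -/
theorem Chain.boundary_eq_zero_of_push {f : Y → X}
    (hf : ContMDiff 𝓘(ℝ, Euc m) 𝓘(ℝ, Euc n) ∞ f) (hi : Function.Injective f)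
    {c : Chain n (k + 2) X} {c' : Chain m (k + 1) Y} (h : c.boundary = c'.push f hf) :
    c'.boundary = 0 := by
  refine Chain.push_injective hf hi ?_
  rw [← Chain.push_boundary, ← h, Chain.boundary_boundary]
  exact (Finsupp.mapDomain_zero).symm

end Boundary

end CovPhase

namespace CovPhase

/-! ### Extension of identities to the closure of a set -/

section Closure

variable {n : ℕ} {W : Type*} [NormedAddCommGroup W] [NormedSpace ℝ W] {T : TensorType n W}
  {M : Type*} [TopologicalSpace M] [ChartedSpace (Euc n) M] [IsManifold 𝓘(ℝ, Euc n) ∞ M]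

/-- Smooth fields equal on a set are equal on its closure. -/
theorem SmoothField.eqOn_closure {α β : M → W} (hα : SmoothField T α) (hβ : SmoothField T β)
    {U : Set M} (h : EqOn α β U) : EqOn α β (closure U) := by
  intro x hx
  have hne : (𝓝[U] x).NeBot := mem_closure_iff_nhdsWithin_neBot.1 hx
  have hsrc := ch_source_mem_nhds (Euc n) (mem_ch_source (Euc n) x)
  have lim : ∀ {α : M → W}, SmoothField T α → Filter.Tendsto
      (fun p => fieldInChart T x α (ch (Euc n) x p)) (𝓝[U] x) (𝓝 (α x)) := by
    intro α hα
    have h1 : ContinuousAt (fieldInChart T x α) (ch (Euc n) x x) := (hα x).continuousAt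
    have h2 := h1.tendsto.comp (continuousAt_ch (Euc n) (mem_ch_source (Euc n) x)).tendsto
    rw [fieldInChart_self] at h2
    exact h2.mono_left nhdsWithin_le_nhds
  refine tendsto_nhds_unique_of_eventuallyEq (lim hα) (lim hβ) ?_
  filter_upwards [self_mem_nhdsWithin, nhdsWithin_le_nhds hsrc] with p hp hps
  rw [fieldInChart_ch T hps, fieldInChart_ch T hps, h hp]

end Closure

/-! ### Lie derivatives of forms -/

section LieForms

variable {l k : ℕ} {X : Type*} [TopologicalSpace X] [ChartedSpace (Euc l) X]
  [IsManifold 𝓘(ℝ, Euc l) ∞ X]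

theorem SmoothField.lieForm {v : VField l X} {α : DForm l (k + 1) X}
    (hv : SmoothField (vecType l) v) (hα : SmoothField (formType l (k + 1)) α) :
    SmoothField (formType l (k + 1)) (lieForm v α) :=
  (hv.contract hα.dForm).add (hv.contract hα).dForm

theorem lieForm_sub {v : VField l X} {α β : DForm l (k + 1) X} (hv : SmoothField (vecType l) v)
    (hα : SmoothField (formType l (k + 1)) α) (hβ : SmoothField (formType l (k + 1)) β) :
    lieForm v (α - β) = lieForm v α - lieForm v β := by
  unfold CovPhase.lieForm
  rw [dForm_sub hα hβ, contract_sub, contract_sub, dForm_sub (hv.contract hα) (hv.contract hβ)]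
  abel

theorem contract_zero (v : VField l X) : contract v (0 : DForm l (k + 1) X) = 0 := by
  simpa using contract_sub v (0 : DForm l (k + 1) X) 0

theorem contract_neg (v : VField l X) (α : DForm l (k + 1) X) :
    contract v (-α) = -contract v α := rfl

theorem lieForm_dForm {v : VField l X} {α : DForm l (k + 1) X}
    (hv : SmoothField (vecType l) v) (hα : SmoothField (formType l (k + 1)) α) :
    lieForm v (dForm α) = dForm (lieForm v α) := by
  unfold CovPhase.lieForm
  rw [dForm_dForm hα, contract_zero, zero_add, dForm_add (hv.contract hα.dForm)
    (hv.contract hα).dForm, dForm_dForm (hv.contract hα), add_zero]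

/-- Forms of degree larger than the dimension vanish. -/
theorem DForm.eq_zero_of_lt (h : l < k) (α : DForm l k X) : α = 0 :=
  funext fun x => alternating_eq_zero_of_finrank_lt (by simpa using h) (α x)

theorem dForm_congr_on {α β : DForm l k X} {U : Set X} (hU : IsOpen U) (h : EqOn α β U) :
    EqOn (dForm α) (dForm β) U := fun _ hx =>
  dForm_congr (h.eventuallyEq_of_mem (hU.mem_nhds hx))

theorem _root_.HasDerivAt.curryLeft {α : ℝ → Euc l [⋀^Fin (k + 1)]→L[ℝ] ℝ}
    {α' : Euc l [⋀^Fin (k + 1)]→L[ℝ] ℝ} {w : ℝ → Euc l} {w' : Euc l} {t : ℝ}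
    (hα : HasDerivAt α α' t) (hw : HasDerivAt w w' t) :
    HasDerivAt (fun t => (α t).curryLeft (w t))
      (α'.curryLeft (w t) + (α t).curryLeft w') t := by
  refine hasDerivAt_alternating fun z => ?_
  have h := (isBoundedBilinearMap_curryLeft (Euc l) k).hasFDerivAt (α t, w t)
  have h2 := (h.comp_hasDerivAt t (hα.prodMk hw)).alternating_apply z
  refine h2.congr_deriv ?_
  simp [add_comm]

end LieForms

/-! ### Generators tangent to the hypersurface and their variations -/

section Generators

variable {n l : ℕ} {W : Type*} [NormedAddCommGroup W] [NormedSpace ℝ W] {T : TensorType n W}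
  {M : Type*} [TopologicalSpace M] [ChartedSpace (Euc n) M] [IsManifold 𝓘(ℝ, Euc n) ∞ M]
  {X : Type*} [TopologicalSpace X] [ChartedSpace (Euc l) X] [IsManifold 𝓘(ℝ, Euc l) ∞ X]
  {ν : X → M} {ζ : (M → W) → VField n M}

theorem IsGenerator.isSmoothGen (hζ : IsGenerator (l := l) T ν ζ) : IsSmoothGen T ζ :=
  hζ.isSmooth

theorem IsGenerator.eventually_tangentAt (hζ : IsGenerator (l := l) T ν ζ) {Φ : ℝ → M → W}
    (hΦ : ∀ t x, SmoothFam T Φ t x) {t : ℝ} (ht : Φ t ∈ FieldSpace T) (y : X) :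
    ∀ᶠ z : ℝ × X in 𝓝 (t, y), TangentAt (n := n) (m := l) ν (ζ (Φ z.1)) z.2 := by
  have h := hζ.tangent 1 (fun q => Φ (q 0))
    (fun q x => (hΦ (q 0) x).comp (τ := fun q : Fin 1 → ℝ => q 0) (contDiff_apply ℝ ℝ 0).contDiffAt)
    (fun _ => t) ht y
  have hc : Filter.Tendsto (fun z : ℝ × X => ((fun _ : Fin 1 => z.1), z.2)) (𝓝 (t, y))
      (𝓝 ((fun _ : Fin 1 => t), y)) := by
    refine Continuous.tendsto (f := fun z : ℝ × X => ((fun _ : Fin 1 => z.1), z.2)) ?_ (t, y)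
    exact (continuous_pi fun _ => continuous_fst).prodMk continuous_snd
  exact hc.eventually h

theorem IsGenerator.tangentAt (hζ : IsGenerator (l := l) T ν ζ) {φ : M → W}
    (hφ : φ ∈ FieldSpace T) (y : X) : TangentAt (n := n) (m := l) ν (ζ φ) y :=
  (hζ.eventually_tangentAt (Φ := fun _ => φ) (t := 0) (fun t x => hφ.1.fam t x) hφ y).self_of_nhds

theorem IsGenerator.smoothFam_restrictVF (hν : Manifold.IsImmersion 𝓘(ℝ, Euc l) 𝓘(ℝ, Euc n) ∞ ν)
    (hζ : IsGenerator (l := l) T ν ζ) {Φ : ℝ → M → W}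
    (hΦ : ∀ t x, SmoothFam T Φ t x) {t : ℝ} (ht : Φ t ∈ FieldSpace T) (y : X) :
    SmoothFam (vecType l) (fun t => restrictVF ν (ζ (Φ t))) t y :=
  SmoothFam.restrictVF hν (hζ.isSmoothGen.smoothFam hΦ ht (ν y))
    (hζ.eventually_tangentAt hΦ ht y)

/-- Differentiate `dν (u_t) = ζ (φ + t Y) ∘ ν` at `t = 0`. The relation holds for all small `t`
because tangency is imposed under variations of the fields as well; it follows that `δζ` is tangent
too. -/
theorem IsGenerator.md_deriv_restrictVF
    (hν : Manifold.IsImmersion 𝓘(ℝ, Euc l) 𝓘(ℝ, Euc n) ∞ ν)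
    (hζ : IsGenerator (l := l) T ν ζ) {φ Y : M → W} (hφ : φ ∈ FieldSpace T)
    (hY : SmoothField T Y) (y : X) :
    md l n ν y (deriv (fun t : ℝ => restrictVF ν (ζ (φ + t • Y)) y) 0) =
      fieldDeriv ζ φ Y (ν y) := by
  have hl := smoothFam_line hφ.1 hY
  have h1 := (hζ.smoothFam_restrictVF hν hl (add_zero_smul_mem hφ) y).hasDerivAt
  have h2 := (md l n ν y).hasFDerivAt.comp_hasDerivAt (0 : ℝ) h1
  have h3 : (fun t : ℝ => md l n ν y (restrictVF ν (ζ (φ + t • Y)) y)) =ᶠ[𝓝 0]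
      fun t => ζ (φ + t • Y) (ν y) := by
    have := ((Continuous.prodMk_left y).tendsto (0 : ℝ)).eventually
      (hζ.eventually_tangentAt hl (add_zero_smul_mem hφ) y)
    filter_upwards [this] with t ht
    exact md_restrictVF ht
  exact (h2.congr_of_eventuallyEq h3.symm).deriv.symm

theorem IsGenerator.tangentAt_fieldDeriv
    (hν : Manifold.IsImmersion 𝓘(ℝ, Euc l) 𝓘(ℝ, Euc n) ∞ ν)
    (hζ : IsGenerator (l := l) T ν ζ) {φ Y : M → W} (hφ : φ ∈ FieldSpace T)
    (hY : SmoothField T Y) (y : X) : TangentAt (n := n) (m := l) ν (fieldDeriv ζ φ Y) y :=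
  tangentAt_of_md (hζ.md_deriv_restrictVF hν hφ hY y)

theorem IsGenerator.hasDerivAt_restrictVF
    (hν : Manifold.IsImmersion 𝓘(ℝ, Euc l) 𝓘(ℝ, Euc n) ∞ ν)
    (hζ : IsGenerator (l := l) T ν ζ) {φ Y : M → W} (hφ : φ ∈ FieldSpace T)
    (hY : SmoothField T Y) (y : X) :
    HasDerivAt (fun t : ℝ => restrictVF (m := l) ν (ζ (φ + t • Y)) y)
      (restrictVF (m := l) ν (fieldDeriv ζ φ Y) y) 0 := by
  rw [restrictVF_eq_of_md hν (hζ.md_deriv_restrictVF hν hφ hY y)]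
  exact (hζ.smoothFam_restrictVF hν (smoothFam_line hφ.1 hY) (add_zero_smul_mem hφ) y).hasDerivAt

theorem restrictVF_eventuallyEq (hν : Continuous ν) {v v' : VField n M} {y : X}
    (h : v =ᶠ[𝓝 (ν y)] v') : restrictVF (m := l) ν v =ᶠ[𝓝 y] restrictVF ν v' := by
  filter_upwards [hν.continuousAt.eventually h] with z hz
  simp only [restrictVF, hz]

theorem lieForm_congr {k : ℕ} {v v' : VField l X} {α α' : DForm l (k + 1) X} {y : X}
    (h : v =ᶠ[𝓝 y] v') (h' : α =ᶠ[𝓝 y] α') : lieForm v α y = lieForm v' α' y := by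
  have h1 : contract v α =ᶠ[𝓝 y] contract v' α' := by
    filter_upwards [h, h'] with z hz hz'
    simp only [contract, hz, hz']
  simp only [CovPhase.lieForm, Pi.add_apply, contract, dForm_congr h', dForm_congr h1,
    h.self_of_nhds]

end Generators

end CovPhase

namespace CovPhase

/-! ### Identities of the covariant theory -/

section Theory

variable {n : ℕ} {W : Type*} [NormedAddCommGroup W] [NormedSpace ℝ W] [FiniteDimensional ℝ W]
  {T : TensorType (n + 3) W} {M : Type*} [TopologicalSpace M] [T2Space M]
  [SecondCountableTopology M] [ChartedSpace (Euc (n + 3)) M] [IsManifold 𝓘(ℝ, Euc (n + 3)) ∞ M]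
  (Th : LagrangianTheory T M) {φ : M → W} {u v : VField (n + 3) M}

namespace LagrangianTheory

omit [FiniteDimensional ℝ W] [T2Space M] [SecondCountableTopology M] in
theorem local_covθ : IsLocal1 T id Th.covθ :=
  (Th.local_θ.sub Th.local_b.delta0).sub (Th.local_lam.dForm continuous_id)

omit [FiniteDimensional ℝ W] [T2Space M] [SecondCountableTopology M] in
theorem smoothField_covL (hφ : φ ∈ FieldSpace T) :
    SmoothField (formType (n + 3) (n + 3)) (Th.covL φ) :=
  (Th.local_L.smoothField hφ).sub (Th.local_b.smoothField hφ).dForm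

omit [FiniteDimensional ℝ W] [T2Space M] [SecondCountableTopology M] in
theorem fieldDeriv_covθ (hφ : φ ∈ FieldSpace T) {X ψ : M → W} (hX : SmoothField T X)
    (hψ : SmoothField T ψ) :
    fieldDeriv (fun φ' => Th.covθ φ' ψ) φ X = fieldDeriv (fun φ' => Th.θ φ' ψ) φ X
      - fieldDeriv (fun φ' => delta0 Th.b φ' ψ) φ X
      - dForm (fieldDeriv (fun φ' => Th.lam φ' ψ) φ X) := by
  have h1 := Th.local_θ.localLin.apply hψ
  have h2 := Th.local_b.delta0.localLin.apply hψ
  have h3 := Th.local_lam.localLin.apply hψ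
  have e := fieldDeriv_sub (h1.sub h2) (h3.dForm continuous_id) hφ hX
  rw [fieldDeriv_sub h1 h2 hφ hX, fieldDeriv_dForm h3 hφ hX] at e
  exact e

/-- The covariant symplectic potential has no anomaly. -/
theorem covariant_covθ (hφ : φ ∈ FieldSpace T) (hv : SmoothField (vecType (n + 3)) v)
    {ψ : M → W} (hψ : SmoothField T ψ) :
    fieldDeriv (fun φ' => Th.covθ φ' ψ) φ (lieField T v φ) + Th.covθ φ (lieField T v ψ) =
      lieForm v (Th.covθ φ ψ) := by
  have hg := isSmoothGen_const (T := T) hv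
  have hX : SmoothField T (lieField T v φ) := hv.lieField hφ.1
  have hvψ : SmoothField T (lieField T v ψ) := hv.lieField hψ
  -- As `d` commutes with field derivatives and with `£_v`, the hypothesis says that the anomaly of
  -- `θ' - δb' - dλ'` vanishes.
  have h := Th.anomaly_θ φ hφ v hv ψ hψ
  rw [anomaly1_eq Th.local_θ hg hφ hψ, anomaly1_eq Th.local_b.delta0 hg hφ hψ,
    anomaly1_eq Th.local_lam hg hφ hψ] at h
  have s1 := Th.local_θ.localLin.smoothField hφ hψ
  have s2 := Th.local_b.delta0.localLin.smoothField hφ hψ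
  have s3 := Th.local_lam.localLin.smoothField hφ hψ
  have s4 := (Th.local_lam.localLin.apply hψ).smoothField_fieldDeriv hφ hX
  have s5 := Th.local_lam.localLin.smoothField hφ hvψ
  change fieldDeriv (fun φ' => Th.θ φ' ψ) φ (lieField T v φ) + _ - _ =
    fieldDeriv (fun φ' => delta0 Th.b φ' ψ) φ (lieField T v φ) + _ - _ +
    dForm (fieldDeriv (fun φ' => Th.lam φ' ψ) φ (lieField T v φ) + _ - _) at h
  rw [dForm_sub (s4.add s5) (hv.lieForm s3), dForm_add s4 s5] at h
  rw [Th.fieldDeriv_covθ hφ hX hψ]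
  simp only [covθ]
  rw [lieForm_sub hv (s1.sub s2) s3.dForm, lieForm_sub hv s1 s2, lieForm_dForm hv s3]
  rw [← sub_eq_zero] at h ⊢
  rw [← h]
  abel

-- From `θ' = θ + δb' + dλ'` and `δδb' = 0`: the noncovariant parts of `θ'` change the symplectic
-- current by the exact term `dδλ'` only.
omit [FiniteDimensional ℝ W] [T2Space M] [SecondCountableTopology M] in
theorem sympCurrent_eq (hφ : φ ∈ FieldSpace T) {X Y : M → W} (hX : SmoothField T X)
    (hY : SmoothField T Y) :
    Th.sympCurrent φ X Y = fieldDeriv (fun φ' => Th.covθ φ' Y) φ X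
      - fieldDeriv (fun φ' => Th.covθ φ' X) φ Y + dForm (delta1 Th.lam φ X Y) := by
  have h0 := delta1_delta0 Th.local_b hφ hX hY
  have s1 := (Th.local_lam.localLin.apply hY).smoothField_fieldDeriv hφ hX
  have s2 := (Th.local_lam.localLin.apply hX).smoothField_fieldDeriv hφ hY
  rw [Th.fieldDeriv_covθ hφ hX hY, Th.fieldDeriv_covθ hφ hY hX]
  simp only [sympCurrent, delta1] at h0 ⊢
  rw [dForm_sub s1 s2, ← sub_eq_zero, ← h0]
  abel

end LagrangianTheory

omit [FiniteDimensional ℝ W] [T2Space M] [SecondCountableTopology M] in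
theorem IsLocal1.smoothField_delta1 {l k : ℕ} {X : Type*} [TopologicalSpace X]
    [ChartedSpace (Euc l) X] [IsManifold 𝓘(ℝ, Euc l) ∞ X] {f : X → M}
    {A : (M → W) → (M → W) → DForm l k X} (hA : IsLocal1 T f A) (hφ : φ ∈ FieldSpace T)
    {ψ₁ ψ₂ : M → W} (h₁ : SmoothField T ψ₁) (h₂ : SmoothField T ψ₂) :
    SmoothField (formType l k) (delta1 A φ ψ₁ ψ₂) :=
  ((hA.localLin.apply h₂).smoothField_fieldDeriv hφ h₁).sub
    ((hA.localLin.apply h₁).smoothField_fieldDeriv hφ h₂)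

variable {Th} {U : Set M} (P : NoetherPotential Th U)

namespace NoetherPotential

/-- Potential, on shell, of the symplectic current of two diffeomorphisms. -/
noncomputable def potential (φ : M → W) (u v : VField (n + 3) M) : DForm (n + 3) (n + 1) M :=
  delta1 Th.lam φ (lieField T v φ) (lieField T u φ) + contract v (Th.covNoetherCurrent φ u)
    - contract u (Th.covNoetherCurrent φ v) + P.Q φ (vfBracket u v)
    + contract v (contract u (Th.covL φ))

section
variable (hφ : φ ∈ FieldSpace T) (hu : SmoothField (vecType (n + 3)) u)
  (hv : SmoothField (vecType (n + 3)) v)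
include hφ hu

omit [FiniteDimensional ℝ W] [T2Space M] [SecondCountableTopology M] in
theorem _root_.CovPhase.LagrangianTheory.smoothField_covNoetherCurrent
    (Th : LagrangianTheory T M) :
    SmoothField (formType (n + 3) (n + 2)) (Th.covNoetherCurrent φ u) :=
  (Th.local_covθ.localLin.smoothField hφ (hu.lieField hφ.1)).sub
    (hu.contract (Th.smoothField_covL hφ))

omit [FiniteDimensional ℝ W] [T2Space M] [SecondCountableTopology M] in
theorem smoothField_Q : SmoothField (formType (n + 3) (n + 1)) (P.Q φ u) :=
  P.local_Q.localLin.smoothField hφ hu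

include hv

omit [FiniteDimensional ℝ W] [T2Space M] [SecondCountableTopology M] in
theorem smoothField_potential : SmoothField (formType (n + 3) (n + 1)) (P.potential φ u v) :=
  ((((Th.local_lam.smoothField_delta1 hφ (hv.lieField hφ.1) (hu.lieField hφ.1)).add
    (hv.contract (Th.smoothField_covNoetherCurrent hφ hu))).sub
    (hu.contract (Th.smoothField_covNoetherCurrent hφ hv))).add
    (P.smoothField_Q hφ (hu.vfBracket hv))).add (hv.contract (hu.contract (Th.smoothField_covL hφ)))

/-- Off-shell form of the exactness of the symplectic current. -/
theorem sympCurrent_sub_dForm_potential :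
    Th.sympCurrent φ (lieField T v φ) (lieField T u φ) - dForm (P.potential φ u v) =
      contract v (dForm (Th.covNoetherCurrent φ u)) - contract u (dForm (Th.covNoetherCurrent φ v))
        + (Th.covNoetherCurrent φ (vfBracket u v) - dForm (P.Q φ (vfBracket u v))) := by
  have hX : SmoothField T (lieField T v φ) := hv.lieField hφ.1
  have hY : SmoothField T (lieField T u φ) := hu.lieField hφ.1
  have hw := hu.vfBracket hv
  have hL := Th.smoothField_covL hφ
  have hJu := Th.smoothField_covNoetherCurrent hφ hu
  have hJv := Th.smoothField_covNoetherCurrent hφ hv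
  have eJ : ∀ w : VField (n + 3) M, Th.covθ φ (lieField T w φ) =
      Th.covNoetherCurrent φ w + contract w (Th.covL φ) := fun w => by
    simp only [LagrangianTheory.covNoetherCurrent, sub_add_cancel]
  -- Covariance replaces each field derivative of `θ` along a diffeomorphism by `£_v θ(Y) - θ(£_v
  -- Y)`. The two terms with a second Lie derivative then combine, through the commutator, into `θ`
  -- on `£_[u,v] φ`.
  have e1 := Th.covariant_covθ hφ hv hY
  have e2 := Th.covariant_covθ hφ hu hX
  have e3 := Th.local_covθ.localLin.sub hφ (hu.lieField hX) (hv.lieField hY)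
  rw [lieField_commutator hu hv hφ.1] at e3
  rw [eJ] at e1 e2 e3
  -- `dL = 0` by degree, so the `i_[u,v] L` hidden in `J_[u,v]` reduces to terms matching those of
  -- the two `£ θ`, up to an exact one.
  have e4 := contract_vfBracket hu hv hL
  rw [DForm.eq_zero_of_lt (by omega) (dForm (Th.covL φ)), contract_zero, contract_zero,
    sub_zero] at e4
  rw [Th.sympCurrent_eq hφ hX hY, eq_sub_of_add_eq e1, eq_sub_of_add_eq e2]
  simp only [potential]
  have s1 := Th.local_lam.smoothField_delta1 hφ hX hY
  have s2 := hv.contract hJu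
  have s3 := hu.contract hJv
  have s4 := P.smoothField_Q hφ hw
  have s5 := hv.contract (hu.contract hL)
  have s6 := hu.contract (hv.contract hL)
  rw [dForm_add (((s1.add s2).sub s3).add s4) s5, dForm_add ((s1.add s2).sub s3) s4,
    dForm_sub (s1.add s2) s3, dForm_add s1 s2]
  rw [e4] at e3
  simp only [lieForm, contract_add]
  rw [dForm_add hJu (hu.contract hL), dForm_add hJv (hv.contract hL), dForm_add s2 s5,
    dForm_add s3 s6]
  simp only [contract_add]
  rw [← sub_eq_zero, ← neg_eq_zero] at e3
  rw [← sub_eq_zero, ← e3]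
  abel

end

-- The relation is given on the open set `U` only; continuity carries it to the closure, which
-- contains the slice and the boundary.
omit [FiniteDimensional ℝ W] [T2Space M] [SecondCountableTopology M] in
theorem dForm_Q (hφ : φ ∈ Th.Solutions U) (hv : SmoothField (vecType (n + 3)) v) :
    EqOn (dForm (P.Q φ v)) (Th.covNoetherCurrent φ v) (closure U) :=
  (P.smoothField_Q hφ.1 hv).dForm.eqOn_closure (Th.smoothField_covNoetherCurrent hφ.1 hv)
    (P.d_Q φ hφ v hv)

/-- On shell the symplectic current of two diffeomorphisms is exact. -/
theorem sympCurrent_eqOn (hU : IsOpen U) (hφ : φ ∈ Th.Solutions U)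
    (hu : SmoothField (vecType (n + 3)) u) (hv : SmoothField (vecType (n + 3)) v) :
    EqOn (Th.sympCurrent φ (lieField T v φ) (lieField T u φ)) (dForm (P.potential φ u v))
      (closure U) := by
  refine SmoothField.eqOn_closure (T := formType (n + 3) (n + 2))
    (Th.local_θ.smoothField_delta1 hφ.1 (hv.lieField hφ.1.1) (hu.lieField hφ.1.1))
    (P.smoothField_potential hφ.1 hu hv).dForm fun x hx => ?_
  -- On the open set `U` the current coincides with `dQ_w`, hence is closed there. With `J_[u,v] =
  -- dQ_[u,v]` this kills every remainder term of the off-shell identity.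
  have hJ : ∀ {w : VField (n + 3) M}, SmoothField (vecType (n + 3)) w →
      dForm (Th.covNoetherCurrent φ w) x = 0 := fun {w} hw => by
    have h := dForm_congr_on hU ((P.dForm_Q hφ hw).mono subset_closure) hx
    rw [dForm_dForm (P.smoothField_Q hφ.1 hw)] at h
    exact h.symm
  have h := congrFun (P.sympCurrent_sub_dForm_potential hφ.1 hu hv) x
  rw [← sub_eq_zero]
  refine h.trans ?_
  simp only [Pi.add_apply, Pi.sub_apply, contract, hJ hu, hJ hv,
    P.d_Q φ hφ _ (hu.vfBracket hv) x hx]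
  simp

omit [FiniteDimensional ℝ W] [T2Space M] [SecondCountableTopology M] in
theorem fieldDeriv_Q (hφ : φ ∈ FieldSpace T) (hu : SmoothField (vecType (n + 3)) u)
    (hv : SmoothField (vecType (n + 3)) v) :
    fieldDeriv (fun φ' => P.Q φ' v) φ (lieField T u φ) =
      lieForm u (P.Q φ v) - P.Q φ (vfBracket u v) := by
  rw [sub_eq_add_neg, ← P.covariant_Q φ hφ u v hu hv]
  simp only [anomaly0]
  abel

end NoetherPotential

end Theory

/-! ### Identities on the boundary -/

section Boundary

variable {n : ℕ} {W : Type*} [NormedAddCommGroup W] [NormedSpace ℝ W]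
  {T : TensorType (n + 3) W} {M : Type*} [TopologicalSpace M]
  [ChartedSpace (Euc (n + 3)) M] [IsManifold 𝓘(ℝ, Euc (n + 3)) ∞ M]
  {N : Type*} [TopologicalSpace N] [ChartedSpace (Euc (n + 2)) N]
  [IsManifold 𝓘(ℝ, Euc (n + 2)) ∞ N]
  {Th : LagrangianTheory T M} {ν : N → M} (B : BoundaryData N Th ν) {φ : M → W}

namespace BoundaryData

variable (hν : ContMDiff 𝓘(ℝ, Euc (n + 2)) 𝓘(ℝ, Euc (n + 3)) ∞ ν)
include hν

theorem local_totalBoundaryTerm : IsLocal0 T ν B.totalBoundaryTerm :=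
  (B.local_ell.add (Th.local_b.pullForm hν)).add (B.local_c.dForm hν.continuous)

theorem fieldDeriv_totalBoundaryTerm (hφ : φ ∈ FieldSpace T) {ψ : M → W}
    (hψ : SmoothField T ψ) : fieldDeriv B.totalBoundaryTerm φ ψ =
      delta0 B.ell φ ψ + pullForm ν (delta0 Th.b φ ψ) + dForm (delta0 B.c φ ψ) := by
  have h1 := B.local_ell
  have h2 := Th.local_b.pullForm hν
  have h3 := B.local_c.dForm hν.continuous
  have e := fieldDeriv_add (h1.add h2) h3 hφ hψ
  rw [fieldDeriv_add h1 h2 hφ hψ, fieldDeriv_pullForm Th.local_b hφ hψ,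
    fieldDeriv_dForm B.local_c hφ hψ] at e
  exact e

/-- Pull-back of the covariant symplectic potential to the boundary. -/
theorem pullForm_covθ (hφ : φ ∈ FieldSpace T) {ψ : M → W} (hψ : SmoothField T ψ) :
    pullForm (m := n + 2) ν (Th.covθ φ ψ) =
      -fieldDeriv B.totalBoundaryTerm φ ψ + dForm (B.ε φ ψ) + B.flux φ ψ := by
  have h1 := B.decomp_θ φ hφ ψ hψ
  have h2 := B.decomp_β φ hφ ψ hψ
  have s1 := Th.local_lam.localLin.smoothField hφ hψ
  have s2 := B.local_c.delta0.localLin.smoothField hφ hψ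
  have s3 := B.local_γ.localLin.smoothField hφ hψ
  have s4 := B.local_ε.localLin.smoothField hφ hψ
  have s5 := B.local_β.localLin.smoothField hφ hψ
  -- Taking `d` of the corner decomposition removes `γ'` and replaces `dβ' - dλ'` by `-dδc' + dε`;
  -- thus `dc'` joins `ℓ'` and `b'` under a single `δ`.
  have h3 := congrArg dForm h2
  rw [dForm_sub s5 (s1.pullForm hν), dForm_add (s2.neg.add s3.dForm) s4,
    dForm_add s2.neg s3.dForm, dForm_neg, dForm_dForm s3, dForm_pullForm hν s1] at h3
  rw [B.fieldDeriv_totalBoundaryTerm hν hφ hψ]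
  simp only [LagrangianTheory.covθ, pullForm_sub]
  rw [h1]
  rw [← sub_eq_zero] at h3 ⊢
  rw [← h3]
  abel

/-- Apply `δ` to the corner decomposition and use `δδc' = 0`. The decomposition is known at
admissible fields only, so the derivatives are compared through `fieldDeriv_congr`. -/
theorem delta1_β [T2Space M] [SecondCountableTopology M] (hφ : φ ∈ FieldSpace T) {ψ₁ ψ₂ : M → W}
    (h₁ : SmoothField T ψ₁) (h₂ : SmoothField T ψ₂) :
    delta1 B.β φ ψ₁ ψ₂ = pullForm ν (delta1 Th.lam φ ψ₁ ψ₂) + dForm (delta1 B.γ φ ψ₁ ψ₂)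
      + delta1 B.ε φ ψ₁ ψ₂ := by
  have key : ∀ {ψ Y : M → W}, SmoothField T ψ → SmoothField T Y →
      fieldDeriv (fun φ' => B.β φ' ψ) φ Y =
        pullForm ν (fieldDeriv (fun φ' => Th.lam φ' ψ) φ Y)
        + (-fieldDeriv (fun φ' => delta0 B.c φ' ψ) φ Y
          + dForm (fieldDeriv (fun φ' => B.γ φ' ψ) φ Y)
          + fieldDeriv (fun φ' => B.ε φ' ψ) φ Y) := by
    intro ψ Y hψ hY
    have l1 := Th.local_lam.localLin.apply hψ
    have l2 := B.local_c.delta0.localLin.apply hψ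
    have l3 := B.local_γ.localLin.apply hψ
    have l4 := B.local_ε.localLin.apply hψ
    have l5 := B.local_β.localLin.apply hψ
    have l6 := (l2.neg.add (l3.dForm hν.continuous)).add l4
    rw [fieldDeriv_congr l5 ((l1.pullForm hν).add l6)
      (fun φ hφ => by rw [← B.decomp_β φ hφ ψ hψ]; abel) hφ hY,
      fieldDeriv_add (l1.pullForm hν) l6 hφ hY,
      fieldDeriv_add (l2.neg.add (l3.dForm hν.continuous)) l4 hφ hY,
      fieldDeriv_add l2.neg (l3.dForm hν.continuous) hφ hY, fieldDeriv_neg l2 hφ hY,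
      fieldDeriv_dForm l3 hφ hY, fieldDeriv_pullForm l1 hφ hY]
  have h0 := delta1_delta0 B.local_c hφ h₁ h₂
  have s1 := (B.local_γ.localLin.apply h₁).smoothField_fieldDeriv hφ h₂
  have s2 := (B.local_γ.localLin.apply h₂).smoothField_fieldDeriv hφ h₁
  simp only [delta1] at h0 ⊢
  rw [key h₁ h₂, key h₂ h₁, dForm_sub s2 s1, pullForm_sub]
  rw [← sub_eq_zero, ← neg_eq_zero, ← h0]
  abel

end BoundaryData

end Boundary

end CovPhase

namespace CovPhase

/-! ### Charge densities -/

section Densities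

variable {n : ℕ} {W : Type*} [NormedAddCommGroup W] [NormedSpace ℝ W]
  {T : TensorType (n + 3) W} {M : Type*} [TopologicalSpace M]
  [ChartedSpace (Euc (n + 3)) M] [IsManifold 𝓘(ℝ, Euc (n + 3)) ∞ M]
  {N : Type*} [TopologicalSpace N] [ChartedSpace (Euc (n + 2)) N]
  [IsManifold 𝓘(ℝ, Euc (n + 2)) ∞ N]
  {Th : LagrangianTheory T M} {U : Set M} {ν : N → M} (B : BoundaryData N Th ν)
  (P : NoetherPotential Th U) {φ : M → W} {u v w : VField (n + 3) M}

/-- Smooth vector fields tangent to an immersed manifold. -/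
structure SmoothTangent (ν : N → M) (v : VField (n + 3) M) : Prop where
  smooth : SmoothField (vecType (n + 3)) v
  tangentAt : ∀ y, TangentAt (n := n + 3) (m := n + 2) ν v y

namespace SmoothTangent

theorem add (hv : SmoothTangent (N := N) ν v) (hw : SmoothTangent (N := N) ν w) :
    SmoothTangent (N := N) ν (v + w) :=
  ⟨hv.smooth.add hw.smooth, fun y => (hv.tangentAt y).add (hw.tangentAt y)⟩

theorem neg (hv : SmoothTangent (N := N) ν v) : SmoothTangent (N := N) ν (-v) := by
  have e : -v = (-1 : ℝ) • v := by funext x; simp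
  rw [e]
  exact ⟨hv.smooth.smul _, fun y => (hv.tangentAt y).smul _⟩

theorem sub (hv : SmoothTangent (N := N) ν v) (hw : SmoothTangent (N := N) ν w) :
    SmoothTangent (N := N) ν (v - w) := by
  rw [sub_eq_add_neg]; exact hv.add hw.neg

theorem vfBracket (hi : Manifold.IsImmersion 𝓘(ℝ, Euc (n + 2)) 𝓘(ℝ, Euc (n + 3)) ∞ ν)
    (hu : SmoothTangent (N := N) ν u) (hv : SmoothTangent (N := N) ν v) :
    SmoothTangent (N := N) ν (vfBracket u v) :=
  ⟨hu.smooth.vfBracket hv.smooth,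
    vfBracket_tangentAt hi hu.smooth hv.smooth hu.tangentAt hv.tangentAt⟩

theorem pullForm_contract {k : ℕ} (hv : SmoothTangent (N := N) ν v) (α : DForm (n + 3) (k + 1) M) :
    pullForm (m := n + 2) ν (contract v α) = contract (restrictVF ν v) (pullForm ν α) :=
  funext fun y => CovPhase.pullForm_contract (hv.tangentAt y) α

end SmoothTangent

namespace BoundaryData

/-- Charge density up to exact forms. -/
noncomputable def redDensity (φ : M → W) (v : VField (n + 3) M) : DForm (n + 2) (n + 1) N :=
  pullForm ν (P.Q φ v) + contract (restrictVF ν v) (B.totalBoundaryTerm φ)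
    - B.ε φ (lieField T v φ)

/-- Potential of the difference of the charge densities. -/
noncomputable def cornerDensity (φ : M → W) (v : VField (n + 3) M) : DForm (n + 2) n N :=
  contract (restrictVF ν v) (B.c φ) - B.γ φ (lieField T v φ)

variable (hi : Manifold.IsImmersion 𝓘(ℝ, Euc (n + 2)) 𝓘(ℝ, Euc (n + 3)) ∞ ν)
include hi

theorem smoothField_redDensity (hφ : φ ∈ FieldSpace T) (hv : SmoothTangent (N := N) ν v) :
    SmoothField (formType (n + 2) (n + 1)) (B.redDensity P φ v) :=
  (((P.smoothField_Q hφ hv.smooth).pullForm hi.contMDiff).add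
    ((SmoothField.restrictVF hi hv.smooth hv.tangentAt).contract
      ((B.local_totalBoundaryTerm hi.contMDiff).smoothField hφ))).sub
    (B.local_ε.localLin.smoothField hφ (hv.smooth.lieField hφ.1))

theorem smoothField_cornerDensity (hφ : φ ∈ FieldSpace T) (hv : SmoothTangent (N := N) ν v) :
    SmoothField (formType (n + 2) n) (B.cornerDensity φ v) :=
  ((SmoothField.restrictVF hi hv.smooth hv.tangentAt).contract
      (B.local_c.smoothField hφ)).sub
    (B.local_γ.localLin.smoothField hφ (hv.smooth.lieField hφ.1))

/-- The corner decomposition turns `I_v̂ (λ' - β')` into `I_v̂ δc' - d I_v̂ γ' - I_v̂ ε`.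
Subtracting `Δ_v̂ c'` cancels `I_v̂ δc'` and adds `£_v c' = i_v dc' + d i_v c'`: the first part
completes `ℬ`, the second is exact. -/
theorem impDensity_eq (hφ : φ ∈ FieldSpace T) (hv : SmoothTangent (N := N) ν v) :
    B.impDensity P φ v = B.redDensity P φ v + dForm (B.cornerDensity φ v) := by
  have hX : SmoothField T (lieField T v φ) := hv.smooth.lieField hφ.1
  have hc : SmoothField (formType (n + 2) (n + 1)) (B.c φ) := B.local_c.smoothField hφ
  have hv' := SmoothField.restrictVF hi hv.smooth hv.tangentAt
  have h := B.decomp_β φ hφ _ hX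
  simp only [impDensity, density, noetherCharge, redDensity, cornerDensity, totalBoundaryTerm,
    anomaly0, lieForm, pullForm_add, contract_add, hv.pullForm_contract]
  rw [dForm_sub (hv'.contract hc) (B.local_γ.localLin.smoothField hφ hX)]
  change _ = -fieldDeriv B.c φ (lieField T v φ) + _ + _ at h
  rw [← sub_eq_zero, ← neg_eq_zero] at h
  rw [← sub_eq_zero, ← h]
  abel

theorem smoothField_impDensity (hφ : φ ∈ FieldSpace T) (hv : SmoothTangent (N := N) ν v) :
    SmoothField (formType (n + 2) (n + 1)) (B.impDensity P φ v) := by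
  rw [B.impDensity_eq P hi hφ hv]
  exact (B.smoothField_redDensity P hi hφ hv).add (B.smoothField_cornerDensity hi hφ hv).dForm

theorem impDensity_add (hφ : φ ∈ FieldSpace T) (hv : SmoothTangent (N := N) ν v)
    (hw : SmoothTangent (N := N) ν w) :
    B.impDensity P φ (v + w) = B.impDensity P φ v + B.impDensity P φ w := by
  have e1 : restrictVF (m := n + 2) ν (v + w) = restrictVF ν v + restrictVF ν w :=
    funext fun y => restrictVF_add hi (hv.tangentAt y) (hw.tangentAt y)
  have e2 := lieField_add_left (T := T) (φ := φ) hv.smooth hw.smooth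
  have hX := hv.smooth.lieField (T := T) hφ.1
  have hX' := hw.smooth.lieField (T := T) hφ.1
  rw [B.impDensity_eq P hi hφ (hv.add hw), B.impDensity_eq P hi hφ hv,
    B.impDensity_eq P hi hφ hw]
  have e3 : B.cornerDensity φ (v + w) = B.cornerDensity φ v + B.cornerDensity φ w := by
    simp only [cornerDensity]
    rw [e1, e2, B.local_γ.add φ hφ _ _ hX hX', contract_add_left]
    abel
  rw [e3, dForm_add (B.smoothField_cornerDensity hi hφ hv) (B.smoothField_cornerDensity hi hφ hw)]
  simp only [redDensity]
  rw [e1, e2, B.local_ε.add φ hφ _ _ hX hX', contract_add_left,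
    P.local_Q.add φ hφ _ _ hv.smooth hw.smooth, pullForm_add]
  abel

theorem impDensity_sub (hφ : φ ∈ FieldSpace T) (hv : SmoothTangent (N := N) ν v)
    (hw : SmoothTangent (N := N) ν w) :
    B.impDensity P φ (v - w) = B.impDensity P φ v - B.impDensity P φ w := by
  have h := B.impDensity_add P hi hφ (hv.sub hw) hw
  rw [sub_add_cancel] at h
  rw [h, add_sub_cancel_right]

-- Pure locality, valid also at fields that are not admissible; this permits replacing the line `φ +
-- t Y` by an admissible family.
omit hi in
theorem impDensity_congr (hν : Continuous ν) {φ φ' : M → W} {v v' : VField (n + 3) M} {y : N}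
    (h : φ =ᶠ[𝓝 (ν y)] φ') (h' : v =ᶠ[𝓝 (ν y)] v') :
    B.impDensity P φ v y = B.impDensity P φ' v' y := by
  have hX : lieField T v φ =ᶠ[𝓝 (ν y)] lieField T v' φ' := by
    filter_upwards [eventually_eventually_nhds.2 h, eventually_eventually_nhds.2 h'] with x hx hx'
    exact lieField_congr hx' hx
  have hr := restrictVF_eventuallyEq (l := n + 2) hν h'
  have hQ : P.Q φ v (ν y) = P.Q φ' v' (ν y) := P.local_Q.isLocal _ _ _ _ (ν y) h h'
  have hb : Th.b φ (ν y) = Th.b φ' (ν y) := Th.local_b.isLocal _ _ (ν y) h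
  have hl : Th.lam φ (lieField T v φ) (ν y) = Th.lam φ' (lieField T v' φ') (ν y) :=
    Th.local_lam.isLocal _ _ _ _ (ν y) h hX
  have he : B.ell φ y = B.ell φ' y := B.local_ell.isLocal _ _ y h
  have hβ : B.β φ (lieField T v φ) y = B.β φ' (lieField T v' φ') y :=
    B.local_β.isLocal _ _ _ _ y h hX
  have hdc : delta0 B.c φ (lieField T v φ) y = delta0 B.c φ' (lieField T v' φ') y :=
    B.local_c.delta0.isLocal _ _ _ _ y h hX
  have hc := lieForm_congr hr (B.local_c.eventuallyEq hν h)
  simp only [impDensity, density, noetherCharge, anomaly0, Pi.add_apply, Pi.sub_apply, pullForm,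
    contract, hQ, hb, hl, he, hβ, hc, hr.self_of_nhds, h'.self_of_nhds]
  simp only [delta0] at hdc
  rw [hdc]

omit hi in
theorem redDensity_congr (hν : ContMDiff 𝓘(ℝ, Euc (n + 2)) 𝓘(ℝ, Euc (n + 3)) ∞ ν)
    {φ φ' : M → W} {v v' : VField (n + 3) M} {y : N}
    (h : φ =ᶠ[𝓝 (ν y)] φ') (h' : v =ᶠ[𝓝 (ν y)] v') :
    B.redDensity P φ v y = B.redDensity P φ' v' y := by
  have hX : lieField T v φ =ᶠ[𝓝 (ν y)] lieField T v' φ' := by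
    filter_upwards [eventually_eventually_nhds.2 h, eventually_eventually_nhds.2 h'] with x hx hx'
    exact lieField_congr hx' hx
  have hr := restrictVF_eventuallyEq (l := n + 2) hν.continuous h'
  have hQ : P.Q φ v (ν y) = P.Q φ' v' (ν y) := P.local_Q.isLocal _ _ _ _ (ν y) h h'
  have he := (B.local_totalBoundaryTerm hν).isLocal _ _ y h
  have hβ : B.ε φ (lieField T v φ) y = B.ε φ' (lieField T v' φ') y :=
    B.local_ε.isLocal _ _ _ _ y h hX
  simp only [redDensity, Pi.add_apply, Pi.sub_apply, pullForm, contract, hQ, he, hβ,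
    hr.self_of_nhds]

end BoundaryData

end Densities

end CovPhase

namespace CovPhase

/-! ### Charges -/

section Charges

variable {n : ℕ} {W : Type*} [NormedAddCommGroup W] [NormedSpace ℝ W] [FiniteDimensional ℝ W]
  {T : TensorType (n + 3) W} {M : Type*} [TopologicalSpace M] [T2Space M]
  [SecondCountableTopology M] [ChartedSpace (Euc (n + 3)) M] [IsManifold 𝓘(ℝ, Euc (n + 3)) ∞ M]
  {N : Type*} [TopologicalSpace N] [ChartedSpace (Euc (n + 2)) N]
  [IsManifold 𝓘(ℝ, Euc (n + 2)) ∞ N]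
  {Th : LagrangianTheory T M} {U : Set M} {ν : N → M} (B : BoundaryData N Th ν)
  (P : NoetherPotential Th U) {φ : M → W} {u v : VField (n + 3) M}
  {ξ ζ : (M → W) → VField (n + 3) M}

theorem IsGenerator.smoothTangent (hζ : IsGenerator (l := n + 2) T ν ζ) (hφ : φ ∈ FieldSpace T) :
    SmoothTangent (N := N) ν (ζ φ) :=
  ⟨hζ.isSmoothGen.smoothField hφ, hζ.tangentAt hφ⟩

theorem IsGenerator.smoothTangent_fieldDeriv
    (hi : Manifold.IsImmersion 𝓘(ℝ, Euc (n + 2)) 𝓘(ℝ, Euc (n + 3)) ∞ ν)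
    (hζ : IsGenerator (l := n + 2) T ν ζ) (hφ : φ ∈ FieldSpace T)
    {Y : M → W} (hY : SmoothField T Y) : SmoothTangent (N := N) ν (fieldDeriv ζ φ Y) :=
  ⟨hζ.isSmoothGen.smoothField_fieldDeriv hφ hY, hζ.tangentAt_fieldDeriv hi hφ hY⟩

namespace BoundaryData

/-- Integrand of the flux. -/
noncomputable def fluxDensity (ξ : (M → W) → VField (n + 3) M) (φ ψ : M → W) :
    DForm (n + 2) (n + 1) N :=
  contract (restrictVF ν (ξ φ)) (B.flux φ ψ)
    - (fieldDeriv (fun φ' => B.ε φ' ψ) φ (hat T ξ φ) + B.ε φ (lieField T (ξ φ) ψ)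
      - lieForm (restrictVF ν (ξ φ)) (B.ε φ ψ))
    + B.impDensity P φ (fieldDeriv ξ φ ψ)

theorem impFlux_eq (cut : Chain (n + 2) (n + 1) N) (hξ : IsGenerator (l := n + 2) T ν ξ)
    (hφ : φ ∈ FieldSpace T) {ψ : M → W} (hψ : SmoothField T ψ) :
    B.impFlux P cut ξ φ ψ = cut.integral (B.fluxDensity P ξ φ ψ) := by
  unfold impFlux
  rw [anomaly1_eq B.local_ε hξ.isSmoothGen hφ hψ]
  rfl

/-- Integrand over the cut of the symplectic form of two diffeomorphisms. -/
noncomputable def sympDensity (φ : M → W) (u v : VField (n + 3) M) : DForm (n + 2) (n + 1) N :=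
  contract (restrictVF ν v) (-fieldDeriv B.totalBoundaryTerm φ (lieField T u φ)
      + dForm (B.ε φ (lieField T u φ)) + B.flux φ (lieField T u φ))
    - contract (restrictVF ν u) (-fieldDeriv B.totalBoundaryTerm φ (lieField T v φ)
      + dForm (B.ε φ (lieField T v φ)) + B.flux φ (lieField T v φ))
    + pullForm ν (P.Q φ (vfBracket u v))
    - (dForm (delta1 B.γ φ (lieField T v φ) (lieField T u φ))
      + delta1 B.ε φ (lieField T v φ) (lieField T u φ))

variable (hi : Manifold.IsImmersion 𝓘(ℝ, Euc (n + 2)) 𝓘(ℝ, Euc (n + 3)) ∞ ν)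
include hi

-- `i_u L` pulls back to the contraction of a `(d+1)`-form on the `d`-dimensional `N`, which is
-- zero; only the potential contributes.
omit [FiniteDimensional ℝ W] [T2Space M] [SecondCountableTopology M] in
theorem pullForm_covNoetherCurrent (hφ : φ ∈ FieldSpace T) (hu : SmoothTangent (N := N) ν u) :
    pullForm (m := n + 2) ν (Th.covNoetherCurrent φ u) =
      -fieldDeriv B.totalBoundaryTerm φ (lieField T u φ)
      + dForm (B.ε φ (lieField T u φ)) + B.flux φ (lieField T u φ) := by
  rw [← B.pullForm_covθ hi.contMDiff hφ (hu.smooth.lieField hφ.1)]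
  simp only [LagrangianTheory.covNoetherCurrent, pullForm_sub, hu.pullForm_contract]
  rw [DForm.eq_zero_of_lt (by omega) (pullForm ν (Th.covL φ)), contract_zero, sub_zero]

/-- The `δλ'` in the bulk potential is cancelled by the one inside `δβ'`, which leaves `δγ'` and
`δε`. This is the purpose of the corner term in the symplectic form. -/
theorem sympDensity_eq (hφ : φ ∈ FieldSpace T) (hu : SmoothTangent (N := N) ν u)
    (hv : SmoothTangent (N := N) ν v) :
    B.sympDensity P φ u v =
      pullForm ν (P.potential φ u v) - delta1 B.β φ (lieField T v φ) (lieField T u φ) := by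
  rw [B.delta1_β hi.contMDiff hφ (hv.smooth.lieField hφ.1) (hu.smooth.lieField hφ.1)]
  simp only [sympDensity, NoetherPotential.potential, pullForm_add, pullForm_sub,
    hu.pullForm_contract, hv.pullForm_contract, ← B.pullForm_covNoetherCurrent hi hφ hu,
    ← B.pullForm_covNoetherCurrent hi hφ hv]
  rw [DForm.eq_zero_of_lt (by omega) (pullForm ν (Th.covL φ)), contract_zero, contract_zero]
  abel

theorem smoothField_sympDensity (hφ : φ ∈ FieldSpace T) (hu : SmoothTangent (N := N) ν u)
    (hv : SmoothTangent (N := N) ν v) :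
    SmoothField (formType (n + 2) (n + 1)) (B.sympDensity P φ u v) := by
  rw [B.sympDensity_eq P hi hφ hu hv]
  exact ((P.smoothField_potential hφ hu.smooth hv.smooth).pullForm hi.contMDiff).sub
    (B.local_β.smoothField_delta1 hφ (hv.smooth.lieField hφ.1) (hu.smooth.lieField hφ.1))

theorem smoothField_fluxDensity (hξ : IsGenerator (l := n + 2) T ν ξ) (hφ : φ ∈ FieldSpace T)
    {ψ : M → W} (hψ : SmoothField T ψ) :
    SmoothField (formType (n + 2) (n + 1)) (B.fluxDensity P ξ φ ψ) := by
  have hu := hξ.smoothTangent hφ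
  have hu' := SmoothField.restrictVF hi hu.smooth hu.tangentAt
  have s1 := hu'.contract (B.local_flux.localLin.smoothField hφ hψ)
  have s2 := (B.local_ε.localLin.apply hψ).smoothField_fieldDeriv hφ
    (hξ.isSmoothGen.smoothField_hat hφ)
  have s3 := B.local_ε.localLin.smoothField hφ (hu.smooth.lieField hψ)
  have s4 := hu'.lieForm (B.local_ε.localLin.smoothField hφ hψ)
  exact (s1.sub ((s2.add s3).sub s4)).add
    (B.smoothField_impDensity P hi hφ (hξ.smoothTangent_fieldDeriv hi hφ hψ))

/-- The symplectic form of two diffeomorphisms is localized on the cut, on shell. -/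
theorem sympForm_eq (hU : IsOpen U) (hφ : φ ∈ Th.Solutions U)
    (hu : SmoothTangent (N := N) ν u) (hv : SmoothTangent (N := N) ν v)
    {slice : Chain (n + 3) (n + 2) M} {cut : Chain (n + 2) (n + 1) N}
    (hslice : ∀ σ ∈ slice.support, ∀ t ∈ Set.Icc (0 : Fin (n + 2) → ℝ) 1, σ.map t ∈ closure U)
    (hcut : slice.boundary = cut.push ν hi.contMDiff) :
    B.sympForm cut slice φ (lieField T v φ) (lieField T u φ) =
      cut.integral (B.sympDensity P φ u v) := by
  have hX : SmoothField T (lieField T v φ) := hv.smooth.lieField hφ.1.1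
  have hY : SmoothField T (lieField T u φ) := hu.smooth.lieField hφ.1.1
  have hp := P.smoothField_potential hφ.1 hu.smooth hv.smooth
  rw [B.sympDensity_eq P hi hφ.1 hu hv, Chain.integral_sub _ (hp.pullForm hi.contMDiff)
    (B.local_β.smoothField_delta1 hφ.1 hX hY), ← Chain.integral_push hi.contMDiff, ← hcut,
    ← Chain.integral_dForm _ hp]
  unfold sympForm
  -- The slice lies in the closure of `U`, where the current is exact on shell; Stokes' theorem has
  -- already been applied to the other side.
  rw [slice.integral_congr fun σ hσ s hs =>
    P.sympCurrent_eqOn hU hφ hu.smooth hv.smooth (hslice σ hσ s hs)]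

/-- Pointwise charge algebra. -/
theorem charge_algebra (hφ : φ ∈ FieldSpace T) (hξ : IsGenerator (l := n + 2) T ν ξ)
    (hζ : IsGenerator (l := n + 2) T ν ζ) :
    B.sympDensity P φ (ξ φ) (ζ φ) - B.fluxDensity P ζ φ (hat T ξ φ)
        + B.fluxDensity P ξ φ (hat T ζ φ) =
      B.impDensity P φ (modBracket T ξ ζ φ)
      + (contract (restrictVF ν (ξ φ))
          (anomaly0 T B.totalBoundaryTerm φ (ζ φ) (restrictVF ν (ζ φ)))
        - contract (restrictVF ν (ζ φ))
          (anomaly0 T B.totalBoundaryTerm φ (ξ φ) (restrictVF ν (ξ φ))))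
      + dForm (-delta1 B.γ φ (hat T ζ φ) (hat T ξ φ)
        - contract (restrictVF ν (ζ φ)) (B.ε φ (hat T ξ φ))
        + contract (restrictVF ν (ξ φ)) (B.ε φ (hat T ζ φ))
        - contract (restrictVF ν (ξ φ)) (contract (restrictVF ν (ζ φ)) (B.totalBoundaryTerm φ))
        - B.cornerDensity φ (vfBracket (ξ φ) (ζ φ))) := by
  have hu := hξ.smoothTangent hφ
  have hv := hζ.smoothTangent hφ
  have hX : SmoothField T (hat T ζ φ) := hζ.isSmoothGen.smoothField_hat hφ
  have hY : SmoothField T (hat T ξ φ) := hξ.isSmoothGen.smoothField_hat hφ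
  have hwζ := hζ.smoothTangent_fieldDeriv hi hφ hY
  have hwξ := hξ.smoothTangent_fieldDeriv hi hφ hX
  have hb := hu.vfBracket hi hv
  have hu' := SmoothField.restrictVF hi hu.smooth hu.tangentAt
  have hv' := SmoothField.restrictVF hi hv.smooth hv.tangentAt
  have hℬ := (B.local_totalBoundaryTerm hi.contMDiff).smoothField hφ
  have hεX := B.local_ε.localLin.smoothField hφ hX
  have hεY := B.local_ε.localLin.smoothField hφ hY
  -- By additivity the two corrections in the modified bracket are the densities of `δζ` and `δξ`
  -- that the fluxes contain, so only the density of `[ξ, ζ]` has to be matched.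
  have e1 : B.impDensity P φ (modBracket T ξ ζ φ) =
      B.redDensity P φ (vfBracket (ξ φ) (ζ φ)) + dForm (B.cornerDensity φ (vfBracket (ξ φ) (ζ φ)))
      - B.impDensity P φ (fieldDeriv ζ φ (hat T ξ φ))
      + B.impDensity P φ (fieldDeriv ξ φ (hat T ζ φ)) := by
    simp only [modBracket]
    rw [B.impDensity_add P hi hφ (hb.sub hwζ) hwξ, B.impDensity_sub P hi hφ hb hwζ,
      B.impDensity_eq P hi hφ hb]
  -- With `dℬ = 0` one has `i_[ξ,ζ] ℬ = d i_ξ i_ζ ℬ + i_ξ d i_ζ ℬ - i_ζ d i_ξ ℬ`. The last two terms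
  -- turn the field derivatives of `ℬ` into its anomalies.
  have e2 := contract_vfBracket hu' hv' hℬ
  rw [DForm.eq_zero_of_lt (by omega) (dForm (B.totalBoundaryTerm φ)), contract_zero,
    contract_zero, sub_zero] at e2
  -- The field derivatives of `ε` in `δε` cancel those in the fluxes; the second Lie derivatives
  -- left over combine into `ε` on `£_[ξ,ζ] φ`.
  have e3 := B.local_ε.localLin.sub hφ (hu.smooth.lieField hX) (hv.smooth.lieField hY)
  have e4 : lieField T (ξ φ) (hat T ζ φ) - lieField T (ζ φ) (hat T ξ φ) =
    lieField T (vfBracket (ξ φ) (ζ φ)) φ := lieField_commutator hu.smooth hv.smooth hφ.1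
  rw [e4] at e3
  have s1 := B.local_γ.smoothField_delta1 hφ hX hY
  have s2 := hv'.contract hεY
  have s3 := hu'.contract hεX
  have s4 := hu'.contract (hv'.contract hℬ)
  have s5 := B.smoothField_cornerDensity hi hφ hb
  rw [e1, dForm_sub (((s1.neg.sub s2).add s3).sub s4) s5, dForm_sub ((s1.neg.sub s2).add s3) s4,
    dForm_add (s1.neg.sub s2) s3, dForm_sub s1.neg s2, dForm_neg]
  have hX' : lieField T (ζ φ) φ = hat T ζ φ := rfl
  have hY' : lieField T (ξ φ) φ = hat T ξ φ := rfl
  simp only [sympDensity, fluxDensity, redDensity, anomaly0, lieForm, contract_add, contract_sub,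
    restrictVF_vfBracket hi hu.smooth hv.smooth hu.tangentAt hv.tangentAt, e2, e3, hX', hY',
    delta1, DForm.eq_zero_of_lt (show n + 2 < n + 2 + 1 by omega) (dForm (B.totalBoundaryTerm φ)),
    contract_zero]
  simp only [contract_neg]
  abel

/-- Pointwise variation of the charge density. -/
theorem charge_variation (hU : ∀ y, ν y ∈ closure U) (hφ : φ ∈ Th.Solutions U)
    (hξ : IsGenerator (l := n + 2) T ν ξ) (hζ : IsGenerator (l := n + 2) T ν ζ) :
    pullForm ν (fieldDeriv (fun φ' => P.Q φ' (ζ φ)) φ (hat T ξ φ)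
        + P.Q φ (fieldDeriv ζ φ (hat T ξ φ)))
      + (contract (restrictVF ν (ζ φ)) (fieldDeriv B.totalBoundaryTerm φ (hat T ξ φ))
        + contract (restrictVF ν (fieldDeriv ζ φ (hat T ξ φ))) (B.totalBoundaryTerm φ))
      - (fieldDeriv (fun φ' => B.ε φ' (hat T ζ φ)) φ (hat T ξ φ)
        + (B.ε φ (lieField T (fieldDeriv ζ φ (hat T ξ φ)) φ)
          + B.ε φ (lieField T (ζ φ) (hat T ξ φ)))) =
      B.fluxDensity P ζ φ (hat T ξ φ) - B.sympDensity P φ (ξ φ) (ζ φ)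
      + dForm (contract (restrictVF ν (ξ φ)) (pullForm ν (P.Q φ (ζ φ)))
        - contract (restrictVF ν (ζ φ)) (B.ε φ (hat T ξ φ))
        - B.cornerDensity φ (fieldDeriv ζ φ (hat T ξ φ))
        - delta1 B.γ φ (hat T ζ φ) (hat T ξ φ)) := by
  have hu := hξ.smoothTangent hφ.1
  have hv := hζ.smoothTangent hφ.1
  have hX : SmoothField T (hat T ζ φ) := hζ.isSmoothGen.smoothField_hat hφ.1
  have hY : SmoothField T (hat T ξ φ) := hξ.isSmoothGen.smoothField_hat hφ.1
  have hw := hζ.smoothTangent_fieldDeriv hi hφ.1 hY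
  have hu' := SmoothField.restrictVF hi hu.smooth hu.tangentAt
  have hv' := SmoothField.restrictVF hi hv.smooth hv.tangentAt
  have hQ := P.smoothField_Q hφ.1 hv.smooth
  have hX' : lieField T (ζ φ) φ = hat T ζ φ := rfl
  have hY' : lieField T (ξ φ) φ = hat T ξ φ := rfl
  -- Here the field equations enter: on the boundary `dQ_ζ` is the pulled-back Noether current.
  have e1 : dForm (pullForm (m := n + 2) ν (P.Q φ (ζ φ))) =
      -fieldDeriv B.totalBoundaryTerm φ (hat T ζ φ)
      + dForm (B.ε φ (hat T ζ φ)) + B.flux φ (hat T ζ φ) := by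
    have e := B.pullForm_covNoetherCurrent hi hφ.1 hv
    rw [hX'] at e
    rw [dForm_pullForm hi.contMDiff hQ, ← e]
    funext y
    simp only [pullForm, P.dForm_Q hφ hv.smooth (hU y)]
  -- Covariance of `Q` with Cartan's formula for `£_ξ`. Its part `i_ξ dQ_ζ` supplies the `i_ξ` term
  -- of the symplectic density, and `-Q_[ξ,ζ]` the term with the bracket.
  have e2 : pullForm (m := n + 2) ν (fieldDeriv (fun φ' => P.Q φ' (ζ φ)) φ (hat T ξ φ)) =
      contract (restrictVF ν (ξ φ)) (dForm (pullForm ν (P.Q φ (ζ φ))))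
      + dForm (contract (restrictVF ν (ξ φ)) (pullForm ν (P.Q φ (ζ φ))))
      - pullForm ν (P.Q φ (vfBracket (ξ φ) (ζ φ))) := by
    have e := P.fieldDeriv_Q hφ.1 hu.smooth hv.smooth
    rw [hY'] at e
    rw [e]
    simp only [lieForm, pullForm_sub, pullForm_add, hu.pullForm_contract]
    rw [← dForm_pullForm hi.contMDiff hQ, ← hu.pullForm_contract,
      ← dForm_pullForm hi.contMDiff (hu.smooth.contract hQ)]
  have s1 := hu'.contract (hQ.pullForm hi.contMDiff)
  have s2 := hv'.contract (B.local_ε.localLin.smoothField hφ.1 hY)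
  have s3 := B.smoothField_cornerDensity hi hφ.1 hw
  have s4 := B.local_γ.smoothField_delta1 hφ.1 hX hY
  rw [dForm_sub ((s1.sub s2).sub s3) s4, dForm_sub (s1.sub s2) s3, dForm_sub s1 s2]
  simp only [fluxDensity, sympDensity, pullForm_add, e2, B.impDensity_eq P hi hφ.1 hw, e1,
    redDensity, lieForm, hX', hY', delta1, contract_add, contract_neg]
  abel

end BoundaryData

end Charges

end CovPhase

namespace CovPhase

/-! ### Variation of the charges and the charge algebra -/

section Algebra

variable {n : ℕ} {W : Type*} [NormedAddCommGroup W] [NormedSpace ℝ W] [FiniteDimensional ℝ W]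
  {T : TensorType (n + 3) W} {M : Type*} [TopologicalSpace M] [T2Space M]
  [SecondCountableTopology M] [ChartedSpace (Euc (n + 3)) M] [IsManifold 𝓘(ℝ, Euc (n + 3)) ∞ M]
  {N : Type*} [TopologicalSpace N] [ChartedSpace (Euc (n + 2)) N]
  [IsManifold 𝓘(ℝ, Euc (n + 2)) ∞ N]
  {Th : LagrangianTheory T M} {U : Set M} {ν : N → M} (B : BoundaryData N Th ν)
  (P : NoetherPotential Th U) {φ : M → W}
  {ξ ζ : (M → W) → VField (n + 3) M}

theorem Chain.integral_dForm_eq_zero {l k : ℕ} {X : Type*} [TopologicalSpace X]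
    [ChartedSpace (Euc l) X] [IsManifold 𝓘(ℝ, Euc l) ∞ X] {c : Chain l (k + 1) X}
    (hc : c.boundary = 0) {α : DForm l k X} (hα : SmoothField (formType l k) α) :
    c.integral (dForm α) = 0 := by
  rw [c.integral_dForm hα, hc, Chain.integral_zero_chain]

/-- The compact set of points of a chain. -/
def Chain.carrier {l k : ℕ} {X : Type*} [TopologicalSpace X] [ChartedSpace (Euc l) X]
    (c : Chain l k X) : Set X := ⋃ σ ∈ c.support, σ.map '' Icc (0 : Fin k → ℝ) 1

theorem Chain.isCompact_carrier {l k : ℕ} {X : Type*} [TopologicalSpace X]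
    [ChartedSpace (Euc l) X] (c : Chain l k X) : IsCompact c.carrier :=
  c.support.isCompact_biUnion fun σ _ => isCompact_Icc.image σ.smooth.continuous

theorem Chain.mem_carrier {l k : ℕ} {X : Type*} [TopologicalSpace X]
    [ChartedSpace (Euc l) X] {c : Chain l k X} {σ : SmoothCube l k X} (hσ : σ ∈ c.support)
    {s : Fin k → ℝ} (hs : s ∈ Icc (0 : Fin k → ℝ) 1) : σ.map s ∈ c.carrier :=
  mem_biUnion (t := fun σ : SmoothCube l k X => σ.map '' Icc (0 : Fin k → ℝ) 1) hσ
    (mem_image_of_mem _ hs)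

namespace BoundaryData

variable (hi : Manifold.IsImmersion 𝓘(ℝ, Euc (n + 2)) 𝓘(ℝ, Euc (n + 3)) ∞ ν)
include hi

/-- The derivative is left in the shape of the left side of `charge_variation`, with the variation
of `ζ` kept apart from that of the fields. -/
theorem hasDerivAt_redDensity (hφ : φ ∈ FieldSpace T) (hζ : IsGenerator (l := n + 2) T ν ζ)
    {Y : M → W} (hY : SmoothField T Y) (y : N) :
    HasDerivAt (fun t : ℝ => B.redDensity P (φ + t • Y) (ζ (φ + t • Y)) y)
      ((pullForm (m := n + 2) ν (fieldDeriv (fun φ' => P.Q φ' (ζ φ)) φ Y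
        + P.Q φ (fieldDeriv ζ φ Y))
      + (contract (restrictVF ν (ζ φ)) (fieldDeriv B.totalBoundaryTerm φ Y)
        + contract (restrictVF ν (fieldDeriv ζ φ Y)) (B.totalBoundaryTerm φ))
      - (fieldDeriv (fun φ' => B.ε φ' (hat T ζ φ)) φ Y
        + (B.ε φ (lieField T (fieldDeriv ζ φ Y) φ) + B.ε φ (lieField T (ζ φ) Y))) :
        DForm (n + 2) (n + 1) N) y) 0 := by
  have h1 : HasDerivAt (fun t : ℝ => pullForm (m := n + 2) ν
      (P.Q (φ + t • Y) (ζ (φ + t • Y))) y)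
      (pullForm (m := n + 2) ν (fieldDeriv (fun φ' => P.Q φ' (ζ φ)) φ Y
        + P.Q φ (fieldDeriv ζ φ Y)) y) 0 :=
    hasDerivAt_pullForm (P.local_Q.hasDerivAt hζ.isSmoothGen hφ hY (ν y))
  have h2 := ((B.local_totalBoundaryTerm hi.contMDiff).hasDerivAt_line hφ hY y).curryLeft
    (hζ.hasDerivAt_restrictVF hi hφ hY y)
  simp only [zero_smul, add_zero] at h2
  have h3 := B.local_ε.hasDerivAt_hat hζ.isSmoothGen hφ hY y
  exact (h1.add h2).sub h3

omit [T2Space M] [SecondCountableTopology M] in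
theorem smoothFam_redDensity (hζ : IsGenerator (l := n + 2) T ν ζ) {Φ : ℝ → M → W}
    (hs : ∀ t x, SmoothFam T Φ t x) (hF : ∀ t, Φ t ∈ FieldSpace T) (t : ℝ) (y : N) :
    SmoothFam (formType (n + 2) (n + 1)) (fun t => B.redDensity P (Φ t) (ζ (Φ t))) t y := by
  have hg := hζ.isSmoothGen
  have h1 := (P.local_Q.localLin.smoothFam hs (fun t x => hg.smoothFam hs (hF t) x) (hF t)
    (ν y)).pullForm hi.contMDiff
  have h2 := (hζ.smoothFam_restrictVF hi hs (hF t) y).contract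
    ((B.local_totalBoundaryTerm hi.contMDiff).smoothFam hs (hF t) y)
  have h3 := B.local_ε.localLin.smoothFam hs
    (fun t x => (hg.smoothFam hs (hF t) x).lieField (hs t x)) (hF t) y
  simpa only [redDensity, sub_eq_add_neg] using (h1.add h2).add h3.neg

/-- Near the cut the line is replaced by an admissible family, on which the charge is the integral
of the reduced density. Differentiation under the integral and `charge_variation` give the value,
its exact part integrating to zero over the cycle. -/
theorem hasDerivAt_impCharge (hU : ∀ y, ν y ∈ closure U) (hφ : φ ∈ Th.Solutions U)
    (hξ : IsGenerator (l := n + 2) T ν ξ) (hζ : IsGenerator (l := n + 2) T ν ζ)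
    {cut : Chain (n + 2) (n + 1) N} (hc : cut.boundary = 0) :
    HasDerivAt (fun t : ℝ => B.impCharge P cut ζ (φ + t • hat T ξ φ))
      (cut.integral (B.fluxDensity P ζ φ (hat T ξ φ))
        - cut.integral (B.sympDensity P φ (ξ φ) (ζ φ))) 0 := by
  have hu := hξ.smoothTangent hφ.1
  have hv := hζ.smoothTangent hφ.1
  have hY : SmoothField T (hat T ξ φ) := hξ.isSmoothGen.smoothField_hat hφ.1
  have hX : SmoothField T (hat T ζ φ) := hζ.isSmoothGen.smoothField_hat hφ.1
  obtain ⟨Φ, V, hV, hKV, hs, hF, h0, hev⟩ := hζ.isSmoothGen.exists_localization hφ.1 hY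
    (cut.isCompact_carrier.image hi.contMDiff.continuous)
  have hmem : ∀ σ ∈ cut.support, ∀ s ∈ Icc (0 : Fin (n + 1) → ℝ) 1, V ∈ 𝓝 (ν (σ.map s)) :=
    fun σ hσ s hs => hV.mem_nhds (hKV (mem_image_of_mem ν (Chain.mem_carrier hσ hs)))
  have hch : (fun t : ℝ => B.impCharge P cut ζ (φ + t • hat T ξ φ)) =ᶠ[𝓝 0]
      fun t => cut.integral (B.redDensity P (Φ t) (ζ (Φ t))) := by
    filter_upwards [hev] with t ht
    have hvt := hζ.smoothTangent (hF t)
    have e1 : B.impCharge P cut ζ (φ + t • hat T ξ φ) =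
        cut.integral (B.impDensity P (Φ t) (ζ (Φ t))) :=
      cut.integral_congr fun σ hσ s hs => (B.impDensity_congr P hi.contMDiff.continuous
        (Filter.eventually_of_mem (hmem σ hσ s hs) fun x hx => (ht x hx).1)
        (Filter.eventually_of_mem (hmem σ hσ s hs) fun x hx => (ht x hx).2)).symm
    -- The exact corner part is dropped before differentiating, so its derivative is never needed.
    rw [e1, B.impDensity_eq P hi (hF t) hvt,
      cut.integral_add (B.smoothField_redDensity P hi (hF t) hvt)
      (B.smoothField_cornerDensity hi (hF t) hvt).dForm,
      Chain.integral_dForm_eq_zero hc (B.smoothField_cornerDensity hi (hF t) hvt), add_zero]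
  have hd := cut.hasDerivAt_integral (t := 0) fun σ _ s _ =>
    B.smoothFam_redDensity P hi hζ hs hF 0 (σ.map s)
  refine (hd.congr_of_eventuallyEq hch).congr_deriv ?_
  have hcv := B.charge_variation P hi hU hφ hξ hζ
  have hη := (((SmoothField.restrictVF hi hu.smooth hu.tangentAt).contract
    ((P.smoothField_Q hφ.1 hv.smooth).pullForm hi.contMDiff)).sub
    ((SmoothField.restrictVF hi hv.smooth hv.tangentAt).contract
      (B.local_ε.localLin.smoothField hφ.1 hY))).sub
    (B.smoothField_cornerDensity hi hφ.1 (hζ.smoothTangent_fieldDeriv hi hφ.1 hY)) |>.sub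
    (B.local_γ.smoothField_delta1 hφ.1 hX hY)
  have s1 := B.smoothField_fluxDensity P hi hζ hφ.1 hY
  have s2 := B.smoothField_sympDensity P hi hφ.1 hu hv
  have hI := cut.integral_add (s1.sub s2) hη.dForm
  rw [Chain.integral_dForm_eq_zero hc hη, add_zero, ← hcv, cut.integral_sub s1 s2] at hI
  rw [← hI]
  refine cut.integral_congr fun σ hσ s hs => ?_
  -- The pointwise derivative is computed on the line itself, to which the family is equal near the
  -- cut for small `t`; the product rules were stated there.
  refine Eq.trans (Filter.EventuallyEq.deriv_eq ?_)
    (B.hasDerivAt_redDensity P hi hφ.1 hζ hY (σ.map s)).deriv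
  filter_upwards [hev] with t ht
  exact B.redDensity_congr P hi.contMDiff
    (Filter.eventually_of_mem (hmem σ hσ s hs) fun x hx => (ht x hx).1)
    (Filter.eventually_of_mem (hmem σ hσ s hs) fun x hx => (ht x hx).2)

end BoundaryData

end Algebra

end CovPhase

/-- Corner-improved charge algebra: on shell, the Barnich-Troessaert bracket of the improved charges
is `-I_ξ̂ δH̃_ζ + I_ζ̂ 𝓕̃_ξ̂` and equals `H̃_{⟦ξ,ζ⟧} + K̃_{ξ,ζ}`. -/
theorem mainTheorem6 {n : ℕ}
    {W : Type*} [NormedAddCommGroup W] [NormedSpace ℝ W] [FiniteDimensional ℝ W]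
    (T : TensorType (n + 3) W)
    {M : Type*} [TopologicalSpace M] [T2Space M] [SecondCountableTopology M]
    [ChartedSpace (Euc (n + 3)) M] [IsManifold 𝓘(ℝ, Euc (n + 3)) ∞ M]
    {N : Type*} [TopologicalSpace N]
    [ChartedSpace (Euc (n + 2)) N] [IsManifold 𝓘(ℝ, Euc (n + 2)) ∞ N]
    (U : Set M) (hU : IsOpen U)
    (ν : N → M) (hν : Manifold.IsSmoothEmbedding 𝓘(ℝ, Euc (n + 2)) 𝓘(ℝ, Euc (n + 3)) ∞ ν)
    (hνU : ∀ y, ν y ∈ frontier U)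
    (Th : LagrangianTheory T M) (P : NoetherPotential Th U) (B : BoundaryData N Th ν)
    (slice : Chain (n + 3) (n + 2) M) (cut : Chain (n + 2) (n + 1) N)
    (hslice : ∀ σ ∈ slice.support, ∀ t ∈ Set.Icc (0 : Fin (n + 2) → ℝ) 1, σ.map t ∈ closure U)
    (hcut : slice.boundary = cut.push ν hν.contMDiff)
    (ξ ζ : (M → W) → VField (n + 3) M) (hξ : IsGenerator (l := n + 2) T ν ξ) (hζ : IsGenerator (l := n + 2) T ν ζ)
    (φ : M → W) (hφ : φ ∈ Th.Solutions U) :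
    B.bracketBT P cut slice ξ ζ φ =
        B.impCharge P cut (modBracket T ξ ζ) φ + B.extensionK cut ξ ζ φ ∧
      HasDerivAt (fun t : ℝ => B.impCharge P cut ζ (φ + t • hat T ξ φ))
        (B.impFlux P cut ξ φ (hat T ζ φ) - B.bracketBT P cut slice ξ ζ φ) 0 := by
  have hi := hν.isImmersion
  have hc : cut.boundary = 0 :=
    Chain.boundary_eq_zero_of_push hν.contMDiff hν.isEmbedding.injective hcut
  have hu := hξ.smoothTangent hφ.1
  have hv := hζ.smoothTangent hφ.1
  have hY : SmoothField T (hat T ξ φ) := hξ.isSmoothGen.smoothField_hat hφ.1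
  have hX : SmoothField T (hat T ζ φ) := hζ.isSmoothGen.smoothField_hat hφ.1
  have hbr : B.bracketBT P cut slice ξ ζ φ =
      cut.integral (B.sympDensity P φ (ξ φ) (ζ φ)) -
        cut.integral (B.fluxDensity P ζ φ (hat T ξ φ)) +
        cut.integral (B.fluxDensity P ξ φ (hat T ζ φ)) := by
    unfold BoundaryData.bracketBT
    rw [B.impFlux_eq P cut hζ hφ.1 hY, B.impFlux_eq P cut hξ hφ.1 hX,
      ← B.sympForm_eq P hi hU hφ hu hv hslice hcut]
    rfl
  constructor
  · have s1 := B.smoothField_fluxDensity P hi hζ hφ.1 hY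
    have s2 := B.smoothField_sympDensity P hi hφ.1 hu hv
    have s3 := B.smoothField_fluxDensity P hi hξ hφ.1 hX
    have hu' := SmoothField.restrictVF hi hu.smooth hu.tangentAt
    have hv' := SmoothField.restrictVF hi hv.smooth hv.tangentAt
    have hℬ := B.local_totalBoundaryTerm hi.contMDiff
    have hb := hu.vfBracket hi hv
    have s4 := B.smoothField_impDensity P hi hφ.1
      ((hb.sub (hζ.smoothTangent_fieldDeriv hi hφ.1 hY)).add
        (hξ.smoothTangent_fieldDeriv hi hφ.1 hX))
    have s5 := (hu'.contract ((hℬ.smoothField_fieldDeriv hφ.1 hX).sub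
      (hv'.lieForm (hℬ.smoothField hφ.1)))).sub
      (hv'.contract ((hℬ.smoothField_fieldDeriv hφ.1 hY).sub (hu'.lieForm (hℬ.smoothField hφ.1))))
    have s6 := ((((B.local_γ.smoothField_delta1 hφ.1 hX hY).neg.sub
      (hv'.contract (B.local_ε.localLin.smoothField hφ.1 hY))).add
      (hu'.contract (B.local_ε.localLin.smoothField hφ.1 hX))).sub
      (hu'.contract (hv'.contract (hℬ.smoothField hφ.1)))).sub
      (B.smoothField_cornerDensity hi hφ.1 hb)
    -- The three integrals over the cut are merged into one so that the pointwise identity applies;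
    -- the facts `s1` to `s6` supply the smoothness needed to split the result and to discard its
    -- exact part.
    rw [hbr, ← cut.integral_sub s2 s1, ← cut.integral_add (s2.sub s1) s3,
      B.charge_algebra P hi hφ.1 hξ hζ]
    refine (cut.integral_add (s4.add s5) s6.dForm).trans ?_
    rw [Chain.integral_dForm_eq_zero hc s6, add_zero]
    exact cut.integral_add s4 s5
  -- That `N` lies in the closure of `U` is what makes `dQ = J` available on it.
  · refine (B.hasDerivAt_impCharge P hi (fun y => frontier_subset_closure (hνU y)) hφ hξ hζ
      hc).congr_deriv ?_
    rw [hbr, B.impFlux_eq P cut hξ hφ.1 hX]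
    ring
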